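/- For $\mathbf s=(s_1,\dots,s_6)$ let $$\zeta_3(\mathbf s;A_3)=\zeta_3(\mathbf s;SU(4))=\sum_{l,m,n=1}^\infty \frac{1}{l^{s_1}m^{s_2}n^{s_3}(l+m)^{s_4}(m+n)^{s_5}(l+m+n)^{s_6}}$$ be the zeta-function of the root system of type $A_3$, and for $P,Q\in\mathbb N=\{1,2,3,\dots\}$ let $$\mathfrak T(P,s,Q;x,y)=\sum_{\substack{l\in\mathbb Z\setminus\{0\},\ m\ge 1\\ l+m\neq 0}}\frac{x^l y^m}{l^{P}m^{s}(l+m)^{Q}} .$$ Let $p,q,a,b,c\in\mathbb N$. Each of the twelve functions $\zeta_3(\,\cdot\,;A_3)$ of $s$ on the left-hand side below, and each function $s\mapsto\mathfrak T(P,s,Q;1,1)$ with $P,Q\in\mathbb N$, is given by an absolutely convergent series in some right half-plane and has a meromorphic continuation in $s$ to $\mathbb C$. With these continuations, $$\begin{aligned} &\zeta_3((p,q,s,a,b,c);A_3)+(-1)^{p}\zeta_3((p,a,s,q,c,b);A_3)\\ &+(-1)^{p+a}\zeta_3((q,a,c,p,s,b);A_3)+(-1)^{p+a+c}\zeta_3((q,s,c,b,a,p);A_3)\\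 &+(-1)^{q}\zeta_3((a,q,b,p,s,c);A_3)+(-1)^{q+b}\zeta_3((a,s,b,c,q,p);A_3)\\ &+(-1)^{q+a}\zeta_3((a,p,b,q,c,s);A_3)+(-1)^{q+a+b}\zeta_3((a,c,b,s,p,q);A_3)\\ &+(-1)^{q+a+b+c}\zeta_3((s,c,p,a,b,q);A_3)+(-1)^{p+q+a}\zeta_3((q,p,c,a,b,s);A_3)\\ &+(-1)^{p+q+a+c}\zeta_3((q,b,c,s,p,a);A_3)+(-1)^{p+q+a+b+c}\zeta_3((s,b,p,q,c,a);A_3)\\ &=2(-1)^{p}\sum_{j=0}^{\lfloor p/2\rfloor}\zeta(2j)\sum_{\omega=0}^{p-2j}\binom{\omega+a-1}{\omega}\binom{p+c-2j-\omega-1}{c-1}\,\mathfrak T(q+a+\omega,\,s,\,p+b+c-2j-\omega;1,1)\\ &\quad+2(-1)^{p+a}\sum_{j=0}^{\lfloor c/2\rfloor}\zeta(2j)\sum_{\omega=0}^{c-2j}\binom{\omega+a-1}{\omega}\binom{p+c-2j-\omega-1}{p-1}\,\mathfrak T(q,\,s+a+\omega,\,p+b+c-2j-\omega;1,1)\\ &\quad+2(-1)^{p}\sum_{j=0}^{\lfloor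 a/2\rfloor}\zeta(2j)\sum_{\omega=0}^{p-1}\binom{\omega+a-2j}{\omega}\binom{p+c-2-\omega}{c-1}\,\mathfrak T(q+a-2j+\omega+1,\,s,\,p+b+c-1-\omega;1,1)\\ &\quad+2(-1)^{p+a}\sum_{j=0}^{\lfloor a/2\rfloor}\zeta(2j)\sum_{\omega=0}^{c-1}\binom{\omega+a-2j}{\omega}\binom{p+c-2-\omega}{p-1}\,\mathfrak T(q,\,s+a-2j+\omega+1,\,p+b+c-1-\omega;1,1) \end{aligned}$$ holds for every $s\in\mathbb C$ that is not a singularity of any of the functions of $s$ on either side. Moreover the right-hand side is expressed by the Riemann zeta-function: for $P,Q\in\mathbb N$, $$\mathfrak T(P,s,Q;1,1)=2(-1)^P\sum_{k=0}^{\lfloor P/2\rfloor}\zeta(2k)\binom{P+Q-1-2k}{Q-1}\zeta(s+P+Q-2k)+2(-1)^P\sum_{k=0}^{\lfloor Q/2\rfloor}\zeta(2k)\binom{P+Q-1-2k}{P-1}\zeta(s+P+Q-2k)$$ for all $s\in\mathbb C$ with $s+P+Q-2k\ne 1$ for $0\le k\le\lfloor\max(P,Q)/2\rfloor$. -/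

import Mathlib

/-- `F` is the meromorphic continuation to the whole plane of the function of `s` which, on some
right half-plane, is the sum of the (unconditionally, hence absolutely) convergent series
`∑ i, f i s`. The normal form fixes the values: removable singularities are filled in, and
the value at a pole is the conventional `0`. -/
def IsMeromorphicContinuation {ι : Type} (f : ι → ℂ → ℂ) (F : ℂ → ℂ) : Prop :=
  MeromorphicNFOn F Set.univ ∧ ∃ σ : ℝ, ∀ s : ℂ, σ < s.re → HasSum (fun i => f i s) (F s)

/-- The meromorphic continuation is unique. -/
theorem IsMeromorphicContinuation.unique {ι : Type} {f : ι → ℂ → ℂ} {F G : ℂ → ℂ}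
    (hF : IsMeromorphicContinuation f F) (hG : IsMeromorphicContinuation f G) : F = G := by
  obtain ⟨hF, σ, hσ⟩ := hF
  obtain ⟨hG, τ, hτ⟩ := hG
  have hsub : MeromorphicOn (F - G) Set.univ := hF.meromorphicOn.sub hG.meromorphicOn
  let y : ℂ := ((max σ τ + 1 : ℝ) : ℂ)
  have hy : meromorphicOrderAt (F - G) y = ⊤ := by
    rw [meromorphicOrderAt_eq_top_iff]
    apply Filter.Eventually.filter_mono nhdsWithin_le_nhds
    have ho : IsOpen {z : ℂ | max σ τ < z.re} := isOpen_lt continuous_const Complex.continuous_re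
    filter_upwards [ho.mem_nhds (show y ∈ {z : ℂ | max σ τ < z.re} from
      lt_add_one (max σ τ))] with z hz
    have h1 := hσ z (lt_of_le_of_lt (le_max_left _ _) hz)
    have h2 := hτ z (lt_of_le_of_lt (le_max_right _ _) hz)
    simp [h1.unique h2]
  funext x
  have hx : meromorphicOrderAt (F - G) x = ⊤ := by
    by_contra h
    exact hsub.meromorphicOrderAt_ne_top_of_isPreconnected isPreconnected_univ
      (Set.mem_univ x) (Set.mem_univ y) h hy
  rw [meromorphicOrderAt_eq_top_iff] at hx
  have hFG : F =ᶠ[nhdsWithin x {x}ᶜ] G := by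
    filter_upwards [hx] with z hz
    exact sub_eq_zero.mp hz
  exact (((hF (Set.mem_univ x)).eventuallyEq_nhdsNE_iff_eventuallyEq_nhds
    (hG (Set.mem_univ x))).mp hFG).eq_of_nhds

open Classical in
/-- The meromorphic continuation in `s` of the series `∑ i, f i s`
(the zero function when there is none). -/
noncomputable def meromorphicContinuation {ι : Type} (f : ι → ℂ → ℂ) : ℂ → ℂ :=
  if h : ∃ F, IsMeromorphicContinuation f F then h.choose else 0

/-- The `(l, m, n)`-term, `l, m, n ≥ 1`, of the zeta-function of the root system of type `A₃`. -/
noncomputable def zetaA3Term (x : ℕ+ × ℕ+ × ℕ+) (s : Fin 6 → ℂ) : ℂ :=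
  let l : ℂ := ((x.1 : ℕ) : ℂ)
  let m : ℂ := ((x.2.1 : ℕ) : ℂ)
  let n : ℂ := ((x.2.2 : ℕ) : ℂ)
  1 / (l ^ s 0 * m ^ s 1 * n ^ s 2 * (l + m) ^ s 3 * (m + n) ^ s 4 * (l + m + n) ^ s 5)

/-- The zeta-function `ζ₃(· ; A₃) = ζ₃(· ; SU(4))` along a one-parameter family `e` of exponents:
the meromorphic continuation in `s` of `ζ₃(e s; A₃)`. -/
noncomputable def zetaA3 (e : ℂ → Fin 6 → ℂ) : ℂ → ℂ :=
  meromorphicContinuation (fun (x : ℕ+ × ℕ+ × ℕ+) s => zetaA3Term x (e s))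

/-- The pairs `(l, m)` with `l ≠ 0`, `m ≥ 1`, `l + m ≠ 0`. -/
abbrev TornheimIndex : Type := {x : ℤ × ℕ+ // x.1 ≠ 0 ∧ x.1 + ((x.2 : ℕ) : ℤ) ≠ 0}

/-- The `(l, m)`-term of the Tornheim type double sum `𝔗(p, s, q; x, y)`. -/
noncomputable def tornheimTerm (p q : ℕ) (x y : ℂ) (i : TornheimIndex) (s : ℂ) : ℂ :=
  let l : ℤ := i.1.1
  let m : ℕ := i.1.2
  x ^ l * y ^ m / ((l : ℂ) ^ p * (m : ℂ) ^ s * ((l : ℂ) + (m : ℂ)) ^ q)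

/-- The Tornheim type double sum `𝔗(p, s, q; x, y)`, continued meromorphically in `s`. -/
noncomputable def tornheimT (p : ℕ) (s : ℂ) (q : ℕ) (x y : ℂ) : ℂ :=
  meromorphicContinuation (tornheimTerm p q x y) s

/-- The twelve arrangements of the exponents `p, q, s, a, b, c` on the left-hand side, as
functions of the complex variable `s`. -/
def exponentsA3 (p q a b c : ℂ) : Fin 12 → ℂ → Fin 6 → ℂ :=
  ![fun s => ![p, q, s, a, b, c],
    fun s => ![p, a, s, q, c, b],
    fun s => ![q, a, c, p, s, b],
    fun s => ![q, s, c, b, a, p],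
    fun s => ![a, q, b, p, s, c],
    fun s => ![a, s, b, c, q, p],
    fun s => ![a, p, b, q, c, s],
    fun s => ![a, c, b, s, p, q],
    fun s => ![s, c, p, a, b, q],
    fun s => ![q, p, c, a, b, s],
    fun s => ![q, b, c, s, p, a],
    fun s => ![s, b, p, q, c, a]]

/-- The exponents of `-1` in front of the twelve terms of the left-hand side. -/
def signA3 (p q a b c : ℕ) : Fin 12 → ℕ :=
  ![0, p, p + a, p + a + c, q, q + b, q + a, q + a + b, q + a + b + c, p + q + a,
    p + q + a + c, p + q + a + b + c]

/-! For large real part of `s`, let `T` be the sum over integers `N ≥ 1`, `m`, `l` of `1 / (l^p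
(l+m)^a (l+m+N)^c m^q (m+N)^b N^s)`. The six factors are the positive roots of type A₃ in the
coordinates `l, m, N`. Since `0⁻¹ = 0` and all integer exponents are positive, points on the root
hyperplanes contribute nothing. The sum converges absolutely for `4 < re s`
(`summable_latticeTerm`), and both sides of the relation are evaluations of it.

Chambers: the half space `N > 0` contains twelve of the twenty-four Weyl chambers. On each of them
the six roots are, up to sign and order, `x, y, z, x+y, y+z, x+y+z` with positive integers `x, y,
z`, so the chamber contributes a sign times a value of `ζ₃(· ; A₃)` (`chamber_injective`,
`exists_chamber_eq`, `latticeTerm_chamber`).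

Lines: with `m` and `N` fixed, the sum over `l` is that of a rational function over the integers
that are not its poles. Partial fractions turn it into the symmetric sums of `1 / l^i`, which are
`2ζ(i)` for even `i` and `0` for odd `i`. Poles are left out of the sum, so each also subtracts the
constant term of the expansion there, which is the weight `2ζ(0) = -1` (`hasSum_symmetricIcc_prod`).
Three poles give `hasSum_line_three`, and summing the result over `m` and `N` produces the double
sums `𝔗` with shifted exponents. Two poles give `hasSum_line_two`, hence the formula for `𝔗` in
terms of `ζ`, which also continues `𝔗`.

Continuation of the `ζ₃`: grouping the terms by the linear form that carries `s` makes each function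
a Dirichlet series. Its coefficients lie in the class `IsHarmonic` generated by iterated harmonic
sums: the class is closed under products, convolutions and tail sums, and partial fractions reduce
the coefficients to these. The Dirichlet series of such a sequence continues meromorphically
(`IsHarmonic.extendsMeromorphically`): the first difference of an iterated sum is a simpler
sequence, and the binomial expansion of `(1 - 1/n)^(-s)` converts this into a recursion that moves
left one unit at a time.

The relation then passes from a half-plane to the whole plane by the identity theorem. -/

section

open Filter Topology

/-! ### Partial fractions for two factors with a given sum. -/

/-- Partial fractions of `1 / (u ^ (p + 1) * v ^ (c + 1))` where `u + v = y`. -/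
theorem partialFraction_aux {K : Type*} [Field K] {u v y : K} (hu : u ≠ 0) (hv : v ≠ 0)
    (hy : y ≠ 0) (huv : u + v = y) (P C : ℕ) :
    (u⁻¹) ^ (P + 1) * (v⁻¹) ^ (C + 1) =
      ∑ k ∈ Finset.range (P + 1), ((C + k).choose C : K) * (u⁻¹) ^ (P + 1 - k) *
          (y⁻¹) ^ (C + 1 + k) +
        ∑ k ∈ Finset.range (C + 1), ((P + k).choose P : K) * (v⁻¹) ^ (C + 1 - k) *
          (y⁻¹) ^ (P + 1 + k) := by
  have key : u⁻¹ * v⁻¹ = y⁻¹ * (u⁻¹ + v⁻¹) := by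
    subst huv; field_simp; ring
  -- Pascal's rule on the coefficients. It reproduces the recursion that `key` gives for `u⁻¹ ^ (P +
  -- 2) * v⁻¹ ^ (C + 2)` from the two products with one exponent lowered; `step0` and `single` are
  -- its degenerate forms when an exponent is `1`.
  have step : ∀ (u v : K) (P C : ℕ),
      ∑ k ∈ Finset.range (P + 2), ((C + 1 + k).choose (C + 1) : K) * (u⁻¹) ^ (P + 2 - k) *
          (y⁻¹) ^ (C + 2 + k) =
      y⁻¹ * (∑ k ∈ Finset.range (P + 1), ((C + 1 + k).choose (C + 1) : K) * (u⁻¹) ^ (P + 1 - k) *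
          (y⁻¹) ^ (C + 2 + k) + ∑ k ∈ Finset.range (P + 2), ((C + k).choose C : K) *
          (u⁻¹) ^ (P + 2 - k) * (y⁻¹) ^ (C + 1 + k)) := by
    intro u v P C
    rw [Finset.sum_range_succ' _ (P + 1), Finset.sum_range_succ' (fun k => ((C + k).choose C : K) *
          (u⁻¹) ^ (P + 2 - k) * (y⁻¹) ^ (C + 1 + k)) (P + 1), ← add_assoc,
      ← Finset.sum_add_distrib, mul_add, Finset.mul_sum]
    congr 1
    · refine Finset.sum_congr rfl fun k hk => ?_
      have h1 : C + 1 + (k + 1) = (C + 1 + k) + 1 := by ring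
      have h2 : C + (k + 1) = C + 1 + k := by ring
      rw [h1, Nat.choose_succ_succ, h2]
      rw [show P + 2 - (k + 1) = P + 1 - k by omega, show C + 2 + (k + 1) = C + 2 + k + 1 by ring,
        show C + 1 + 1 + k = C + 2 + k by ring]
      push_cast
      rw [Nat.succ_eq_add_one]
      ring
    · simp
      ring
  have step0 : ∀ (u v : K) (P : ℕ),
      ∑ k ∈ Finset.range (P + 2), ((0 + k).choose 0 : K) * (u⁻¹) ^ (P + 2 - k) *
          (y⁻¹) ^ (0 + 1 + k) =
      y⁻¹ * (∑ k ∈ Finset.range (P + 1), ((0 + k).choose 0 : K) * (u⁻¹) ^ (P + 1 - k) *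
          (y⁻¹) ^ (0 + 1 + k) + (u⁻¹) ^ (P + 2)) := by
    intro u v P
    rw [Finset.sum_range_succ' _ (P + 1), mul_add, Finset.mul_sum]
    congr 1
    · refine Finset.sum_congr rfl fun k hk => ?_
      rw [show P + 2 - (k + 1) = P + 1 - k by omega]
      simp
      ring
    · simp
      ring
  have single : ∀ (v : K) (P : ℕ),
      ∑ k ∈ Finset.range (0 + 1), ((P + 1 + k).choose (P + 1) : K) * (v⁻¹) ^ (0 + 1 - k) *
          (y⁻¹) ^ (P + 1 + 1 + k) =
      y⁻¹ * ∑ k ∈ Finset.range (0 + 1), ((P + k).choose P : K) * (v⁻¹) ^ (0 + 1 - k) *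
          (y⁻¹) ^ (P + 1 + k) := by
    intro v P
    simp
    ring
  induction P generalizing C with
  | zero =>
    induction C with
    | zero => simp [key]; ring
    | succ C ih =>
      rw [step0 v u C, single u C]
      rw [zero_add] at ih ⊢
      linear_combination v⁻¹ ^ (C + 1) * key + y⁻¹ * ih
  | succ P ihP =>
    induction C with
    | zero =>
      have := ihP 0
      rw [step0 u v P, single v P]
      linear_combination u⁻¹ ^ (P + 1) * key + y⁻¹ * this
    | succ C ih =>
      have := ihP (C + 1)
      rw [step u v P C, step v u C P]
      linear_combination u⁻¹ ^ (P + 1) * v⁻¹ ^ (C + 1) * key + y⁻¹ * this + y⁻¹ * ih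

/-- Partial fractions of `1 / (u ^ p * v ^ c)` where `u + v = y`. -/
theorem partialFraction {K : Type*} [Field K] {u v y : K} (hu : u ≠ 0) (hv : v ≠ 0)
    (hy : y ≠ 0) (huv : u + v = y) {p c : ℕ} (hp : 1 ≤ p) (hc : 1 ≤ c) :
    (u⁻¹) ^ p * (v⁻¹) ^ c =
      ∑ ω ∈ Finset.range p, ((p + c - 2 - ω).choose (c - 1) : K) * (u⁻¹) ^ (ω + 1) *
          (y⁻¹) ^ (p + c - 1 - ω) +
        ∑ ω ∈ Finset.range c, ((p + c - 2 - ω).choose (p - 1) : K) * (v⁻¹) ^ (ω + 1) *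
          (y⁻¹) ^ (p + c - 1 - ω) := by
  obtain ⟨P, rfl⟩ : ∃ P, p = P + 1 := ⟨p - 1, by omega⟩
  obtain ⟨C, rfl⟩ : ∃ C, c = C + 1 := ⟨c - 1, by omega⟩
  rw [partialFraction_aux hu hv hy huv, ← Finset.sum_range_reflect,
    ← Finset.sum_range_reflect _ (C + 1)]
  congr 1
  · refine Finset.sum_congr rfl fun k hk => ?_
    have := Finset.mem_range.mp hk
    rw [show C + (P + 1 - 1 - k) = P + 1 + (C + 1) - 2 - k by omega,
      show P + 1 - (P + 1 - 1 - k) = k + 1 by omega,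
      show C + 1 + (P + 1 - 1 - k) = P + 1 + (C + 1) - 1 - k by omega, Nat.add_sub_cancel]
  · refine Finset.sum_congr rfl fun k hk => ?_
    have := Finset.mem_range.mp hk
    rw [show P + (C + 1 - 1 - k) = P + 1 + (C + 1) - 2 - k by omega,
      show C + 1 - (C + 1 - 1 - k) = k + 1 by omega,
      show P + 1 + (C + 1 - 1 - k) = P + 1 + (C + 1) - 1 - k by omega, Nat.add_sub_cancel]

/-! ### Symmetric sums of inverse powers over the integers. -/

open SummationFilter in
/-- The symmetric sum over `ℤ` of `1 / (l - x) ^ r` does not depend on `x`. -/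
theorem hasSum_symmetricIcc_inv_sub_pow (x : ℤ) {r : ℕ} (hr : 1 ≤ r) {S : ℂ}
    (h : HasSum (fun l : ℤ => ((l : ℂ)⁻¹) ^ r) S (symmetricIcc ℤ)) :
    HasSum (fun l : ℤ => (((l : ℂ) - x)⁻¹) ^ r) S (symmetricIcc ℤ) := by
  have hlim : ∀ y : ℤ, ∀ ε : ℤ, IsUnit ε →
      Tendsto (fun L : ℕ => (((ε * (L : ℤ) - y : ℤ) : ℂ)⁻¹) ^ r) atTop (𝓝 0) := by
    intro y ε hε
    have h0 : Tendsto (fun L : ℕ => ((ε * (L : ℤ) - y : ℤ) : ℂ)⁻¹) atTop (𝓝 0) := by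
      refine tendsto_inv₀_cobounded.comp ?_
      rw [← tendsto_norm_atTop_iff_cobounded]
      have h1 : Tendsto (fun L : ℕ => (L : ℝ) - |(y : ℝ)|) atTop atTop :=
        tendsto_atTop_add_const_right _ _ tendsto_natCast_atTop_atTop
      refine tendsto_atTop_mono (fun L => ?_) h1
      rw [Complex.norm_intCast]
      rcases Int.isUnit_iff.mp hε with rfl | rfl
      · push_cast
        have := abs_sub_abs_le_abs_sub (L : ℝ) y
        simp only [Nat.abs_cast, one_mul] at this ⊢
        linarith
      · push_cast
        have := abs_sub_abs_le_abs_sub (-(L : ℝ)) y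
        simp only [abs_neg, Nat.abs_cast] at this ⊢
        linarith [show |-1 * (L : ℝ) - y| = |-(L : ℝ) - y| by ring_nf]
    simpa [show r ≠ 0 by omega] using h0.pow r
  -- Shifting by one moves the window `[-L, L]` by one place: one term enters at the left end, one
  -- leaves at the right end, and both tend to `0`.
  have key : ∀ y : ℤ, Tendsto (fun L : ℕ =>
      ∑ l ∈ Finset.Icc (-(L : ℤ)) L, (((l : ℂ) - (y + 1 : ℤ))⁻¹) ^ r -
      ∑ l ∈ Finset.Icc (-(L : ℤ)) L, (((l : ℂ) - y)⁻¹) ^ r) atTop (𝓝 0) := by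
    intro y
    have h3 := (hlim (y + 1) (-1) (by simp)).sub (hlim y 1 (by simp))
    rw [sub_zero] at h3
    refine h3.congr fun L => ?_
    induction L with
    | zero =>
      have h0 : (((-1 * ((0 : ℕ) : ℤ) - (y + 1) : ℤ) : ℂ)⁻¹) = ((0 : ℂ) - (y + 1 : ℤ))⁻¹ := by
        push_cast; ring_nf
      have h1 : (((1 * ((0 : ℕ) : ℤ) - y : ℤ) : ℂ)⁻¹) = ((0 : ℂ) - y)⁻¹ := by
        push_cast; ring_nf
      rw [h0, h1]
      simp
      rw [← inv_pow, inv_neg]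
    | succ L ih =>
      have hI : Finset.Icc (-((L + 1 : ℕ) : ℤ)) ((L + 1 : ℕ) : ℤ) =
          insert (-((L + 1 : ℕ) : ℤ)) (insert (((L + 1 : ℕ) : ℤ)) (Finset.Icc (-(L : ℤ)) L)) := by
        ext z; simp only [Finset.mem_Icc, Finset.mem_insert]; push_cast; omega
      rw [hI, Finset.sum_insert, Finset.sum_insert, Finset.sum_insert, Finset.sum_insert]
      · rw [eq_sub_iff_add_eq] at ih
        rw [← ih]
        push_cast
        ring_nf
      all_goals simp only [Finset.mem_Icc, Finset.mem_insert]; push_cast; omega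
  have hcong : ∀ y : ℤ, HasSum (fun l : ℤ => (((l : ℂ) - y)⁻¹) ^ r) S (symmetricIcc ℤ) ↔
      HasSum (fun l : ℤ => (((l : ℂ) - (y + 1 : ℤ))⁻¹) ^ r) S (symmetricIcc ℤ) := by
    intro y
    simp only [HasSum, symmetricIcc_eq_map_Icc_nat, tendsto_map'_iff, Function.comp_def]
    constructor
    · intro h
      simpa using (key y).add h
    · intro h
      simpa using h.sub (key y)
  induction x using Int.induction_on with
  | zero => simpa using h
  | succ n ih => exact (hcong n).mp ih
  | pred n ih =>
    rw [hcong]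
    simpa using ih

/-- The weight `2 ζ(i)` for even `i`, and `0` for odd `i`. -/
noncomputable def evenZeta (i : ℕ) : ℂ := if Even i then 2 * riemannZeta i else 0

-- For even `r` the series converges absolutely and is twice the zeta value. For odd `r` the
-- substitution `l ↦ -l` makes every symmetric partial sum vanish. The case `r = 1` is not
-- absolutely summable, and it is what forces symmetric summation on everything built from these
-- sums.
open SummationFilter in
theorem hasSum_symmetricIcc_inv_pow {r : ℕ} (hr : 1 ≤ r) :
    HasSum (fun l : ℤ => ((l : ℂ)⁻¹) ^ r) (evenZeta r) (symmetricIcc ℤ) := by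
  rcases Nat.even_or_odd r with he | ho
  · have h2 : 2 ≤ r := by rcases he with ⟨k, rfl⟩; omega
    have hs : Summable (fun l : ℤ => ((l : ℂ)⁻¹) ^ r) := by
      refine Summable.of_norm ?_
      have := (Real.summable_one_div_int_pow (p := r)).mpr (by omega)
      refine this.abs.congr fun l => ?_
      simp [abs_inv]
    have := two_mul_riemannZeta_eq_tsum_int_inv_pow_of_even h2 he
    rw [evenZeta, if_pos he, this]
    simp only [inv_pow] at hs ⊢
    exact Filter.Tendsto.mono_left hs.hasSum (SummationFilter.LeAtTop.le_atTop (L := symmetricIcc ℤ))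
  · rw [evenZeta, if_neg (by simpa using ho)]
    simp only [HasSum, symmetricIcc_eq_map_Icc_nat, tendsto_map'_iff, Function.comp_def]
    refine tendsto_const_nhds.congr fun L => ?_
    symm
    have : ∑ l ∈ Finset.Icc (-(L : ℤ)) L, ((l : ℂ)⁻¹) ^ r =
        ∑ l ∈ Finset.Icc (-(L : ℤ)) L, (((-l : ℤ) : ℂ)⁻¹) ^ r :=
      Finset.sum_bij' (fun l _ => -l) (fun l _ => -l) (by simp; omega) (by simp; omega)
        (by simp) (by simp) (by simp)
    have h2 : ∀ l : ℤ, (((-l : ℤ) : ℂ)⁻¹) ^ r = -(((l : ℂ)⁻¹) ^ r) := by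
      intro l
      rw [Int.cast_neg, inv_neg, ho.neg_pow]
    simp only [h2, Finset.sum_neg_distrib] at this
    exact self_eq_neg.mp this

/-! ### Sums of rational functions over the integers from their polar parts. -/

section LineSum
variable {ι : Type*} [Fintype ι]

/-- The Laurent expansion at the point `c` of `∏ i, 1 / (t - x i) ^ n i`. -/
noncomputable def laurentAt (x : ι → ℤ) (n : ι → ℕ) (c : ℤ) : LaurentSeries ℂ :=
  ∏ i, (HahnSeries.single (1 : ℤ) (1 : ℂ) + HahnSeries.C ((c : ℂ) - x i))⁻¹ ^ n i

/-- The sum over the poles of the polar parts, including the constant terms, with the monomial of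
degree `-i` replaced by `evenZeta i`. -/
noncomputable def polarSum (x : ι → ℤ) (M : ℕ) (n : ι → ℕ) : ℂ :=
  ∑ j, ∑ i ∈ Finset.range M, evenZeta i * (laurentAt x n (x j)).coeff (-(i : ℤ))

theorem single_add_C_ne_zero (c : ℂ) :
    HahnSeries.single (1 : ℤ) (1 : ℂ) + HahnSeries.C c ≠ 0 := by
  intro h
  have := congrArg (fun f : LaurentSeries ℂ => f.coeff 1) h
  simp [HahnSeries.C_apply] at this

theorem prod_pow_add_single {K : Type*} [CommMonoid K] [DecidableEq ι] (w : ι → K) (m : ι → ℕ)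
    (j : ι) : ∏ i, w i ^ (m + Pi.single j 1 : ι → ℕ) i = (∏ i, w i ^ m i) * w j := by
  simp only [Pi.add_apply, pow_add, Finset.prod_mul_distrib]
  congr 1
  rw [Finset.prod_eq_single j]
  · simp
  · intro b _ hb; simp [hb]
  · simp

/-- The power series of `1 / (d + t) ^ (a + 1)`. -/
theorem inv_single_add_C_pow {d : ℂ} (hd : d ≠ 0) (a : ℕ) :
    (HahnSeries.single (1 : ℤ) (1 : ℂ) + HahnSeries.C d : LaurentSeries ℂ)⁻¹ ^ (a + 1) =
      ((PowerSeries.mk fun k => (-1 : ℂ) ^ k * ((a + k).choose a : ℂ) * d⁻¹ ^ (a + 1 + k) :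
        PowerSeries ℂ) : LaurentSeries ℂ) := by
  have h1 : (PowerSeries.mk fun k => (-1 : ℂ) ^ k * ((a + k).choose a : ℂ) * d⁻¹ ^ (a + 1 + k)) =
      PowerSeries.C (d⁻¹ ^ (a + 1)) *
        (PowerSeries.rescale (-d⁻¹) (PowerSeries.mk 1 : PowerSeries ℂ)) ^ (a + 1) := by
    rw [← map_pow, PowerSeries.mk_one_pow_eq_mk_choose_add]
    ext k
    rw [PowerSeries.coeff_mk, PowerSeries.coeff_C_mul, PowerSeries.coeff_rescale,
      PowerSeries.coeff_mk, neg_pow d⁻¹]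
    ring
  have h2 : (PowerSeries.rescale (-d⁻¹) (PowerSeries.mk 1 : PowerSeries ℂ)) *
      (PowerSeries.X + PowerSeries.C d) = PowerSeries.C d := by
    have := congrArg (PowerSeries.rescale (-d⁻¹)) (PowerSeries.mk_one_mul_one_sub_eq_one ℂ)
    rw [map_mul, map_sub, map_one, PowerSeries.rescale_X] at this
    have h3 : PowerSeries.C d * (1 - PowerSeries.C (-d⁻¹) * PowerSeries.X) =
        PowerSeries.X + PowerSeries.C d := by
      rw [mul_sub, ← mul_assoc, ← map_mul]
      simp [hd]
      ring
    rw [← h3]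
    linear_combination PowerSeries.C d * this
  have h4 : (PowerSeries.mk fun k => (-1 : ℂ) ^ k * ((a + k).choose a : ℂ) * d⁻¹ ^ (a + 1 + k)) *
      (PowerSeries.X + PowerSeries.C d) ^ (a + 1) = 1 := by
    rw [h1, mul_assoc, ← mul_pow, h2, ← map_pow, ← map_mul, ← mul_pow, inv_mul_cancel₀ hd]
    simp
  have h5 := congrArg (HahnSeries.ofPowerSeries ℤ ℂ) h4
  rw [map_mul, map_pow, map_add, HahnSeries.ofPowerSeries_X, HahnSeries.ofPowerSeries_C,
    RingHom.map_one] at h5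
  rw [inv_pow]
  exact (eq_inv_of_mul_eq_one_left h5).symm

/-- This is `(x k - x j) / ((t - x j) (t - x k)) = 1 / (t - x k) - 1 / (t - x j)`, expanded at an
arbitrary centre. -/
theorem laurentAt_recursion [DecidableEq ι] (x : ι → ℤ) (m : ι → ℕ) (j k : ι) (c : ℤ) :
    HahnSeries.C ((x k : ℂ) - x j) * laurentAt x (m + Pi.single j 1 + Pi.single k 1) c =
      laurentAt x (m + Pi.single k 1) c - laurentAt x (m + Pi.single j 1) c := by
  simp only [laurentAt]
  rw [prod_pow_add_single, prod_pow_add_single, prod_pow_add_single]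
  have hj := single_add_C_ne_zero ((c : ℂ) - x j)
  have hk := single_add_C_ne_zero ((c : ℂ) - x k)
  have : (HahnSeries.C ((x k : ℂ) - x j) : LaurentSeries ℂ) =
      (HahnSeries.single (1 : ℤ) (1 : ℂ) + HahnSeries.C ((c : ℂ) - x j)) -
      (HahnSeries.single (1 : ℤ) (1 : ℂ) + HahnSeries.C ((c : ℂ) - x k)) := by
    rw [add_sub_add_left_eq_sub, ← map_sub]; congr 1; ring
  rw [this]
  field_simp

/-- Taking polar coefficients is linear, so the polar sum obeys the same recursion as the rational
function. This is what drives the induction on the total pole order. -/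
theorem polarSum_recursion [DecidableEq ι] (x : ι → ℤ) (M : ℕ) (m : ι → ℕ) (j k : ι) :
    ((x k : ℂ) - x j) * polarSum x M (m + Pi.single j 1 + Pi.single k 1) =
      polarSum x M (m + Pi.single k 1) - polarSum x M (m + Pi.single j 1) := by
  simp only [polarSum]
  rw [Finset.mul_sum, ← Finset.sum_sub_distrib]
  refine Finset.sum_congr rfl fun i _ => ?_
  rw [Finset.mul_sum, ← Finset.sum_sub_distrib]
  refine Finset.sum_congr rfl fun r _ => ?_
  have := congrArg (fun f : LaurentSeries ℂ => f.coeff (-(r : ℤ)))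
    (laurentAt_recursion x m j k (x i))
  simp only [HahnSeries.C_mul_eq_smul, HahnSeries.coeff_smul, HahnSeries.coeff_sub, smul_eq_mul] at this
  rw [← mul_sub, ← this]
  ring

open SummationFilter in
/-- The symmetric sum of `∏ i, 1 / (l - x i) ^ n i` over the integers that are not poles. -/
theorem hasSum_symmetricIcc_prod (x : ι → ℤ) (hx : Function.Injective x) (M : ℕ) (n : ι → ℕ)
    (hM : ∀ i, n i < M) (hn : n ≠ 0) :
    HasSum ((Set.range x)ᶜ.indicator fun l : ℤ => ∏ i, (((l : ℂ) - x i)⁻¹) ^ n i)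
      (polarSum x M n) (symmetricIcc ℤ) := by
  classical
  induction hd : ∑ i, n i using Nat.strong_induction_on generalizing n with
  | _ d ih =>
  by_cases hjk : ∃ j k, j ≠ k ∧ n j ≠ 0 ∧ n k ≠ 0
  · obtain ⟨j, k, hjk, hj, hk⟩ := hjk
    -- Two distinct poles: take one factor off each. The recursion then expresses the term through
    -- two products of smaller total order, and the polar sum follows it.
    obtain ⟨m, rfl⟩ : ∃ m : ι → ℕ, n = m + Pi.single j 1 + Pi.single k 1 := by
      refine ⟨n - Pi.single j 1 - Pi.single k 1, ?_⟩
      funext i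
      by_cases h1 : i = j
      · subst h1; simp [hjk]; omega
      · by_cases h2 : i = k
        · subst h2; simp [h1]; omega
        · simp [h1, h2]
    have hxk : (x k : ℂ) - x j ≠ 0 := by
      rw [sub_ne_zero]; exact_mod_cast fun h => hjk (hx h).symm
    have hle : ∀ i, (m + Pi.single k 1 : ι → ℕ) i < M ∧ (m + Pi.single j 1 : ι → ℕ) i < M := by
      intro i
      have := hM i
      simp only [Pi.add_apply] at this ⊢
      omega
    have hsum : ∀ (m : ι → ℕ) (i : ι), ∑ b, (m + Pi.single i 1 : ι → ℕ) b = ∑ b, m b + 1 := by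
      intro m i; simp [Finset.sum_add_distrib]
    rw [hsum, hsum] at hd
    have h1 := ih _ (by rw [hsum]; omega) (m + Pi.single k 1) (fun i => (hle i).1)
      (by intro h; simpa using congrFun h k) rfl
    have h2 := ih _ (by rw [hsum]; omega) (m + Pi.single j 1) (fun i => (hle i).2)
      (by intro h; simpa using congrFun h j) rfl
    have h3 := (h1.sub h2).mul_left ((x k : ℂ) - x j)⁻¹
    rw [← polarSum_recursion, inv_mul_cancel_left₀ hxk] at h3
    refine h3.congr_fun ?_
    intro l
    by_cases hl : l ∈ (Set.range x)ᶜ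
    · rw [Set.indicator_of_mem hl, Set.indicator_of_mem hl, Set.indicator_of_mem hl]
      rw [prod_pow_add_single, prod_pow_add_single, prod_pow_add_single]
      have hlj : (l : ℂ) - x j ≠ 0 := by
        rw [sub_ne_zero]; exact fun h => hl ⟨j, (Int.cast_injective h).symm⟩
      have hlk : (l : ℂ) - x k ≠ 0 := by
        rw [sub_ne_zero]; exact fun h => hl ⟨k, (Int.cast_injective h).symm⟩
      field_simp
      ring
    · rw [Set.indicator_of_notMem hl, Set.indicator_of_notMem hl, Set.indicator_of_notMem hl]
      simp
  -- Only one pole `x j` has positive order. The full symmetric sum is `evenZeta (n j)`, and the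
  -- values at all the listed points must be taken out of it, including points of order zero.
  · push Not at hjk
    obtain ⟨j, hj⟩ := Function.ne_iff.mp hn
    rw [Pi.zero_apply] at hj
    have hz : ∀ k, k ≠ j → n k = 0 := fun k hk => hjk j k hk.symm hj
    have hr : 1 ≤ n j := by omega
    have hprod : ∀ {K : Type} [CommMonoid K] (w : ι → K), ∏ i, w i ^ n i = w j ^ n j := by
      intro K _ w
      rw [Finset.prod_eq_single j]
      · intro b _ hb; simp [hz b hb]
      · simp
    have h1 := hasSum_symmetricIcc_inv_sub_pow (x j) hr (hasSum_symmetricIcc_inv_pow hr)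
    have hfin : HasSum (fun l : ℤ => if l ∈ Finset.univ.image x then
        (((l : ℂ) - x j)⁻¹) ^ n j else 0)
        (∑ i, (((x i : ℂ) - x j)⁻¹) ^ n j) (symmetricIcc ℤ) := by
      have := hasSum_sum_of_ne_finset_zero (L := unconditional ℤ)
        (f := fun l : ℤ => if l ∈ Finset.univ.image x then
        (((l : ℂ) - x j)⁻¹) ^ n j else 0) (s := Finset.univ.image x) (by
          intro b hb; simp only [if_neg hb])
      rw [Finset.sum_ite_mem, Finset.inter_self, Finset.sum_image (fun a _ b _ h => hx h)] at this
      exact Filter.Tendsto.mono_left this (SummationFilter.LeAtTop.le_atTop (L := symmetricIcc ℤ))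
    have h2 := h1.sub hfin
    -- At `x j` the expansion is a single monomial. At any other `x k` it is a power series, so only
    -- `i = 0` counts, and its weight `2ζ(0) = -1` subtracts precisely the value of the function at
    -- `x k`.
    have hval : polarSum x M n = evenZeta (n j) - ∑ i, (((x i : ℂ) - x j)⁻¹) ^ n j := by
      rw [polarSum, ← Finset.add_sum_erase _ _ (Finset.mem_univ j)]
      have ha : ∑ i ∈ Finset.range M, evenZeta i * (laurentAt x n (x j)).coeff (-(i : ℤ)) =
          evenZeta (n j) := by
        rw [Finset.sum_eq_single (n j)]
        · rw [laurentAt, hprod]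
          simp [HahnSeries.inv_single]
        · intro i _ hi
          rw [laurentAt, hprod]
          have : (-(i : ℤ)) ≠ -(n j : ℤ) := by omega
          simp [HahnSeries.inv_single, HahnSeries.coeff_single_of_ne this]
        · intro h; exact absurd (Finset.mem_range.mpr (hM j)) h
      rw [ha, sub_eq_add_neg, ← Finset.add_sum_erase _ (fun i => (((x i : ℂ) - x j)⁻¹) ^ n j)
        (Finset.mem_univ j)]
      congr 1
      simp only [sub_self, inv_zero, zero_pow (show n j ≠ 0 by omega), zero_add]
      rw [← Finset.sum_neg_distrib]
      refine Finset.sum_congr rfl fun k hk => ?_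
      have hkj : (x k : ℂ) - x j ≠ 0 := by
        rw [sub_ne_zero]; exact_mod_cast fun h => (Finset.ne_of_mem_erase hk) (hx h)
      obtain ⟨r, hr'⟩ : ∃ r, n j = r + 1 := ⟨n j - 1, by omega⟩
      rw [laurentAt, hprod, hr', inv_single_add_C_pow hkj, Finset.sum_eq_single 0]
      · have := LaurentSeries.coeff_coe_powerSeries (PowerSeries.mk fun k_1 => (-1 : ℂ) ^ k_1 *
          ((r + k_1).choose r : ℂ) * ((x k : ℂ) - x j)⁻¹ ^ (r + 1 + k_1)) 0
        rw [Nat.cast_zero] at this ⊢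
        rw [neg_zero, this]
        simp [evenZeta, riemannZeta_zero]
        ring
      · intro i _ hi
        rw [PowerSeries.coeff_coe, if_pos (by omega), mul_zero]
      · intro h
        exact absurd (Finset.mem_range.mpr (by have := hM j; omega)) h
    rw [hval]
    refine h2.congr_fun ?_
    intro l
    by_cases hl : l ∈ Set.range x
    · rw [Set.indicator_of_notMem (by simpa using hl), if_pos (by simpa using hl), sub_self]
    · rw [Set.indicator_of_mem (by simpa using hl), if_neg (by simpa using hl), sub_zero, hprod]
end LineSum

/-! ### Explicit line sums for two and three poles. -/

theorem sum_evenZeta_mul (c : ℕ → ℂ) {p M : ℕ} (hM : p < M) (hc : ∀ i, p < i → c i = 0) :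
    ∑ i ∈ Finset.range M, evenZeta i * c i =
      2 * ∑ j ∈ Finset.range (p / 2 + 1), riemannZeta (2 * j) * c (2 * j) := by
  rw [Finset.mul_sum]
  symm
  have h1 : ∑ j ∈ Finset.range (p / 2 + 1), 2 * (riemannZeta (2 * j) * c (2 * j)) =
      ∑ i ∈ (Finset.range (p / 2 + 1)).image (fun j => 2 * j), evenZeta i * c i := by
    rw [Finset.sum_image (fun a _ b _ h => by simpa using h)]
    refine Finset.sum_congr rfl fun j _ => ?_
    rw [evenZeta, if_pos (even_two_mul j)]
    push_cast
    ring
  rw [h1]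
  refine Finset.sum_subset ?_ ?_
  · intro i hi
    simp only [Finset.mem_image, Finset.mem_range] at hi ⊢
    omega
  · intro i hi hni
    by_cases he : Even i
    · obtain ⟨k, rfl⟩ := he
      have : p < k + k := by
        by_contra h
        exact hni (Finset.mem_image.mpr ⟨k, Finset.mem_range.mpr (by omega), by ring⟩)
      rw [hc _ this, mul_zero]
    · rw [evenZeta, if_neg he, zero_mul]

/-- At a pole of order `p` the polar part is read off the Taylor coefficients of the remaining
regular factor `g`; this is how every pole is evaluated below. -/
theorem coeff_single_inv_pow_mul (g : PowerSeries ℂ) (p i : ℕ) :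
    ((HahnSeries.single (1 : ℤ) (1 : ℂ) : LaurentSeries ℂ)⁻¹ ^ p * (g : LaurentSeries ℂ)).coeff
      (-(i : ℤ)) = if i ≤ p then PowerSeries.coeff (p - i) g else 0 := by
  have h1 : (HahnSeries.single (1 : ℤ) (1 : ℂ) : LaurentSeries ℂ)⁻¹ ^ p =
      HahnSeries.single (-(p : ℤ)) 1 := by
    simp [HahnSeries.inv_single]
  rw [h1, HahnSeries.coeff_single_mul, one_mul, PowerSeries.coeff_coe]
  split_ifs with h2 h3 h3
  · omega
  · rfl
  · congr 2; omega
  · omega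

/-- The power series of `1 / (d + t) ^ a`. -/
noncomputable def invAddPow (d : ℂ) (a : ℕ) : PowerSeries ℂ :=
  PowerSeries.mk fun k => (-1 : ℂ) ^ k * ((a - 1 + k).choose (a - 1) : ℂ) * d⁻¹ ^ (a + k)

theorem coe_invAddPow {d : ℂ} (hd : d ≠ 0) {a : ℕ} (ha : 1 ≤ a) :
    (HahnSeries.single (1 : ℤ) (1 : ℂ) + HahnSeries.C d : LaurentSeries ℂ)⁻¹ ^ a =
      (invAddPow d a : LaurentSeries ℂ) := by
  obtain ⟨b, rfl⟩ : ∃ b, a = b + 1 := ⟨a - 1, by omega⟩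
  rw [inv_single_add_C_pow hd]
  rfl

theorem coeff_invAddPow (d : ℂ) (a k : ℕ) : PowerSeries.coeff k (invAddPow d a) =
    (-1 : ℂ) ^ k * ((a - 1 + k).choose (a - 1) : ℂ) * d⁻¹ ^ (a + k) := by
  simp [invAddPow]

theorem coeff_invAddPow_neg (d : ℂ) (a k : ℕ) : PowerSeries.coeff k (invAddPow (-d) a) =
    (-1 : ℂ) ^ a * ((a - 1 + k).choose (a - 1) : ℂ) * d⁻¹ ^ (a + k) := by
  rw [coeff_invAddPow, inv_neg, neg_pow d⁻¹, pow_add (-1 : ℂ) a k]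
  linear_combination (-1 : ℂ) ^ a * ((a - 1 + k).choose (a - 1) : ℂ) * d⁻¹ ^ (a + k) *
    (pow_mul_pow_eq_one k (show (-1 : ℂ) * (-1) = 1 by norm_num))

/-- The sum over a line of `1 / (l ^ P * (l + m) ^ Q)`. -/
theorem hasSum_line_two {P Q : ℕ} (hP : 1 ≤ P) (hQ : 1 ≤ Q) {m : ℤ} (hm : m ≠ 0)
    (hs : Summable fun l : ℤ => (l : ℂ)⁻¹ ^ P * ((l : ℂ) + m)⁻¹ ^ Q) :
    HasSum (fun l : ℤ => (l : ℂ)⁻¹ ^ P * ((l : ℂ) + m)⁻¹ ^ Q)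
      (2 * (-1 : ℂ) ^ P * ∑ k ∈ Finset.range (P / 2 + 1), riemannZeta (2 * k) *
          ((P + Q - 1 - 2 * k).choose (Q - 1) : ℂ) * (m : ℂ)⁻¹ ^ (P + Q - 2 * k) +
        2 * (-1 : ℂ) ^ P * ∑ k ∈ Finset.range (Q / 2 + 1), riemannZeta (2 * k) *
          ((P + Q - 1 - 2 * k).choose (P - 1) : ℂ) * (m : ℂ)⁻¹ ^ (P + Q - 2 * k)) := by
  have hmC : (m : ℂ) ≠ 0 := by exact_mod_cast hm
  have h1 := hasSum_symmetricIcc_prod ![0, -m] (by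
    intro i j; fin_cases i <;> fin_cases j <;> simp [hm, eq_comm]) (P + Q + 1) ![P, Q]
    (by intro i; fin_cases i <;> simp)
    (by intro h; have := congrFun h 0; simp at this; omega)
  have h2 : ((Set.range ![(0 : ℤ), -m])ᶜ.indicator fun l : ℤ =>
      ∏ i, (((l : ℂ) - (![(0 : ℤ), -m] i : ℤ))⁻¹) ^ (![P, Q] i)) =
      fun l : ℤ => (l : ℂ)⁻¹ ^ P * ((l : ℂ) + m)⁻¹ ^ Q := by
    funext l
    by_cases hl : l ∈ (Set.range ![(0 : ℤ), -m])ᶜ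
    · rw [Set.indicator_of_mem hl]
      simp [Fin.prod_univ_two, mul_comm]
    · rw [Set.indicator_of_notMem hl]
      -- At a pole the convention `0⁻¹ = 0` already makes the product vanish, so the indicator may
      -- be dropped.
      rw [Set.mem_compl_iff, not_not] at hl
      obtain ⟨i, rfl⟩ := hl
      fin_cases i
      · simp [show P ≠ 0 by omega]
      · simp [show Q ≠ 0 by omega]
  rw [h2] at h1
  -- Absolute convergence lets the unconditional sum be computed along symmetric intervals.
  have h3 : HasSum (fun l : ℤ => (l : ℂ)⁻¹ ^ P * ((l : ℂ) + m)⁻¹ ^ Q) _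
      (SummationFilter.symmetricIcc ℤ) :=
    Filter.Tendsto.mono_left hs.hasSum (SummationFilter.LeAtTop.le_atTop)
  have h4 := HasSum.unique h3 h1
  rw [show ∀ z, HasSum (fun l : ℤ => (l : ℂ)⁻¹ ^ P * ((l : ℂ) + m)⁻¹ ^ Q) z ↔
    (∑' l : ℤ, (l : ℂ)⁻¹ ^ P * ((l : ℂ) + m)⁻¹ ^ Q) = z from fun z => hs.hasSum_iff, h4]
  rw [polarSum, Fin.sum_univ_two]
  congr 1
  · have hc : ∀ i : ℕ, (laurentAt ![0, -m] ![P, Q] (![0, -m] 0)).coeff (-(i : ℤ)) =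
        if i ≤ P then PowerSeries.coeff (P - i) (invAddPow (m : ℂ) Q) else 0 := by
      intro i
      rw [← coeff_single_inv_pow_mul, ← coe_invAddPow hmC hQ]
      simp only [laurentAt, Fin.prod_univ_two, Matrix.cons_val_zero, Matrix.cons_val_one,
        Int.cast_zero, Int.cast_neg, sub_self, map_zero, add_zero, sub_neg_eq_add, zero_add]
    rw [sum_evenZeta_mul _ (p := P) (by omega) (fun i hi => by rw [hc, if_neg (by omega)]),
      mul_assoc, Finset.mul_sum _ _ ((-1 : ℂ) ^ P)]
    congr 1
    refine Finset.sum_congr rfl fun k hk => ?_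
    have hk := Finset.mem_range.mp hk
    rw [hc, if_pos (by omega), coeff_invAddPow]
    rw [show Q - 1 + (P - 2 * k) = P + Q - 1 - 2 * k by omega,
      show Q + (P - 2 * k) = P + Q - 2 * k by omega]
    have : (-1 : ℂ) ^ P = (-1) ^ (P - 2 * k) := by
      conv_lhs => rw [show P = P - 2 * k + 2 * k by omega, pow_add, pow_mul]
      simp
    rw [this]
    ring
  · have hc : ∀ i : ℕ, (laurentAt ![0, -m] ![P, Q] (![0, -m] 1)).coeff (-(i : ℤ)) =
        if i ≤ Q then PowerSeries.coeff (Q - i) (invAddPow (-(m : ℂ)) P) else 0 := by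
      intro i
      rw [← coeff_single_inv_pow_mul, ← coe_invAddPow (neg_ne_zero.mpr hmC) hP]
      simp only [laurentAt, Fin.prod_univ_two, Matrix.cons_val_zero, Matrix.cons_val_one,
        Int.cast_zero, Int.cast_neg, sub_self, map_zero, add_zero, sub_zero, mul_comm]
    rw [sum_evenZeta_mul _ (p := Q) (by omega) (fun i hi => by rw [hc, if_neg (by omega)]),
      mul_assoc, Finset.mul_sum _ _ ((-1 : ℂ) ^ P)]
    congr 1
    refine Finset.sum_congr rfl fun k hk => ?_
    have hk := Finset.mem_range.mp hk
    rw [hc, if_pos (by omega), coeff_invAddPow_neg]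
    rw [show P - 1 + (Q - 2 * k) = P + Q - 1 - 2 * k by omega,
      show P + (Q - 2 * k) = P + Q - 2 * k by omega]
    ring

theorem coeff_invAddPow_mul (d e : ℂ) {a c : ℕ} (ha : 1 ≤ a) (hc : 1 ≤ c) (n : ℕ) :
    PowerSeries.coeff n (invAddPow d a * invAddPow e c) =
      (-1 : ℂ) ^ n * ∑ ω ∈ Finset.range (n + 1), ((ω + a - 1).choose ω : ℂ) *
        ((n - ω + c - 1).choose (c - 1) : ℂ) * (d⁻¹ ^ (a + ω) * e⁻¹ ^ (c + n - ω)) := by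
  rw [PowerSeries.coeff_mul, Finset.Nat.sum_antidiagonal_eq_sum_range_succ
    (fun i j => PowerSeries.coeff i (invAddPow d a) * PowerSeries.coeff j (invAddPow e c)),
    Finset.mul_sum]
  refine Finset.sum_congr rfl fun ω hω => ?_
  have hω := Finset.mem_range.mp hω
  rw [coeff_invAddPow, coeff_invAddPow, show c - 1 + (n - ω) = n - ω + c - 1 by omega,
    show c + (n - ω) = c + n - ω by omega, show ω + a - 1 = a - 1 + ω by omega,
    Nat.choose_symm_add]
  have : (-1 : ℂ) ^ n = (-1) ^ ω * (-1) ^ (n - ω) := by rw [← pow_add]; congr 1; omega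
  rw [this]
  ring

theorem neg_inv_pow_eq {K : Type*} [Field K] (z : K) (k : ℕ) :
    (-z)⁻¹ ^ k = (-1) ^ k * z⁻¹ ^ k := by
  rw [inv_neg, neg_pow]

/-- Partial fractions for the expansion at the middle one of three poles. -/
theorem inv_pow_mul_inv_pow_eq_coe {m n : ℂ} (hm : m ≠ 0) (hn : n ≠ 0) (hmn : m + n ≠ 0)
    {p c : ℕ} (hp : 1 ≤ p) (hc : 1 ≤ c) :
    (HahnSeries.single (1 : ℤ) (1 : ℂ) + HahnSeries.C (-m) : LaurentSeries ℂ)⁻¹ ^ p *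
      (HahnSeries.single (1 : ℤ) (1 : ℂ) + HahnSeries.C n : LaurentSeries ℂ)⁻¹ ^ c =
    ((PowerSeries.C ((-1 : ℂ) ^ p) * (∑ ω ∈ Finset.range p,
      PowerSeries.C (((p + c - 2 - ω).choose (c - 1) : ℂ) * (m + n)⁻¹ ^ (p + c - 1 - ω) *
        (-1) ^ (ω + 1)) * invAddPow (-m) (ω + 1) +
      ∑ ω ∈ Finset.range c, PowerSeries.C (((p + c - 2 - ω).choose (p - 1) : ℂ) *
        (m + n)⁻¹ ^ (p + c - 1 - ω)) * invAddPow n (ω + 1)) : PowerSeries ℂ) : LaurentSeries ℂ) := by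
  have hu := single_add_C_ne_zero (-m)
  have hv := single_add_C_ne_zero n
  have hy : (HahnSeries.C (m + n) : LaurentSeries ℂ) ≠ 0 := by
    rw [Ne, map_eq_zero]; exact hmn
  have huv : -(HahnSeries.single (1 : ℤ) (1 : ℂ) + HahnSeries.C (-m) : LaurentSeries ℂ) +
      (HahnSeries.single (1 : ℤ) (1 : ℂ) + HahnSeries.C n) = HahnSeries.C (m + n) := by
    rw [map_neg, map_add]; ring
  have h := partialFraction (neg_ne_zero.mpr hu) hv hy huv hp hc
  have hneg : ∀ k : ℕ, (-(HahnSeries.single (1 : ℤ) (1 : ℂ) + HahnSeries.C (-m) :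
      LaurentSeries ℂ))⁻¹ ^ k = HahnSeries.C ((-1 : ℂ) ^ k) *
      (HahnSeries.single (1 : ℤ) (1 : ℂ) + HahnSeries.C (-m) : LaurentSeries ℂ)⁻¹ ^ k := by
    intro k
    have h0 : (HahnSeries.C ((-1 : ℂ) ^ k) : LaurentSeries ℂ) = (-1) ^ k := by
      rw [RingHom.map_pow, RingHom.map_neg, RingHom.map_one]
    rw [h0]
    exact neg_inv_pow_eq _ _
  have hyp : ∀ k : ℕ, (HahnSeries.C (m + n) : LaurentSeries ℂ)⁻¹ ^ k =
      HahnSeries.C ((m + n)⁻¹ ^ k) := by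
    intro k
    rw [← map_inv₀, map_pow]
  have h1 : (HahnSeries.C ((-1 : ℂ) ^ p) * HahnSeries.C ((-1 : ℂ) ^ p) : LaurentSeries ℂ) = 1 := by
    rw [← map_mul, ← mul_pow]; simp
  rw [hneg] at h
  have h2 := congrArg (fun z => HahnSeries.C ((-1 : ℂ) ^ p) * z) h
  simp only [← mul_assoc] at h2
  rw [h1, one_mul] at h2
  rw [h2, PowerSeries.coe_mul, PowerSeries.coe_C, PowerSeries.coe_add]
  congr 1
  rw [show ∀ (s : Finset ℕ) (f : ℕ → PowerSeries ℂ),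
    ((∑ i ∈ s, f i : PowerSeries ℂ) : LaurentSeries ℂ) =
      ∑ i ∈ s, (f i : LaurentSeries ℂ) from fun s f => map_sum _ f s,
    show ∀ (s : Finset ℕ) (f : ℕ → PowerSeries ℂ),
    ((∑ i ∈ s, f i : PowerSeries ℂ) : LaurentSeries ℂ) =
      ∑ i ∈ s, (f i : LaurentSeries ℂ) from fun s f => map_sum _ f s]
  congr 1
  · refine Finset.sum_congr rfl fun ω _ => ?_
    rw [hneg, hyp, coe_invAddPow (neg_ne_zero.mpr hm) (by omega), PowerSeries.coe_mul,
      PowerSeries.coe_C, map_mul, map_mul, map_natCast]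
    ring
  · refine Finset.sum_congr rfl fun ω _ => ?_
    rw [hyp, coe_invAddPow hn (by omega), PowerSeries.coe_mul,
      PowerSeries.coe_C, map_mul, map_natCast]
    ring

/-- The sum over a line of `1 / (l ^ p * (l + m) ^ a * (l + m + n) ^ c)`. -/
noncomputable def lineSumThree (p a c : ℕ) (m n : ℂ) : ℂ :=
  2 * (-1 : ℂ) ^ p * ∑ j ∈ Finset.range (p / 2 + 1), riemannZeta (2 * j) *
    ∑ ω ∈ Finset.range (p - 2 * j + 1), ((ω + a - 1).choose ω : ℂ) *
      ((p + c - 2 * j - ω - 1).choose (c - 1) : ℂ) *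
        (m⁻¹ ^ (a + ω) * (m + n)⁻¹ ^ (p + c - 2 * j - ω)) +
  2 * (-1 : ℂ) ^ (p + a) * ∑ j ∈ Finset.range (c / 2 + 1), riemannZeta (2 * j) *
    ∑ ω ∈ Finset.range (c - 2 * j + 1), ((ω + a - 1).choose ω : ℂ) *
      ((p + c - 2 * j - ω - 1).choose (p - 1) : ℂ) *
        (n⁻¹ ^ (a + ω) * (m + n)⁻¹ ^ (p + c - 2 * j - ω)) +
  2 * (-1 : ℂ) ^ p * ∑ j ∈ Finset.range (a / 2 + 1), riemannZeta (2 * j) *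
    ∑ ω ∈ Finset.range p, ((ω + a - 2 * j).choose ω : ℂ) * ((p + c - 2 - ω).choose (c - 1) : ℂ) *
        (m⁻¹ ^ (a - 2 * j + ω + 1) * (m + n)⁻¹ ^ (p + c - 1 - ω)) +
  2 * (-1 : ℂ) ^ (p + a) * ∑ j ∈ Finset.range (a / 2 + 1), riemannZeta (2 * j) *
    ∑ ω ∈ Finset.range c, ((ω + a - 2 * j).choose ω : ℂ) * ((p + c - 2 - ω).choose (p - 1) : ℂ) *
        (n⁻¹ ^ (a - 2 * j + ω + 1) * (m + n)⁻¹ ^ (p + c - 1 - ω))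

theorem neg_one_pow_sub_two_mul {p k : ℕ} (h : 2 * k ≤ p) :
    (-1 : ℂ) ^ (p - 2 * k) = (-1) ^ p := by
  conv_rhs => rw [show p = p - 2 * k + 2 * k by omega, pow_add, pow_mul]
  simp

/-- The poles are `0`, `-m` and `-(m + n)`. At the two outer ones the polar part comes from the
Cauchy product of two binomial series. At the middle one the two regular factors, the first negated,
add up to the constant `m + n`; splitting them by partial fractions before expanding leaves a single
binomial series per term. This accounts for the different shape of the last two sums in
`lineSumThree`. -/
theorem hasSum_line_three {p a c : ℕ} (hp : 1 ≤ p) (ha : 1 ≤ a) (hc : 1 ≤ c) {m n : ℤ}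
    (hm : m ≠ 0) (hn : n ≠ 0) (hmn : m + n ≠ 0)
    (hs : Summable fun l : ℤ =>
      (l : ℂ)⁻¹ ^ p * ((l : ℂ) + m)⁻¹ ^ a * ((l : ℂ) + m + n)⁻¹ ^ c) :
    HasSum (fun l : ℤ => (l : ℂ)⁻¹ ^ p * ((l : ℂ) + m)⁻¹ ^ a * ((l : ℂ) + m + n)⁻¹ ^ c)
      (lineSumThree p a c m n) := by
  have hmC : (m : ℂ) ≠ 0 := by exact_mod_cast hm
  have hnC : (n : ℂ) ≠ 0 := by exact_mod_cast hn
  have hmnC : (m : ℂ) + n ≠ 0 := by exact_mod_cast hmn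
  have h1 := hasSum_symmetricIcc_prod ![0, -m, -(m + n)] (by
    intro i j; fin_cases i <;> fin_cases j <;> simp <;> omega) (p + a + c + 1) ![p, a, c]
    (by intro i; fin_cases i <;> simp <;> omega)
    (by intro h; have := congrFun h 0; simp at this; omega)
  have h2 : ((Set.range ![(0 : ℤ), -m, -(m + n)])ᶜ.indicator fun l : ℤ =>
      ∏ i, (((l : ℂ) - (![(0 : ℤ), -m, -(m + n)] i : ℤ))⁻¹) ^ (![p, a, c] i)) =
      fun l : ℤ => (l : ℂ)⁻¹ ^ p * ((l : ℂ) + m)⁻¹ ^ a * ((l : ℂ) + m + n)⁻¹ ^ c := by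
    funext l
    by_cases hl : l ∈ (Set.range ![(0 : ℤ), -m, -(m + n)])ᶜ
    · rw [Set.indicator_of_mem hl, Fin.prod_univ_three]
      simp only [Matrix.cons_val_zero, Matrix.cons_val_one, Matrix.cons_val]
      push_cast
      congr 3 <;> ring
    · rw [Set.indicator_of_notMem hl]
      rw [Set.mem_compl_iff, not_not] at hl
      obtain ⟨i, rfl⟩ := hl
      fin_cases i
      · simp [show p ≠ 0 by omega]
      · simp [show a ≠ 0 by omega]
      · have : (((-(m + n) : ℤ) : ℂ) + m + n)⁻¹ ^ c = 0 := by
          push_cast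
          rw [show -((m : ℂ) + n) + m + n = 0 by ring, inv_zero, zero_pow (by omega)]
        simp only [Fin.reduceFinMk, Matrix.cons_val]
        rw [this, mul_zero]
  rw [h2] at h1
  have h3 : HasSum (fun l : ℤ =>
      (l : ℂ)⁻¹ ^ p * ((l : ℂ) + m)⁻¹ ^ a * ((l : ℂ) + m + n)⁻¹ ^ c) _
      (SummationFilter.symmetricIcc ℤ) :=
    Filter.Tendsto.mono_left hs.hasSum (SummationFilter.LeAtTop.le_atTop)
  have h4 := HasSum.unique h3 h1
  rw [hs.hasSum_iff, h4, polarSum, Fin.sum_univ_three]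
  have c0 : ∀ i : ℕ, (laurentAt ![0, -m, -(m + n)] ![p, a, c]
      (![0, -m, -(m + n)] 0)).coeff (-(i : ℤ)) =
      if i ≤ p then PowerSeries.coeff (p - i)
        (invAddPow (m : ℂ) a * invAddPow ((m : ℂ) + n) c) else 0 := by
    intro i
    rw [← coeff_single_inv_pow_mul, PowerSeries.coe_mul, ← coe_invAddPow hmC ha,
      ← coe_invAddPow hmnC hc]
    simp only [laurentAt, Fin.prod_univ_three, Matrix.cons_val_zero, Matrix.cons_val_one,
      Matrix.cons_val, Int.cast_zero, Int.cast_neg, sub_self, map_zero, add_zero, sub_neg_eq_add,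
      zero_add, Int.cast_add, mul_assoc]
  have c2 : ∀ i : ℕ, (laurentAt ![0, -m, -(m + n)] ![p, a, c]
      (![0, -m, -(m + n)] 2)).coeff (-(i : ℤ)) =
      if i ≤ c then PowerSeries.coeff (c - i)
        (invAddPow (-(n : ℂ)) a * invAddPow (-((m : ℂ) + n)) p) else 0 := by
    intro i
    rw [← coeff_single_inv_pow_mul, PowerSeries.coe_mul, ← coe_invAddPow (neg_ne_zero.mpr hnC) ha,
      ← coe_invAddPow (neg_ne_zero.mpr hmnC) hp]
    simp only [laurentAt, Fin.prod_univ_three, Matrix.cons_val_zero, Matrix.cons_val_one,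
      Matrix.cons_val, Int.cast_zero, Int.cast_neg, sub_self, map_zero, add_zero, sub_neg_eq_add,
      sub_zero, Int.cast_add, neg_add_rev, neg_add_cancel_right]
    congr 1
    ring
  have c1 : ∀ i : ℕ, (laurentAt ![0, -m, -(m + n)] ![p, a, c]
      (![0, -m, -(m + n)] 1)).coeff (-(i : ℤ)) =
      if i ≤ a then
        (-1) ^ p * ∑ ω ∈ Finset.range p, ((ω + (a - i)).choose ω : ℂ) *
          ((p + c - 2 - ω).choose (c - 1) : ℂ) *
            ((m : ℂ)⁻¹ ^ (a - i + ω + 1) * ((m : ℂ) + n)⁻¹ ^ (p + c - 1 - ω)) +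
        (-1) ^ p * (-1) ^ (a - i) * ∑ ω ∈ Finset.range c, ((ω + (a - i)).choose ω : ℂ) *
          ((p + c - 2 - ω).choose (p - 1) : ℂ) *
            ((n : ℂ)⁻¹ ^ (a - i + ω + 1) * ((m : ℂ) + n)⁻¹ ^ (p + c - 1 - ω))
      else 0 := by
    intro i
    have h5 : laurentAt ![0, -m, -(m + n)] ![p, a, c] (![0, -m, -(m + n)] 1) =
        (HahnSeries.single (1 : ℤ) (1 : ℂ) : LaurentSeries ℂ)⁻¹ ^ a *
        ((HahnSeries.single (1 : ℤ) (1 : ℂ) + HahnSeries.C (-(m : ℂ)) : LaurentSeries ℂ)⁻¹ ^ p *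
        (HahnSeries.single (1 : ℤ) (1 : ℂ) + HahnSeries.C (n : ℂ) : LaurentSeries ℂ)⁻¹ ^ c) := by
      simp only [laurentAt, Fin.prod_univ_three, Matrix.cons_val_zero, Matrix.cons_val_one,
        Matrix.cons_val, Int.cast_zero, Int.cast_neg, sub_self, map_zero, add_zero, sub_neg_eq_add,
        sub_zero, Int.cast_add, neg_add_cancel_left]
      ring
    rw [h5, inv_pow_mul_inv_pow_eq_coe hmC hnC hmnC hp hc, coeff_single_inv_pow_mul]
    split_ifs with hi
    · simp only [PowerSeries.coeff_C_mul, map_add, map_sum,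
        mul_add, Finset.mul_sum]
      congr 1
      · refine Finset.sum_congr rfl fun ω _ => ?_
        rw [coeff_invAddPow_neg, show ω + 1 - 1 + (a - i) = ω + (a - i) by omega,
          show ω + 1 - 1 = ω by omega, show a - i + ω + 1 = ω + 1 + (a - i) by omega,
          Nat.choose_symm_add]
        linear_combination (-1 : ℂ) ^ p * ((ω + (a - i)).choose (a - i) : ℂ) *
          ((p + c - 2 - ω).choose (c - 1) : ℂ) *
            ((m : ℂ)⁻¹ ^ (ω + 1 + (a - i)) * ((m : ℂ) + n)⁻¹ ^ (p + c - 1 - ω)) *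
          (pow_mul_pow_eq_one (ω + 1) (show (-1 : ℂ) * (-1) = 1 by norm_num))
      · refine Finset.sum_congr rfl fun ω _ => ?_
        rw [coeff_invAddPow, show ω + 1 - 1 + (a - i) = ω + (a - i) by omega,
          show ω + 1 - 1 = ω by omega, show a - i + ω + 1 = ω + 1 + (a - i) by omega]
        ring
    · rfl
  rw [sum_evenZeta_mul _ (p := p) (by omega) (fun i hi => by rw [c0, if_neg (by omega)]),
    sum_evenZeta_mul _ (p := a) (by omega) (fun i hi => by rw [c1, if_neg (by omega)]),
    sum_evenZeta_mul _ (p := c) (by omega) (fun i hi => by rw [c2, if_neg (by omega)])]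
  have e0 : ∑ j ∈ Finset.range (p / 2 + 1), riemannZeta (2 * j) *
      (laurentAt ![0, -m, -(m + n)] ![p, a, c] (![0, -m, -(m + n)] 0)).coeff (-((2 * j : ℕ) : ℤ)) =
      (-1 : ℂ) ^ p * ∑ j ∈ Finset.range (p / 2 + 1), riemannZeta (2 * j) *
    ∑ ω ∈ Finset.range (p - 2 * j + 1), ((ω + a - 1).choose ω : ℂ) *
      ((p + c - 2 * j - ω - 1).choose (c - 1) : ℂ) *
        ((m : ℂ)⁻¹ ^ (a + ω) * ((m : ℂ) + n)⁻¹ ^ (p + c - 2 * j - ω)) := by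
    rw [Finset.mul_sum]
    refine Finset.sum_congr rfl fun j hj => ?_
    have hj := Finset.mem_range.mp hj
    rw [c0, if_pos (by omega), coeff_invAddPow_mul _ _ ha hc, neg_one_pow_sub_two_mul (by omega),
      mul_left_comm]
    congr 2
    refine Finset.sum_congr rfl fun ω hω => ?_
    have hω := Finset.mem_range.mp hω
    rw [show p - 2 * j - ω + c - 1 = p + c - 2 * j - ω - 1 by omega,
      show c + (p - 2 * j) - ω = p + c - 2 * j - ω by omega]
  have e2 : ∑ j ∈ Finset.range (c / 2 + 1), riemannZeta (2 * j) *
      (laurentAt ![0, -m, -(m + n)] ![p, a, c] (![0, -m, -(m + n)] 2)).coeff (-((2 * j : ℕ) : ℤ)) =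
      (-1 : ℂ) ^ (p + a) * ∑ j ∈ Finset.range (c / 2 + 1), riemannZeta (2 * j) *
    ∑ ω ∈ Finset.range (c - 2 * j + 1), ((ω + a - 1).choose ω : ℂ) *
      ((p + c - 2 * j - ω - 1).choose (p - 1) : ℂ) *
        ((n : ℂ)⁻¹ ^ (a + ω) * ((m : ℂ) + n)⁻¹ ^ (p + c - 2 * j - ω)) := by
    rw [Finset.mul_sum]
    refine Finset.sum_congr rfl fun j hj => ?_
    have hj := Finset.mem_range.mp hj
    rw [c2, if_pos (by omega), coeff_invAddPow_mul _ _ ha hp, neg_one_pow_sub_two_mul (by omega),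
      mul_left_comm ((-1 : ℂ) ^ (p + a)), Finset.mul_sum, Finset.mul_sum _ _ ((-1 : ℂ) ^ (p + a))]
    congr 1
    refine Finset.sum_congr rfl fun ω hω => ?_
    have hω := Finset.mem_range.mp hω
    rw [show c - 2 * j - ω + p - 1 = p + c - 2 * j - ω - 1 by omega,
      show p + (c - 2 * j) - ω = p + c - 2 * j - ω by omega, inv_neg, inv_neg,
      neg_pow (n : ℂ)⁻¹, neg_pow ((m : ℂ) + n)⁻¹]
    -- The signs collected are `(-1)^c` from the Cauchy product, the even shift `2 * j` being
    -- harmless, and one for each negated base. The exponents add up to `p + a` modulo `2`.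
    have : (-1 : ℂ) ^ (p + a) = (-1 : ℂ) ^ c * (-1) ^ (a + ω) * (-1) ^ (p + c - 2 * j - ω) := by
      rw [mul_assoc, ← pow_add, show a + ω + (p + c - 2 * j - ω) = p + a + c - 2 * j by omega,
        neg_one_pow_sub_two_mul (by omega), pow_add _ (p + a) c, mul_left_comm, ← mul_pow]
      simp
    rw [this]
    ring
  have e1 : ∑ j ∈ Finset.range (a / 2 + 1), riemannZeta (2 * j) *
      (laurentAt ![0, -m, -(m + n)] ![p, a, c] (![0, -m, -(m + n)] 1)).coeff (-((2 * j : ℕ) : ℤ)) =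
      (-1 : ℂ) ^ p * ∑ j ∈ Finset.range (a / 2 + 1), riemannZeta (2 * j) *
    ∑ ω ∈ Finset.range p, ((ω + a - 2 * j).choose ω : ℂ) * ((p + c - 2 - ω).choose (c - 1) : ℂ) *
        ((m : ℂ)⁻¹ ^ (a - 2 * j + ω + 1) * ((m : ℂ) + n)⁻¹ ^ (p + c - 1 - ω)) +
      (-1 : ℂ) ^ (p + a) * ∑ j ∈ Finset.range (a / 2 + 1), riemannZeta (2 * j) *
    ∑ ω ∈ Finset.range c, ((ω + a - 2 * j).choose ω : ℂ) * ((p + c - 2 - ω).choose (p - 1) : ℂ) *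
        ((n : ℂ)⁻¹ ^ (a - 2 * j + ω + 1) * ((m : ℂ) + n)⁻¹ ^ (p + c - 1 - ω)) := by
    rw [Finset.mul_sum, Finset.mul_sum _ _ ((-1 : ℂ) ^ (p + a)), ← Finset.sum_add_distrib]
    refine Finset.sum_congr rfl fun j hj => ?_
    have hj := Finset.mem_range.mp hj
    rw [c1, if_pos (by omega), neg_one_pow_sub_two_mul (by omega), pow_add]
    have h5 : ∀ ω, ω + (a - 2 * j) = ω + a - 2 * j := by intro ω; omega
    simp only [h5]
    ring
  rw [e0, e1, e2, lineSumThree]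
  ring

/-! ### Harmonic sequences: products, convolutions and growth. -/

/-- The sequences generated from the constant sequence `1` by linear combinations, division by `n`
and the summation operator `a ↦ (N ↦ ∑ n < N, a n / n)`: the linear combinations of multiple
harmonic sums with powers of `1 / n`. Values at `0` are irrelevant. -/
inductive IsHarmonic : (ℕ → ℂ) → Prop
  | one : IsHarmonic (fun _ => 1)
  | add {a b : ℕ → ℂ} : IsHarmonic a → IsHarmonic b → IsHarmonic (fun n => a n + b n)
  | const_mul (c : ℂ) {a : ℕ → ℂ} : IsHarmonic a → IsHarmonic (fun n => c * a n)
  | div {a : ℕ → ℂ} : IsHarmonic a → IsHarmonic (fun n => a n / n)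
  | sum {a : ℕ → ℂ} : IsHarmonic a → IsHarmonic (fun N => ∑ n ∈ Finset.range N, a n / n)
  | congr {a b : ℕ → ℂ} : IsHarmonic a → (∀ n, n ≠ 0 → a n = b n) → IsHarmonic b

namespace IsHarmonic
variable {a b : ℕ → ℂ}

theorem const (c : ℂ) : IsHarmonic (fun _ => c) :=
  (one.const_mul c).congr fun n _ => by simp

theorem sub (ha : IsHarmonic a) (hb : IsHarmonic b) : IsHarmonic (fun n => a n - b n) :=
  (ha.add (hb.const_mul (-1))).congr fun n _ => by ring

theorem finset_sum {ι : Type*} (s : Finset ι) (f : ι → ℕ → ℂ) (h : ∀ i ∈ s, IsHarmonic (f i)) :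
    IsHarmonic (fun n => ∑ i ∈ s, f i n) := by
  classical
  induction s using Finset.induction_on with
  | empty => exact (const 0).congr fun n _ => by simp
  | insert i s hi ih =>
    refine ((h i (Finset.mem_insert_self i s)).add
      (ih fun j hj => h j (Finset.mem_insert_of_mem hj))).congr fun n _ => ?_
    rw [Finset.sum_insert hi]

theorem inv_pow_mul (ha : IsHarmonic a) (k : ℕ) : IsHarmonic (fun n => (n : ℂ)⁻¹ ^ k * a n) := by
  induction k with
  | zero => exact ha.congr fun n _ => by simp
  | succ k ih => exact ih.div.congr fun n _ => by rw [pow_succ]; ring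

theorem inv_pow (k : ℕ) : IsHarmonic (fun n => (n : ℂ)⁻¹ ^ k) :=
  (one.inv_pow_mul k).congr fun n _ => by simp

theorem sum_le (ha : IsHarmonic a) :
    IsHarmonic (fun N => ∑ n ∈ Finset.range (N + 1), a n / n) :=
  (ha.sum.add ha.div).congr fun n _ => by rw [Finset.sum_range_succ]

/-- The square of index pairs is split into its two open triangles and the diagonal: the
quasi-shuffle rule behind the closure under products. -/
theorem sum_mul_sum (f g : ℕ → ℂ) (N : ℕ) :
    (∑ n ∈ Finset.range N, f n) * ∑ n ∈ Finset.range N, g n =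
      ∑ n ∈ Finset.range N, (f n * ∑ k ∈ Finset.range n, g k + g n * ∑ k ∈ Finset.range n, f k +
        f n * g n) := by
  induction N with
  | zero => simp
  | succ N ih =>
    rw [Finset.sum_range_succ, Finset.sum_range_succ, Finset.sum_range_succ, ← ih]
    ring

theorem mul (ha : IsHarmonic a) (hb : IsHarmonic b) : IsHarmonic (fun n => a n * b n) := by
  induction ha generalizing b with
  | one => exact hb.congr fun n _ => by simp
  | add _ _ ih1 ih2 => exact ((ih1 hb).add (ih2 hb)).congr fun n _ => by ring
  | const_mul c _ ih => exact ((ih hb).const_mul c).congr fun n _ => by ring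
  | div _ ih => exact (ih hb).div.congr fun n _ => by ring
  | congr _ h ih => exact (ih hb).congr fun n hn => by rw [h n hn]
  | @sum a ha ih =>
    induction hb with
    | one => exact ha.sum.congr fun n _ => by simp
    | add _ _ ih1 ih2 => exact (ih1.add ih2).congr fun n _ => by ring
    | const_mul c _ ih => exact (ih.const_mul c).congr fun n _ => by ring
    | div _ ih => exact ih.div.congr fun n _ => by ring
    | congr _ h ih => exact ih.congr fun n hn => by rw [h n hn]
    | @sum b hb ih2 =>
      refine (((ih hb.sum).sum.add ih2.sum).add (ih hb).div.sum).congr fun N _ => ?_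
      rw [sum_mul_sum, ← Finset.sum_add_distrib, ← Finset.sum_add_distrib]
      refine Finset.sum_congr rfl fun n _ => ?_
      ring

/-- The convolution of the sequences `a n` and `b n / n`. -/
noncomputable def conv (a b : ℕ → ℂ) (N : ℕ) : ℂ := ∑ n ∈ Finset.range N, a (N - n) * (b n / n)

theorem conv_congr {a' b' : ℕ → ℂ} (h : ∀ n, n ≠ 0 → a n = a' n) (h' : ∀ n, n ≠ 0 → b n = b' n)
    (N : ℕ) : conv a b N = conv a' b' N := by
  refine Finset.sum_congr rfl fun n hn => ?_
  have hn := Finset.mem_range.mp hn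
  rw [h _ (by omega)]
  rcases eq_or_ne n 0 with rfl | h0
  · simp
  · rw [h' _ h0]

/-- `1 / ((N - n) n) = (1 / N) (1 / (N - n) + 1 / n)`, followed by `n ↦ N - n` in one of the two
sums. The term `n = 0` is `0` because of division by zero. -/
theorem conv_div (a b : ℕ → ℂ) {N : ℕ} (hN : N ≠ 0) :
    conv (fun n => a n / n) b N = (conv a b N + conv b a N) / N := by
  obtain ⟨M, rfl⟩ : ∃ M, N = M + 1 := ⟨N - 1, by omega⟩
  simp only [conv]
  rw [Finset.sum_range_succ', Finset.sum_range_succ', Finset.sum_range_succ',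
    ← Finset.sum_range_reflect (fun n => b (M + 1 - (n + 1)) * (a (n + 1) / (n + 1 : ℕ)))]
  simp only [Nat.cast_zero, div_zero, mul_zero, add_zero]
  rw [← Finset.sum_add_distrib, Finset.sum_div]
  refine Finset.sum_congr rfl fun n hn => ?_
  have hn := Finset.mem_range.mp hn
  rw [show M + 1 - (M - 1 - n + 1) = n + 1 by omega, show M - 1 - n + 1 = M - n by omega,
    show M + 1 - (n + 1) = M - n by omega, show M + 1 = (M - n) + (n + 1) by omega]
  have h1 : ((M - n : ℕ) : ℂ) ≠ 0 := by exact_mod_cast (show M - n ≠ 0 by omega)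
  have h2 : ((n + 1 : ℕ) : ℂ) ≠ 0 := by exact_mod_cast Nat.succ_ne_zero n
  have h3 : ((M - n : ℕ) : ℂ) + ((n + 1 : ℕ) : ℂ) ≠ 0 := by
    exact_mod_cast (show M - n + (n + 1) ≠ 0 by omega)
  rw [Nat.cast_add (M - n)]
  field_simp

theorem sum_range_sum_range_sub (f : ℕ → ℕ → ℂ) (N : ℕ) :
    ∑ y ∈ Finset.range N, ∑ x ∈ Finset.range (N - y), f x y =
      ∑ M ∈ Finset.range N, ∑ y ∈ Finset.range (M + 1), f (M - y) y := by
  induction N with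
  | zero => simp
  | succ N ih =>
    rw [Finset.sum_range_succ (fun M => ∑ y ∈ Finset.range (M + 1), f (M - y) y) N, ← ih,
      Finset.sum_range_succ (fun y => ∑ x ∈ Finset.range (N + 1 - y), f x y) N,
      Finset.sum_range_succ (fun y => f (N - y) y) N, ← add_assoc, ← Finset.sum_add_distrib]
    congr 1
    · refine Finset.sum_congr rfl fun y hy => ?_
      have := Finset.mem_range.mp hy
      rw [show N + 1 - y = N - y + 1 by omega, Finset.sum_range_succ]
    · simp

theorem conv_sum (a b : ℕ → ℂ) (N : ℕ) :
    conv (fun N => ∑ n ∈ Finset.range N, a n / n) b N =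
      ∑ M ∈ Finset.range N, (conv a b M + conv b a M) / M := by
  simp only [conv, Finset.sum_mul]
  rw [sum_range_sum_range_sub (fun x y => a x / x * (b y / y))]
  refine Finset.sum_congr rfl fun M _ => ?_
  rcases eq_or_ne M 0 with rfl | hM
  · simp
  · rw [Finset.sum_range_succ]
    simpa [conv] using conv_div a b hM

/-- The recursion for a division or a summation brings in the convolution with its arguments
exchanged. Inducting on the other argument, with `a` known to convolve well on the left, closes that
loop for `harmonic_conv`. -/
theorem conv_of_forall (ha : IsHarmonic a) (h : ∀ b, IsHarmonic b → IsHarmonic (conv a b))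
    (hb : IsHarmonic b) : IsHarmonic (conv b a) := by
  induction hb with
  | one => exact ha.sum.congr fun n _ => by simp [conv]
  | add _ _ ih1 ih2 =>
    exact (ih1.add ih2).congr fun n _ => by simp [conv, add_mul, Finset.sum_add_distrib]
  | const_mul c _ ih =>
    exact (ih.const_mul c).congr fun n _ => by simp [conv, mul_assoc, Finset.mul_sum]
  | div hb ih => exact (ih.add (h _ hb)).div.congr fun n hn => by rw [conv_div _ _ hn]
  | sum hb ih => exact (ih.add (h _ hb)).sum.congr fun n hn => by rw [conv_sum]
  | congr _ h ih => exact ih.congr fun n hn => conv_congr h (fun _ _ => rfl) n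

theorem harmonic_conv (ha : IsHarmonic a) (hb : IsHarmonic b) : IsHarmonic (conv a b) := by
  induction ha generalizing b with
  | one => exact hb.sum.congr fun n _ => by simp [conv]
  | add _ _ ih1 ih2 =>
    exact ((ih1 hb).add (ih2 hb)).congr fun n _ => by simp [conv, add_mul, Finset.sum_add_distrib]
  | const_mul c _ ih =>
    exact ((ih hb).const_mul c).congr fun n _ => by simp [conv, mul_assoc, Finset.mul_sum]
  | div ha ih =>
    exact ((ih hb).add (conv_of_forall ha (fun _ h => ih h) hb)).div.congr
      fun n hn => by rw [conv_div _ _ hn]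
  | sum ha ih =>
    exact ((ih hb).add (conv_of_forall ha (fun _ h => ih h) hb)).sum.congr
      fun n hn => by rw [conv_sum]
  | congr _ h ih => exact (ih hb).congr fun n hn => conv_congr h (fun _ _ => rfl) n

theorem sum_inv_sqrt_le (N : ℕ) : ∑ n ∈ Finset.range (N + 1), (√(n : ℝ))⁻¹ ≤ 2 * √(N : ℝ) := by
  induction N with
  | zero => simp
  | succ N ih =>
    rw [Finset.sum_range_succ]
    have h1 : 0 < √((N + 1 : ℕ) : ℝ) := by positivity
    have h2 : (√((N + 1 : ℕ) : ℝ))⁻¹ ≤ 2 * √((N + 1 : ℕ) : ℝ) - 2 * √(N : ℝ) := by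
      rw [inv_le_iff_one_le_mul₀ h1]
      have h3 := Real.mul_self_sqrt (show (0 : ℝ) ≤ ((N + 1 : ℕ) : ℝ) by positivity)
      have h4 := Real.mul_self_sqrt (show (0 : ℝ) ≤ (N : ℝ) by positivity)
      push_cast at h3 ⊢
      nlinarith [sq_nonneg (√((N : ℝ) + 1) - √(N : ℝ))]
    linarith

/-- The true growth is logarithmic, but a power of a logarithm would rise with each summation. The
bound `√n` is reproduced: dividing by `n` and summing gives at most `2√N` times the constant. -/
theorem exists_bound (ha : IsHarmonic a) : ∃ C : ℝ, 0 ≤ C ∧ ∀ n, n ≠ 0 → ‖a n‖ ≤ C * √n := by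
  have hs : ∀ n : ℕ, n ≠ 0 → 1 ≤ √(n : ℝ) := fun n hn => by
    rw [Real.one_le_sqrt]; exact_mod_cast Nat.one_le_iff_ne_zero.mpr hn
  induction ha with
  | one => exact ⟨1, zero_le_one, fun n hn => by simpa using hs n hn⟩
  | add _ _ ih1 ih2 =>
    obtain ⟨C, hC, h⟩ := ih1
    obtain ⟨D, hD, h'⟩ := ih2
    exact ⟨C + D, by positivity, fun n hn => (norm_add_le _ _).trans (by
      rw [add_mul]; exact add_le_add (h n hn) (h' n hn))⟩
  | const_mul c _ ih =>
    obtain ⟨C, hC, h⟩ := ih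
    exact ⟨‖c‖ * C, by positivity, fun n hn => by
      rw [norm_mul, mul_assoc]; exact mul_le_mul_of_nonneg_left (h n hn) (norm_nonneg _)⟩
  | div _ ih =>
    obtain ⟨C, hC, h⟩ := ih
    refine ⟨C, hC, fun n hn => ?_⟩
    rw [norm_div, Complex.norm_natCast]
    exact (div_le_self (norm_nonneg _) (by exact_mod_cast Nat.one_le_iff_ne_zero.mpr hn)).trans
      (h n hn)
  | @sum a _ ih =>
    obtain ⟨C, hC, h⟩ := ih
    refine ⟨C * 2, by positivity, fun N _ => ?_⟩
    calc ‖∑ n ∈ Finset.range N, a n / n‖ ≤ ∑ n ∈ Finset.range N, C * (√n)⁻¹ := by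
          refine norm_sum_le_of_le _ fun n _ => ?_
          rcases eq_or_ne n 0 with rfl | hn
          · simp
          rw [norm_div, Complex.norm_natCast, div_le_iff₀ (by positivity)]
          refine (h n hn).trans_eq ?_
          have : (0 : ℝ) < √n := by positivity
          field_simp
          rw [Real.sq_sqrt (by positivity)]
      _ ≤ C * 2 * √N := by
          rw [← Finset.mul_sum, mul_assoc]
          refine mul_le_mul_of_nonneg_left (le_trans ?_ (sum_inv_sqrt_le N)) hC
          rw [Finset.sum_range_succ]
          exact le_add_of_nonneg_right (by positivity)
  | congr _ h ih =>
    obtain ⟨C, hC, h'⟩ := ih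
    exact ⟨C, hC, fun n hn => by rw [← h n hn]; exact h' n hn⟩
end IsHarmonic

/-! ### Harmonic sequences: tail sums. -/

namespace IsHarmonic
variable {a b f : ℕ → ℂ}

theorem summable_sqrt_div_sq : Summable fun m : ℕ => √((m + 1 : ℕ) : ℝ) / ((m + 1 : ℕ) : ℝ) ^ 2 := by
  have h := (summable_nat_add_iff 1).mpr (Real.summable_nat_rpow (p := -(3 / 2 : ℝ)) |>.mpr (by norm_num))
  refine h.congr fun m => ?_
  have : (0 : ℝ) < ((m + 1 : ℕ) : ℝ) := by positivity
  rw [Real.sqrt_eq_rpow, ← Real.rpow_natCast, ← Real.rpow_sub this]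
  norm_num

theorem norm_inv_add_le (m N : ℕ) : ‖(((m + 1 : ℕ) : ℂ) + N)⁻¹‖ ≤ ((m + 1 : ℕ) : ℝ)⁻¹ := by
  rw [norm_inv, ← Nat.cast_add, Complex.norm_natCast]
  exact inv_anti₀ (by positivity) (by exact_mod_cast Nat.le_add_right _ _)

theorem norm_inv_add_pow_le (m N : ℕ) {j k : ℕ} (h : k ≤ j) :
    ‖(((m + 1 : ℕ) : ℂ) + N)⁻¹ ^ j‖ ≤ (((m + 1 : ℕ) : ℝ) ^ k)⁻¹ := by
  rw [norm_pow]
  refine (pow_le_pow_left₀ (norm_nonneg _) (norm_inv_add_le m N) j).trans ?_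
  rw [_root_.inv_pow]
  gcongr
  exact_mod_cast Nat.le_add_left 1 m

theorem summable_mul_inv_pow (hf : IsHarmonic f) (N : ℕ) {j : ℕ} (hj : 2 ≤ j) :
    Summable fun m : ℕ => f (m + 1) * (((m + 1 : ℕ) : ℂ) + N)⁻¹ ^ j := by
  obtain ⟨C, hC, h⟩ := hf.exists_bound
  refine Summable.of_norm_bounded (summable_sqrt_div_sq.mul_left C) fun m => ?_
  rw [norm_mul, div_eq_mul_inv, ← mul_assoc]
  exact mul_le_mul (h _ (by omega)) (norm_inv_add_pow_le m N hj) (norm_nonneg _) (by positivity)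

theorem summable_div_mul_inv_pow (hf : IsHarmonic f) (N : ℕ) {j : ℕ} (hj : 1 ≤ j) :
    Summable fun m : ℕ => f (m + 1) / (m + 1 : ℕ) * (((m + 1 : ℕ) : ℂ) + N)⁻¹ ^ j := by
  obtain ⟨C, hC, h⟩ := hf.exists_bound
  refine Summable.of_norm_bounded (summable_sqrt_div_sq.mul_left C) fun m => ?_
  rw [norm_mul, norm_div, Complex.norm_natCast]
  calc ‖f (m + 1)‖ / ((m + 1 : ℕ) : ℝ) * ‖(((m + 1 : ℕ) : ℂ) + N)⁻¹ ^ j‖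
      ≤ (C * √((m + 1 : ℕ) : ℝ)) / ((m + 1 : ℕ) : ℝ) * (((m + 1 : ℕ) : ℝ) ^ 1)⁻¹ := by
        gcongr
        · exact h _ (by omega)
        · exact norm_inv_add_pow_le m N hj
    _ = C * (√((m + 1 : ℕ) : ℝ) / ((m + 1 : ℕ) : ℝ) ^ 2) := by
        field_simp

theorem tendsto_mul_inv_pow (hf : IsHarmonic f) (N : ℕ) {j : ℕ} (hj : 1 ≤ j) :
    Tendsto (fun m : ℕ => f (m + 1) * (((m + 1 : ℕ) : ℂ) + N)⁻¹ ^ j) atTop (𝓝 0) := by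
  obtain ⟨C, hC, h⟩ := hf.exists_bound
  have h1 : Tendsto (fun m : ℕ => C * (√((m + 1 : ℕ) : ℝ))⁻¹) atTop (𝓝 (C * 0)) := by
    refine Tendsto.const_mul _ (tendsto_inv_atTop_zero.comp ?_)
    exact Real.tendsto_sqrt_atTop.comp
      (tendsto_natCast_atTop_atTop.comp (tendsto_add_atTop_nat 1))
  rw [mul_zero] at h1
  refine squeeze_zero_norm (fun m => ?_) h1
  rw [norm_mul]
  calc ‖f (m + 1)‖ * ‖(((m + 1 : ℕ) : ℂ) + N)⁻¹ ^ j‖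
      ≤ (C * √((m + 1 : ℕ) : ℝ)) * (((m + 1 : ℕ) : ℝ) ^ 1)⁻¹ :=
        mul_le_mul (h _ (by omega)) (norm_inv_add_pow_le m N hj) (norm_nonneg _) (by positivity)
    _ = C * (√((m + 1 : ℕ) : ℝ))⁻¹ := by
        have h2 : 0 < √((m + 1 : ℕ) : ℝ) := by positivity
        have h3 := Real.mul_self_sqrt (show (0 : ℝ) ≤ ((m + 1 : ℕ) : ℝ) by positivity)
        rw [pow_one, mul_assoc]
        congr 1
        rw [← div_eq_mul_inv, div_eq_iff (by positivity), eq_comm, inv_mul_eq_iff_eq_mul₀ h2.ne', h3]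

/-- Summation by parts. -/
theorem hasSum_mul_sub (hf : IsHarmonic f) (N : ℕ) {j : ℕ} (hj : 1 ≤ j)
    (hs : Summable fun m : ℕ => f (m + 1) *
      ((((m + 1 : ℕ) : ℂ) + N)⁻¹ ^ j - (((m + 1 : ℕ) : ℂ) + (N + 1 : ℕ))⁻¹ ^ j))
    {S : ℂ} (hS : HasSum (fun m : ℕ => (f (m + 2) - f (m + 1)) *
      (((m + 1 : ℕ) : ℂ) + (N + 1 : ℕ))⁻¹ ^ j) S) :
    ∑' m : ℕ, f (m + 1) *
      ((((m + 1 : ℕ) : ℂ) + N)⁻¹ ^ j - (((m + 1 : ℕ) : ℂ) + (N + 1 : ℕ))⁻¹ ^ j) =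
      f 1 * (1 + N : ℂ)⁻¹ ^ j + S := by
  refine tendsto_nhds_unique hs.hasSum.tendsto_sum_nat ?_
  have h1 : ∀ L : ℕ, ∑ m ∈ Finset.range L, f (m + 1) *
      ((((m + 1 : ℕ) : ℂ) + N)⁻¹ ^ j - (((m + 1 : ℕ) : ℂ) + (N + 1 : ℕ))⁻¹ ^ j) =
      f 1 * (1 + N : ℂ)⁻¹ ^ j + ∑ m ∈ Finset.range L, (f (m + 2) - f (m + 1)) *
      (((m + 1 : ℕ) : ℂ) + (N + 1 : ℕ))⁻¹ ^ j - f (L + 1) * (((L + 1 : ℕ) : ℂ) + N)⁻¹ ^ j := by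
    intro L
    induction L with
    | zero => simp
    | succ L ih =>
      rw [Finset.sum_range_succ, ih, Finset.sum_range_succ]
      have : (((L + 1 + 1 : ℕ) : ℂ) + N) = ((L + 1 : ℕ) : ℂ) + (N + 1 : ℕ) := by push_cast; ring
      rw [this]
      ring
  simp only [h1]
  have := (tendsto_const_nhds (x := f 1 * (1 + N : ℂ)⁻¹ ^ j)).add hS.tendsto_sum_nat |>.sub
    (tendsto_mul_inv_pow hf N hj)
  rwa [sub_zero] at this

/-- `∑ m ≥ 1, f m / m * (m + N) ^ (-j)`. -/
noncomputable def tailDiv (f : ℕ → ℂ) (j N : ℕ) : ℂ :=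
  ∑' m : ℕ, f (m + 1) / (m + 1 : ℕ) * (((m + 1 : ℕ) : ℂ) + N)⁻¹ ^ j

/-- `∑ m ≥ 1, f m * (m + N) ^ (-j)`. -/
noncomputable def tail (f : ℕ → ℂ) (j N : ℕ) : ℂ :=
  ∑' m : ℕ, f (m + 1) * (((m + 1 : ℕ) : ℂ) + N)⁻¹ ^ j

theorem summable_mul_sub (hf : IsHarmonic f) (N : ℕ) {j : ℕ} (hj : 2 ≤ j) :
    Summable fun m : ℕ => f (m + 1) *
      ((((m + 1 : ℕ) : ℂ) + N)⁻¹ ^ j - (((m + 1 : ℕ) : ℂ) + (N + 1 : ℕ))⁻¹ ^ j) :=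
  ((summable_mul_inv_pow hf N hj).sub (summable_mul_inv_pow hf (N + 1) hj)).congr
    fun m => by ring

theorem tail_sub (hf : IsHarmonic f) (N : ℕ) {j : ℕ} (hj : 2 ≤ j) :
    tail f j N - tail f j (N + 1) = ∑' m : ℕ, f (m + 1) *
      ((((m + 1 : ℕ) : ℂ) + N)⁻¹ ^ j - (((m + 1 : ℕ) : ℂ) + (N + 1 : ℕ))⁻¹ ^ j) := by
  rw [tail, tail, ← (summable_mul_inv_pow hf N hj).tsum_sub (summable_mul_inv_pow hf (N + 1) hj)]
  simp only [mul_sub]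

/-- This is `N / (m (m + N)) = 1 / m - 1 / (m + N)`. At `j = 0` it shows `N * tailDiv f 1 N` to be
the sum of `f m (1 / m - 1 / (m + N))`, a regularization of the possibly divergent `tail f 1`. -/
theorem mul_tailDiv_term (N m : ℕ) (z : ℂ) (j : ℕ) :
    (N : ℂ) * (z / (m + 1 : ℕ) * (((m + 1 : ℕ) : ℂ) + N)⁻¹ ^ (j + 1)) =
      z / (m + 1 : ℕ) * (((m + 1 : ℕ) : ℂ) + N)⁻¹ ^ j - z * (((m + 1 : ℕ) : ℂ) + N)⁻¹ ^ (j + 1) := by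
  have h1 : ((m + 1 : ℕ) : ℂ) ≠ 0 := by exact_mod_cast Nat.succ_ne_zero m
  have h2 : ((m + 1 : ℕ) : ℂ) + N ≠ 0 := by exact_mod_cast (show m + 1 + N ≠ 0 by omega)
  rw [pow_succ]
  field_simp
  ring

theorem mul_tailDiv (hf : IsHarmonic f) (N : ℕ) {j : ℕ} (hj : 1 ≤ j) :
    (N : ℂ) * tailDiv f (j + 1) N = tailDiv f j N - tail f (j + 1) N := by
  rw [tailDiv, tailDiv, tail, ← tsum_mul_left, ← (summable_div_mul_inv_pow hf N hj).tsum_sub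
    (summable_mul_inv_pow hf N (by omega))]
  exact tsum_congr fun m => mul_tailDiv_term N m _ j

theorem summable_mul_sub_one (hf : IsHarmonic f) (N : ℕ) :
    Summable fun m : ℕ => f (m + 1) *
      ((((m + 1 : ℕ) : ℂ) + N)⁻¹ ^ 1 - (((m + 1 : ℕ) : ℂ) + (N + 1 : ℕ))⁻¹ ^ 1) := by
  refine (((summable_div_mul_inv_pow hf (N + 1) le_rfl).mul_left ((N + 1 : ℕ) : ℂ)).sub
    ((summable_div_mul_inv_pow hf N le_rfl).mul_left (N : ℂ))).congr fun m => ?_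
  have := mul_tailDiv_term (N + 1) m (f (m + 1)) 0
  have h2 := mul_tailDiv_term N m (f (m + 1)) 0
  simp only [zero_add] at this h2
  rw [this, h2]
  ring

theorem mul_tailDiv_one_sub (hf : IsHarmonic f) (N : ℕ) :
    ((N + 1 : ℕ) : ℂ) * tailDiv f 1 (N + 1) - N * tailDiv f 1 N = ∑' m : ℕ, f (m + 1) *
      ((((m + 1 : ℕ) : ℂ) + N)⁻¹ ^ 1 - (((m + 1 : ℕ) : ℂ) + (N + 1 : ℕ))⁻¹ ^ 1) := by
  rw [tailDiv, tailDiv, ← tsum_mul_left, ← tsum_mul_left,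
    ← ((summable_div_mul_inv_pow hf (N + 1) le_rfl).mul_left ((N + 1 : ℕ) : ℂ)).tsum_sub
    ((summable_div_mul_inv_pow hf N le_rfl).mul_left (N : ℂ))]
  refine tsum_congr fun m => ?_
  have := mul_tailDiv_term (N + 1) m (f (m + 1)) 0
  have h2 := mul_tailDiv_term N m (f (m + 1)) 0
  simp only [zero_add] at this h2
  rw [this, h2]
  ring

theorem tsum_one_mul_sub (N : ℕ) {j : ℕ} (hj : 1 ≤ j)
    (hs : Summable fun m : ℕ => (fun _ => 1 : ℕ → ℂ) (m + 1) *
      ((((m + 1 : ℕ) : ℂ) + N)⁻¹ ^ j - (((m + 1 : ℕ) : ℂ) + (N + 1 : ℕ))⁻¹ ^ j)) :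
    ∑' m : ℕ, (fun _ => 1 : ℕ → ℂ) (m + 1) *
      ((((m + 1 : ℕ) : ℂ) + N)⁻¹ ^ j - (((m + 1 : ℕ) : ℂ) + (N + 1 : ℕ))⁻¹ ^ j) =
      ((N + 1 : ℕ) : ℂ)⁻¹ ^ j := by
  rw [hasSum_mul_sub one N hj hs (S := 0) (by simp)]
  push_cast
  rw [add_zero, one_mul, add_comm]

theorem tsum_sum_mul_sub (hf : IsHarmonic f) (N : ℕ) {j : ℕ} (hj : 1 ≤ j)
    (hs : Summable fun m : ℕ => (fun N => ∑ n ∈ Finset.range N, f n / n) (m + 1) *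
      ((((m + 1 : ℕ) : ℂ) + N)⁻¹ ^ j - (((m + 1 : ℕ) : ℂ) + (N + 1 : ℕ))⁻¹ ^ j)) :
    ∑' m : ℕ, (fun N => ∑ n ∈ Finset.range N, f n / n) (m + 1) *
      ((((m + 1 : ℕ) : ℂ) + N)⁻¹ ^ j - (((m + 1 : ℕ) : ℂ) + (N + 1 : ℕ))⁻¹ ^ j) =
      tailDiv f j (N + 1) := by
  rw [hasSum_mul_sub hf.sum N hj hs (S := tailDiv f j (N + 1))]
  · simp
  · refine (summable_div_mul_inv_pow hf (N + 1) hj).hasSum.congr_fun fun m => ?_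
    congr 1
    rw [Finset.sum_range_succ _ (m + 1)]
    ring

theorem eq_sub_sum_of_sub {u h : ℕ → ℂ} (hu : ∀ N, u N - u (N + 1) = h (N + 1)) (N : ℕ) :
    u N = u 0 - ∑ n ∈ Finset.range (N + 1), (n * h n) / n := by
  induction N with
  | zero => simp
  | succ N ih =>
    rw [Finset.sum_range_succ]
    have h1 : ((N + 1 : ℕ) : ℂ) ≠ 0 := by exact_mod_cast Nat.succ_ne_zero N
    rw [mul_div_cancel_left₀ _ h1]
    linear_combination ih - hu N

/-- A tail is recovered from its first differences in `N`. If these are `h j (N + 1)` with `n * h j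
n` harmonic, then summing them stays in the class. For `j = 1` the regularized sum `N * tailDiv f 1
N` stands in for the tail. -/
theorem harmonic_tail_of_difference {h : ℕ → ℕ → ℂ} (hf : IsHarmonic f)
    (hh : ∀ j, 1 ≤ j → IsHarmonic (fun n => n * h j n))
    (hd : ∀ j N : ℕ, 1 ≤ j → (Summable fun m : ℕ => f (m + 1) *
        ((((m + 1 : ℕ) : ℂ) + N)⁻¹ ^ j - (((m + 1 : ℕ) : ℂ) + (N + 1 : ℕ))⁻¹ ^ j)) →
        ∑' m : ℕ, f (m + 1) * ((((m + 1 : ℕ) : ℂ) + N)⁻¹ ^ j -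
          (((m + 1 : ℕ) : ℂ) + (N + 1 : ℕ))⁻¹ ^ j) = h j (N + 1)) :
    (∀ j, 2 ≤ j → IsHarmonic (tail f j)) ∧ IsHarmonic (fun N => N * tailDiv f 1 N) := by
  constructor
  · intro j hj
    refine ((const (tail f j 0)).sub (hh j (by omega)).sum_le).congr fun N _ => ?_
    refine (eq_sub_sum_of_sub (u := tail f j) (fun N => ?_) N).symm
    rw [tail_sub hf N hj, hd j N (by omega) (summable_mul_sub hf N hj)]
  · refine (hh 1 le_rfl).sum_le.congr fun N _ => ?_
    have := eq_sub_sum_of_sub (u := fun N => -(N * tailDiv f 1 N)) (h := h 1) (fun N => ?_) N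
    · simp only [Nat.cast_zero, zero_mul, neg_zero, zero_sub, neg_inj] at this
      exact this.symm
    · rw [← hd 1 N le_rfl (summable_mul_sub_one hf N), ← mul_tailDiv_one_sub hf]
      ring

/-- The class of harmonic sequences is closed under the tail sums. -/
theorem harmonic_tail_aux (hf : IsHarmonic f) :
    (∀ j, 2 ≤ j → IsHarmonic (tail f j)) ∧ ∀ j, 1 ≤ j → IsHarmonic (fun N => N * tailDiv f j N) := by
  -- The identity `N * tailDiv f (j + 1) N = tailDiv f j N - tail f (j + 1) N` climbs from `j = 1`
  -- to all exponents.
  suffices h : (∀ j, 2 ≤ j → IsHarmonic (tail f j)) ∧ IsHarmonic (fun N => N * tailDiv f 1 N) by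
    refine ⟨h.1, fun j hj => ?_⟩
    induction j, hj using Nat.le_induction with
    | base => exact h.2
    | succ j hj ih =>
      refine (ih.div.sub (h.1 (j + 1) (by omega))).congr fun N hN => ?_
      have hN' : (N : ℂ) ≠ 0 := by exact_mod_cast hN
      rw [mul_tailDiv hf N hj, mul_div_cancel_left₀ _ hN']
  induction hf with
  | one =>
    refine harmonic_tail_of_difference one (h := fun j n => (n : ℂ)⁻¹ ^ j) (fun j hj => ?_)
      (fun j N hj hs => tsum_one_mul_sub N hj hs)
    refine (inv_pow (j - 1)).congr fun n hn => ?_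
    have hn' : (n : ℂ) ≠ 0 := by exact_mod_cast hn
    obtain ⟨k, rfl⟩ : ∃ k, j = k + 1 := ⟨j - 1, by omega⟩
    rw [Nat.add_sub_cancel, pow_succ]
    field_simp
  | @sum f hf ih =>
    -- Summation by parts moves the difference from the kernel onto the iterated sum, whose
    -- difference is `f n / n`. What is left is a tail of `f`, covered by the induction hypothesis.
    refine harmonic_tail_of_difference hf.sum (h := fun j n => tailDiv f j n) (fun j hj => ?_)
      (fun j N hj hs => tsum_sum_mul_sub hf N hj hs)
    induction j, hj using Nat.le_induction with
    | base => exact ih.2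
    | succ j hj ih' =>
      refine (ih'.div.sub (ih.1 (j + 1) (by omega))).congr fun N hN => ?_
      have hN' : (N : ℂ) ≠ 0 := by exact_mod_cast hN
      rw [mul_tailDiv hf N hj, mul_div_cancel_left₀ _ hN']
  | @div f hf ih =>
    have ht : ∀ j, tail (fun n => f n / n) j = tailDiv f j := fun j => rfl
    constructor
    · intro j hj
      rw [ht]
      obtain ⟨k, rfl⟩ : ∃ k, j = k + 1 := ⟨j - 1, by omega⟩
      have hQ : ∀ k, 1 ≤ k → IsHarmonic (fun N => N * tailDiv f k N) := by
        intro k hk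
        induction k, hk using Nat.le_induction with
        | base => exact ih.2
        | succ k hk ih' =>
          refine (ih'.div.sub (ih.1 (k + 1) (by omega))).congr fun N hN => ?_
          have hN' : (N : ℂ) ≠ 0 := by exact_mod_cast hN
          rw [mul_tailDiv hf N hk, mul_div_cancel_left₀ _ hN']
      refine (hQ (k + 1) (by omega)).div.congr fun N hN => ?_
      have hN' : (N : ℂ) ≠ 0 := by exact_mod_cast hN
      rw [mul_div_cancel_left₀ _ hN']
    -- With `f n / n` in place of `f`, the regularized sum really splits: it is the constant sum of
    -- `f m / m ^ 2` minus `tailDiv f 1 N`.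
    · have h0 : Summable fun m : ℕ => f (m + 1) / (m + 1 : ℕ) / (m + 1 : ℕ) := by
        refine (summable_div_mul_inv_pow hf 0 le_rfl).congr fun m => ?_
        simp [div_eq_mul_inv]
      refine ((const (∑' m : ℕ, f (m + 1) / (m + 1 : ℕ) / (m + 1 : ℕ))).sub ih.2.div).congr
        fun N hN => ?_
      have hN' : (N : ℂ) ≠ 0 := by exact_mod_cast hN
      rw [mul_div_cancel_left₀ _ hN', tailDiv, tailDiv, ← tsum_mul_left,
        ← h0.tsum_sub (summable_div_mul_inv_pow hf N le_rfl)]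
      refine tsum_congr fun m => ?_
      have := mul_tailDiv_term N m (f (m + 1) / (m + 1 : ℕ)) 0
      simp only [zero_add] at this
      rw [this, pow_zero, mul_one]
  | @add f g hf hg ihf ihg =>
    constructor
    · intro j hj
      refine ((ihf.1 j hj).add (ihg.1 j hj)).congr fun N _ => ?_
      rw [tail, tail, tail, ← (summable_mul_inv_pow hf N hj).tsum_add (summable_mul_inv_pow hg N hj)]
      exact tsum_congr fun m => by ring
    · refine (ihf.2.add ihg.2).congr fun N _ => ?_
      rw [← mul_add, tailDiv, tailDiv, tailDiv, ← (summable_div_mul_inv_pow hf N le_rfl).tsum_add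
        (summable_div_mul_inv_pow hg N le_rfl)]
      congr 1
      exact tsum_congr fun m => by ring
  | @const_mul c f hf ih =>
    constructor
    · intro j hj
      refine ((ih.1 j hj).const_mul c).congr fun N _ => ?_
      rw [tail, tail, ← tsum_mul_left]
      exact tsum_congr fun m => by ring
    · refine (ih.2.const_mul c).congr fun N _ => ?_
      rw [mul_left_comm, tailDiv, tailDiv, ← tsum_mul_left]
      congr 1
      exact tsum_congr fun m => by ring
  | congr hf h ih =>
    constructor
    · intro j hj
      refine (ih.1 j hj).congr fun N _ => tsum_congr fun m => by rw [h _ (by omega)]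
    · refine ih.2.congr fun N _ => ?_
      congr 1
      exact tsum_congr fun m => by rw [h _ (by omega)]

theorem harmonic_tailDiv (hf : IsHarmonic f) {j : ℕ} (hj : 1 ≤ j) : IsHarmonic (tailDiv f j) :=
  ((harmonic_tail_aux hf).2 j hj).div.congr fun N hN => by
    have hN' : (N : ℂ) ≠ 0 := by exact_mod_cast hN
    rw [mul_div_cancel_left₀ _ hN']
end IsHarmonic

/-! ### Identity theorem and gluing of meromorphic continuations. -/

theorem MeromorphicOn.eventuallyEq_of_isPreconnected {F G : ℂ → ℂ} {U : Set ℂ}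
    (hF : MeromorphicOn F U) (hG : MeromorphicOn G U) (hU : IsPreconnected U) {y : ℂ} (hy : y ∈ U)
    (h : F =ᶠ[𝓝[≠] y] G) {x : ℂ} (hx : x ∈ U) : F =ᶠ[𝓝[≠] x] G := by
  have hsub : MeromorphicOn (F - G) U := hF.sub hG
  have hy' : meromorphicOrderAt (F - G) y = ⊤ := by
    rw [meromorphicOrderAt_eq_top_iff]
    filter_upwards [h] with z hz
    simp [hz]
  have hx' : meromorphicOrderAt (F - G) x = ⊤ := by
    by_contra hne
    exact hsub.meromorphicOrderAt_ne_top_of_isPreconnected hU hx hy hne hy'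
  rw [meromorphicOrderAt_eq_top_iff] at hx'
  filter_upwards [hx'] with z hz
  exact sub_eq_zero.mp hz

theorem eventuallyEq_nhdsNE_of_forall_re_lt {F G : ℂ → ℂ} {σ : ℝ}
    (h : ∀ s : ℂ, σ < s.re → F s = G s) {y : ℂ} (hy : σ < y.re) : F =ᶠ[𝓝[≠] y] G := by
  apply Filter.Eventually.filter_mono nhdsWithin_le_nhds
  filter_upwards [(isOpen_lt continuous_const Complex.continuous_re).mem_nhds hy] with z hz
  exact h z hz

theorem toMeromorphicNFOn_eq_of_analyticAt {G : ℂ → ℂ} {U : Set ℂ} (hG : MeromorphicOn G U)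
    {s : ℂ} (hs : s ∈ U) (h : AnalyticAt ℂ G s) : toMeromorphicNFOn G U s = G s :=
  (((meromorphicNFOn_toMeromorphicNFOn G U hs).eventuallyEq_nhdsNE_iff_eventuallyEq_nhds
    h.meromorphicNFAt).mp (hG.toMeromorphicNFOn_eq_self_on_nhdsNE hs)).eq_of_nhds

theorem exists_isMeromorphicContinuation {ι : Type} {f : ι → ℂ → ℂ} {G : ℂ → ℂ}
    (hG : MeromorphicOn G Set.univ) (σ : ℝ) (ha : ∀ s : ℂ, σ < s.re → AnalyticAt ℂ G s)
    (h : ∀ s : ℂ, σ < s.re → HasSum (fun i => f i s) (G s)) :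
    IsMeromorphicContinuation f (toMeromorphicNFOn G Set.univ) := by
  refine ⟨meromorphicNFOn_toMeromorphicNFOn G Set.univ, σ, fun s hs => ?_⟩
  rw [toMeromorphicNFOn_eq_of_analyticAt hG (Set.mem_univ s) (ha s hs)]
  exact h s hs

/-- `Z`, defined on the half plane `3 < re s`, extends meromorphically to all half planes. -/
def ExtendsMeromorphically (Z : ℂ → ℂ) : Prop :=
  ∀ M : ℕ, ∃ F : ℂ → ℂ, MeromorphicOn F {s | -(M : ℝ) < s.re} ∧ ∀ s : ℂ, 3 < s.re → F s = Z s

theorem isPreconnected_re_lt (c : ℝ) : IsPreconnected {s : ℂ | c < s.re} :=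
  (convex_halfSpace_re_gt c).isPreconnected

/-- Extensions to different half-planes agree only up to values at isolated points. In normal form
they agree everywhere on the smaller half-plane, so they glue. -/
theorem ExtendsMeromorphically.exists_meromorphicOn_univ {Z : ℂ → ℂ} (h : ExtendsMeromorphically Z)
    (hZ : ∀ s : ℂ, 3 < s.re → AnalyticAt ℂ Z s) :
    ∃ F : ℂ → ℂ, MeromorphicOn F Set.univ ∧ ∀ s : ℂ, 3 < s.re → F s = Z s := by
  choose F hF hFZ using h
  let U : ℕ → Set ℂ := fun M => {s | -(M : ℝ) < s.re}
  have hUo : ∀ M, IsOpen (U M) := fun M => isOpen_lt continuous_const Complex.continuous_re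
  let N : ℕ → ℂ → ℂ := fun M => toMeromorphicNFOn (F M) (U M)
  have hN : ∀ M, MeromorphicNFOn (N M) (U M) := fun M => meromorphicNFOn_toMeromorphicNFOn _ _
  have hU2 : ∀ M, ∀ s : ℂ, 3 < s.re → s ∈ U M := fun M s hs => by
    show -(M : ℝ) < s.re
    have : (0 : ℝ) ≤ M := by positivity
    linarith
  have hNZ : ∀ M, ∀ s : ℂ, 3 < s.re → N M s = Z s := by
    intro M s hs
    have hev : Z =ᶠ[𝓝 s] F M := by
      filter_upwards [(isOpen_lt continuous_const Complex.continuous_re).mem_nhds hs] with z hz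
      exact (hFZ M z hz).symm
    have ha : AnalyticAt ℂ (F M) s := (hZ s hs).congr hev
    rw [← hFZ M s hs]
    exact toMeromorphicNFOn_eq_of_analyticAt (hF M) (hU2 M s hs) ha
  have hmono : ∀ M K, M ≤ K → U M ⊆ U K := by
    intro M K h s hs
    have : (M : ℝ) ≤ K := by exact_mod_cast h
    simp only [U, Set.mem_ofPred_eq] at hs ⊢
    linarith
  have heq : ∀ M K, M ≤ K → ∀ s ∈ U M, N M s = N K s := by
    intro M K hMK s hs
    have h3 : (3 : ℝ) < (4 : ℂ).re := by norm_num
    have := MeromorphicOn.eventuallyEq_of_isPreconnected (hN M).meromorphicOn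
      ((hN K).meromorphicOn.mono_set (hmono M K hMK)) (isPreconnected_re_lt _) (hU2 M 4 h3)
      (eventuallyEq_nhdsNE_of_forall_re_lt (fun s hs => (hNZ M s hs).trans (hNZ K s hs).symm) h3) hs
    exact (((hN M hs).eventuallyEq_nhdsNE_iff_eventuallyEq_nhds
      (hN K (hmono M K hMK hs))).mp this).eq_of_nhds
  -- Since `re s ≥ -‖s‖`, the half-plane with this index contains `s`.
  let idx : ℂ → ℕ := fun s => ⌈‖s‖⌉₊ + 1
  have hidx : ∀ s, s ∈ U (idx s) := by
    intro s
    simp only [U, idx, Set.mem_ofPred_eq]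
    have h1 := Nat.le_ceil ‖s‖
    have h2 := (abs_le.mp (Complex.abs_re_le_norm s)).1
    push_cast
    linarith
  refine ⟨fun s => N (idx s) s, fun x _ => ?_, fun s hs => hNZ _ s hs⟩
  refine ((hN (idx x)).meromorphicOn x (hidx x)).congr ?_
  apply Filter.Eventually.filter_mono nhdsWithin_le_nhds
  filter_upwards [(hUo (idx x)).mem_nhds (hidx x)] with z hz
  rcases le_total (idx x) (idx z) with h | h
  · exact heq _ _ h z hz
  · exact (heq _ _ h z (hidx z)).symm

theorem meromorphicAt_riemannZeta (s : ℂ) : MeromorphicAt riemannZeta s := by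
  by_cases hs : s = 1
  · subst hs
    -- Near `1` the zeta function is the completed one, an entire function minus two simple
    -- fractions, times the entire function `1 / Gammaℝ`.
    have h1 : MeromorphicAt (fun s : ℂ => (completedRiemannZeta₀ s - 1 / s - 1 / (1 - s)) *
        (Complex.Gammaℝ s)⁻¹) 1 := by
      have e1 : AnalyticAt ℂ completedRiemannZeta₀ 1 :=
        differentiable_completedZeta₀.analyticAt 1
      have e2 : AnalyticAt ℂ (fun s => (Complex.Gammaℝ s)⁻¹) 1 :=
        Complex.differentiable_Gammaℝ_inv.analyticAt 1
      have := e1.meromorphicAt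
      have := e2.meromorphicAt
      fun_prop
    refine h1.congr ?_
    apply Filter.Eventually.filter_mono nhdsWithin_le_nhds
    filter_upwards [isOpen_compl_singleton.mem_nhds (show (1 : ℂ) ∈ ({0} : Set ℂ)ᶜ by simp)]
      with z hz
    rw [riemannZeta_def_of_ne_zero hz, completedRiemannZeta_eq]
    exact (div_eq_mul_inv _ _).symm
  · refine AnalyticAt.meromorphicAt ?_
    refine DifferentiableOn.analyticAt (s := {1}ᶜ) (fun z hz => ?_)
      (isOpen_compl_singleton.mem_nhds hs)
    exact (differentiableAt_riemannZeta hz).differentiableWithinAt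

theorem analyticAt_riemannZeta {s : ℂ} (hs : s ≠ 1) : AnalyticAt ℂ riemannZeta s := by
  refine DifferentiableOn.analyticAt (s := {1}ᶜ) (fun z hz => ?_)
    (isOpen_compl_singleton.mem_nhds hs)
  exact (differentiableAt_riemannZeta hz).differentiableWithinAt

/-! ### Binomial expansion and continuation of Dirichlet series. -/

/-- The coefficients `s (s + 1) ⋯ (s + i - 1) / i!` of `(1 - x) ^ (-s)`. -/
noncomputable def risingCoeff (s : ℂ) (i : ℕ) : ℂ := ∏ k ∈ Finset.range i, (s + k) / (k + 1)

theorem risingCoeff_eq (s : ℂ) (i : ℕ) : risingCoeff s i = Ring.choose (s + i - 1) i := by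
  rw [← Ring.multichoose_eq]
  have h : ∀ n : ℕ, (n.factorial : ℂ) * risingCoeff s n = (ascPochhammer ℕ n).smeval s := by
    intro n
    induction n with
    | zero => simp [risingCoeff]
    | succ n ih =>
      rw [ascPochhammer_succ_right, Polynomial.smeval_mul, ← ih, risingCoeff,
        Finset.prod_range_succ, ← risingCoeff, Nat.factorial_succ]
      have : (n : ℂ) + 1 ≠ 0 := by exact_mod_cast Nat.succ_ne_zero n
      simp [Polynomial.smeval_add, Polynomial.smeval_natCast]
      field_simp
  have h2 := Ring.factorial_nsmul_multichoose_eq_ascPochhammer s i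
  rw [nsmul_eq_mul, ← h i] at h2
  exact (mul_left_cancel₀ (by exact_mod_cast Nat.factorial_ne_zero i) h2).symm

theorem hasSum_risingCoeff (s : ℂ) {x : ℂ} (hx : ‖x‖ < 1) :
    HasSum (fun i => risingCoeff s i * x ^ i) (1 / (1 - x) ^ s) := by
  have h := (Complex.one_div_one_sub_cpow_hasFPowerSeriesOnBall_zero s).hasSum_sub (y := x)
    (by rw [← ENNReal.ofReal_one, Metric.eball_ofReal]; simpa using hx)
  simp only [sub_zero] at h
  refine h.congr_fun fun i => ?_
  rw [risingCoeff_eq]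
  simp [mul_comm]

/-- Each factor `s + k` is at most `R + k` in norm. The series at the real point `R` therefore
majorizes all `s` in a disc, which makes the remainder estimates locally uniform. -/
theorem norm_risingCoeff_le {s : ℂ} {R : ℝ} (h : ‖s‖ ≤ R) (i : ℕ) :
    ‖risingCoeff s i‖ ≤ ‖risingCoeff R i‖ := by
  have hR : 0 ≤ R := (norm_nonneg s).trans h
  simp only [risingCoeff, norm_prod]
  refine Finset.prod_le_prod (fun _ _ => norm_nonneg _) fun k _ => ?_
  rw [norm_div, norm_div]
  gcongr
  have : ((R : ℂ) + k) = ((R + k : ℝ) : ℂ) := by push_cast; rfl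
  rw [this, Complex.norm_real, Real.norm_of_nonneg (by positivity)]
  exact (norm_add_le _ _).trans (by simpa using h)

theorem differentiable_risingCoeff (i : ℕ) : Differentiable ℂ fun s => risingCoeff s i := by
  unfold risingCoeff
  fun_prop

/-- The remainder of the Taylor expansion of `(1 - x) ^ (-s)`. -/
theorem exists_norm_remainder_le (R : ℝ) (K : ℕ) : ∃ B : ℝ, 0 ≤ B ∧ ∀ s : ℂ, ‖s‖ ≤ R → ∀ x : ℂ,
    ‖x‖ ≤ 1 / 2 →
    ‖1 / (1 - x) ^ s - ∑ i ∈ Finset.range K, risingCoeff s i * x ^ i‖ ≤ B * ‖x‖ ^ K := by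
  have hsum : Summable fun i => ‖risingCoeff R i‖ * (1 / 2 : ℝ) ^ i := by
    have := (hasSum_risingCoeff (R : ℂ) (x := 1 / 2) (by norm_num)).summable.norm
    refine this.congr fun i => ?_
    simp
  have hsum' := ((summable_nat_add_iff K).mpr hsum).mul_left ((2 : ℝ) ^ K)
  -- The factor `2 ^ K` undoes `(1 / 2) ^ K`: `K` powers of `‖x‖` are kept, and only the other `i`
  -- are bounded by powers of `1 / 2`.
  refine ⟨∑' i, 2 ^ K * (‖risingCoeff R (i + K)‖ * (1 / 2 : ℝ) ^ (i + K)),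
    tsum_nonneg fun i => by positivity, fun s hs x hx => ?_⟩
  have h1 := hasSum_risingCoeff s (lt_of_le_of_lt hx (by norm_num))
  have h2 := (hasSum_nat_add_iff' K).mpr h1
  rw [← h2.tsum_eq, ← tsum_mul_right]
  refine tsum_of_norm_bounded (hsum'.mul_right (‖x‖ ^ K)).hasSum fun i => ?_
  rw [norm_mul, norm_pow, pow_add, pow_add]
  have h3 : ‖x‖ ^ i ≤ (1 / 2 : ℝ) ^ i := pow_le_pow_left₀ (norm_nonneg _) hx i
  calc ‖risingCoeff s (i + K)‖ * (‖x‖ ^ i * ‖x‖ ^ K)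
      ≤ ‖risingCoeff R (i + K)‖ * ((1 / 2 : ℝ) ^ i * ‖x‖ ^ K) := by
        gcongr
        exact norm_risingCoeff_le hs _
    _ = 2 ^ K * (‖risingCoeff R (i + K)‖ * ((1 / 2 : ℝ) ^ i * (1 / 2 : ℝ) ^ K)) * ‖x‖ ^ K := by
        have : (2 : ℝ) ^ K * (1 / 2 : ℝ) ^ K = 1 := by rw [← mul_pow]; norm_num
        linear_combination (-(‖risingCoeff R (i + K)‖ * (1 / 2 : ℝ) ^ i * ‖x‖ ^ K)) * this


theorem exists_norm_le_mul_rpow_of_sqrt {b : ℕ → ℂ} (hb : ∃ C : ℝ, 0 ≤ C ∧ ∀ n ≠ 0, ‖b n‖ ≤ C * √n) :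
    ∃ C : ℝ, ∀ n ≠ 0, ‖b n‖ ≤ C * (n : ℝ) ^ ((3 / 2 : ℝ) - 1) := by
  obtain ⟨C, -, h⟩ := hb
  refine ⟨C, fun n hn => (h n hn).trans_eq ?_⟩
  rw [Real.sqrt_eq_rpow]
  norm_num

theorem LSeriesSummable.of_sqrt {b : ℕ → ℂ} (hb : ∃ C : ℝ, 0 ≤ C ∧ ∀ n ≠ 0, ‖b n‖ ≤ C * √n)
    {s : ℂ} (hs : 3 / 2 < s.re) : LSeriesSummable b s :=
  LSeriesSummable_of_le_const_mul_rpow hs (exists_norm_le_mul_rpow_of_sqrt hb)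

theorem analyticAt_LSeries_of_sqrt {b : ℕ → ℂ} (hb : ∃ C : ℝ, 0 ≤ C ∧ ∀ n ≠ 0, ‖b n‖ ≤ C * √n)
    {s : ℂ} (hs : 3 / 2 < s.re) : AnalyticAt ℂ (LSeries b) s := by
  refine LSeries_analyticOnNhd b s ?_
  refine lt_of_le_of_lt
    (LSeries.abscissaOfAbsConv_le_of_le_const_mul_rpow (exists_norm_le_mul_rpow_of_sqrt hb)) ?_
  rw [← EReal.coe_one, ← EReal.coe_add, EReal.coe_lt_coe_iff]
  linarith

theorem sqrt_bound_succ {b : ℕ → ℂ} (hb : ∃ C : ℝ, 0 ≤ C ∧ ∀ n ≠ 0, ‖b n‖ ≤ C * √n) :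
    ∃ C : ℝ, 0 ≤ C ∧ ∀ n ≠ 0, ‖b (n + 1)‖ ≤ C * √n := by
  obtain ⟨C, hC, h⟩ := hb
  refine ⟨C * √2, by positivity, fun n hn => (h (n + 1) (by omega)).trans ?_⟩
  rw [mul_assoc, ← Real.sqrt_mul (by norm_num)]
  gcongr
  have : (1 : ℝ) ≤ n := by exact_mod_cast Nat.one_le_iff_ne_zero.mpr hn
  push_cast
  linarith

theorem hasSum_LSeries_succ {b : ℕ → ℂ} {s : ℂ} (h : LSeriesSummable b s) :
    HasSum (fun n : ℕ => b (n + 1) / ((n + 1 : ℕ) : ℂ) ^ s) (LSeries b s) := by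
  have h1 := (hasSum_nat_add_iff' 1).mpr h.LSeriesHasSum
  simp only [Finset.range_one, Finset.sum_singleton, LSeries.term_zero, sub_zero] at h1
  exact h1.congr_fun fun n => (LSeries.term_of_ne_zero (Nat.succ_ne_zero n) b s).symm

/-- The summand of the error term in the binomial expansion of the differences of a Dirichlet
series. -/
noncomputable def diffRemainder (b : ℕ → ℂ) (K n : ℕ) (s : ℂ) : ℂ :=
  b (n + 2) / ((n + 2 : ℕ) : ℂ) ^ s * (1 / (1 - ((n + 2 : ℕ) : ℂ)⁻¹) ^ s -
    ∑ i ∈ Finset.range K, risingCoeff s i * (((n + 2 : ℕ) : ℂ)⁻¹) ^ i)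

theorem exists_summable_norm_diffRemainder_le {b : ℕ → ℂ}
    (hb : ∃ C : ℝ, 0 ≤ C ∧ ∀ n ≠ 0, ‖b n‖ ≤ C * √n) (K : ℕ) (R : ℝ) :
    ∃ u : ℕ → ℝ, Summable u ∧ ∀ n, ∀ s : ℂ, ‖s‖ ≤ R → 2 - (K : ℝ) < s.re →
      ‖diffRemainder b K n s‖ ≤ u n := by
  obtain ⟨C, hC, h⟩ := hb
  obtain ⟨B, hB, hrem⟩ := exists_norm_remainder_le R K
  -- The decay is `√X * X ^ (-re s) * X ^ (-K)`, and `2 - K < re s` pushes its exponent below `-3 /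
  -- 2`.
  refine ⟨fun n => C * B * ((n + 2 : ℕ) : ℝ) ^ (-(3 / 2) : ℝ), ?_, fun n s hs hre => ?_⟩
  · have h1 : Summable fun n : ℕ => (n : ℝ) ^ (-(3 / 2) : ℝ) :=
      Real.summable_nat_rpow.mpr (by norm_num)
    exact (h1.comp_injective (add_left_injective 2)).mul_left _
  · have hN : (2 : ℝ) ≤ ((n + 2 : ℕ) : ℝ) := by push_cast; linarith [n.cast_nonneg (α := ℝ)]
    have hN0 : (0 : ℝ) < ((n + 2 : ℕ) : ℝ) := by linarith
    have hx : ‖(((n + 2 : ℕ) : ℂ))⁻¹‖ = ((n + 2 : ℕ) : ℝ)⁻¹ := by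
      rw [norm_inv, Complex.norm_natCast]
    have h1 := hrem s hs ((n + 2 : ℕ) : ℂ)⁻¹ (by
      rw [hx, inv_le_comm₀ hN0 (by norm_num)]; linarith)
    have h2 := h (n + 2) (by omega)
    rw [hx] at h1
    unfold diffRemainder
    rw [norm_mul, norm_div, Complex.norm_natCast_cpow_of_pos (by omega)]
    beta_reduce
    generalize 1 / (1 - ((n + 2 : ℕ) : ℂ)⁻¹) ^ s - _ = r at h1 ⊢
    generalize ((n + 2 : ℕ) : ℝ) = X at *
    have h3 : X ^ (1 / 2 - s.re - K) = √X / X ^ s.re * (X⁻¹) ^ K := by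
      rw [Real.rpow_sub hN0, Real.rpow_sub hN0, Real.rpow_natCast, Real.sqrt_eq_rpow, inv_pow]
      rfl
    calc ‖b (n + 2)‖ / X ^ s.re * ‖r‖ ≤ (C * √X) / X ^ s.re * (B * (X⁻¹) ^ K) := by gcongr
      _ = C * B * X ^ (1 / 2 - s.re - K) := by rw [h3]; ring
      _ ≤ C * B * X ^ (-(3 / 2) : ℝ) := by
        refine mul_le_mul_of_nonneg_left ?_ (by positivity)
        exact Real.rpow_le_rpow_of_exponent_le (by linarith) (by linarith)

theorem differentiable_diffRemainder (b : ℕ → ℂ) (K n : ℕ) :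
    Differentiable ℂ (diffRemainder b K n) := by
  have h1 : ((n + 2 : ℕ) : ℂ) ≠ 0 := by exact_mod_cast (by omega : n + 2 ≠ 0)
  have h2 : (1 - ((n + 2 : ℕ) : ℂ)⁻¹) ≠ 0 := by
    have : (n : ℂ) + 1 ≠ 0 := by exact_mod_cast Nat.succ_ne_zero n
    rw [sub_ne_zero]
    intro h
    rw [eq_comm, inv_eq_one] at h
    apply this
    push_cast at h
    linear_combination h
  have h3 : ∀ i, Differentiable ℂ fun s => risingCoeff s i := differentiable_risingCoeff
  have e1 : Differentiable ℂ fun s : ℂ => ((n + 2 : ℕ) : ℂ) ^ s := fun s =>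
    (differentiableAt_id.const_cpow (Or.inl h1))
  have e2 : Differentiable ℂ fun s : ℂ => (1 - ((n + 2 : ℕ) : ℂ)⁻¹) ^ s := fun s =>
    (differentiableAt_id.const_cpow (Or.inl h2))
  unfold diffRemainder
  refine Differentiable.mul ((differentiable_const _).div e1 fun s => ?_)
    (((differentiable_const _).div e2 fun s => ?_).sub ?_)
  · exact fun h => h1 ((Complex.cpow_eq_zero_iff _ _).mp h).1
  · exact fun h => h2 ((Complex.cpow_eq_zero_iff _ _).mp h).1
  · exact Differentiable.fun_sum fun i _ => (h3 i).mul_const _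

theorem analyticAt_tsum_diffRemainder {b : ℕ → ℂ}
    (hb : ∃ C : ℝ, 0 ≤ C ∧ ∀ n ≠ 0, ‖b n‖ ≤ C * √n) (K : ℕ) {s : ℂ} (hs : 2 - (K : ℝ) < s.re) :
    AnalyticAt ℂ (fun s => ∑' n, diffRemainder b K n s) s := by
  obtain ⟨u, hu, h⟩ := exists_summable_norm_diffRemainder_le hb K (‖s‖ + 1)
  let U : Set ℂ := {z | 2 - (K : ℝ) < z.re} ∩ Metric.ball 0 (‖s‖ + 1)
  have hU : IsOpen U := (isOpen_lt continuous_const Complex.continuous_re).inter Metric.isOpen_ball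
  have hsU : s ∈ U := ⟨hs, by simp⟩
  refine (Complex.differentiableOn_tsum_of_summable_norm hu
    (fun n => (differentiable_diffRemainder b K n).differentiableOn) hU
    fun n z hz => h n z ?_ hz.1).analyticAt (hU.mem_nhds hsU)
  have := hz.2
  rw [mem_ball_zero_iff] at this
  exact this.le

/-- Write `n = (n + 1) (1 - 1 / (n + 1))` in the sum of `b (n + 1) / n ^ s` and expand in powers of
`1 / (n + 1)`. The term of order zero cancels against `LSeries b s`. The condition `b 1 = 0` makes
the shifted sums complete Dirichlet series. -/
theorem LSeries_sub_eq {b : ℕ → ℂ} (hb : ∃ C : ℝ, 0 ≤ C ∧ ∀ n ≠ 0, ‖b n‖ ≤ C * √n)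
    (h1 : b 1 = 0) (K : ℕ) {s : ℂ} (hs : 2 < s.re) :
    LSeries (fun n => b (n + 1) - b n) s = (∑ i ∈ Finset.range K,
      risingCoeff s (i + 1) * LSeries b (s + (i + 1 : ℕ))) + ∑' n, diffRemainder b (K + 1) n s := by
  have hZ : ∀ i : ℕ, HasSum (fun n : ℕ => b (n + 2) / ((n + 2 : ℕ) : ℂ) ^ (s + i))
      (LSeries b (s + i)) := by
    intro i
    have hre : 3 / 2 < (s + i).re := by
      have : (0 : ℝ) ≤ i := i.cast_nonneg
      simp only [Complex.add_re, Complex.natCast_re]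
      linarith
    have := (hasSum_nat_add_iff' 1).mpr (hasSum_LSeries_succ (LSeriesSummable.of_sqrt hb hre))
    simpa [h1, add_assoc] using this
  have hD := (hasSum_LSeries_succ (LSeriesSummable.of_sqrt (sqrt_bound_succ hb)
    (show 3 / 2 < s.re by linarith))).summable
  have hΔ : LSeries (fun n => b (n + 1) - b n) s =
      (∑' n : ℕ, b (n + 2) / ((n + 1 : ℕ) : ℂ) ^ s) - LSeries b s := by
    have e1 := LSeriesSummable.of_sqrt (sqrt_bound_succ hb) (show 3 / 2 < s.re by linarith)
    have e2 := LSeriesSummable.of_sqrt hb (show 3 / 2 < s.re by linarith)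
    have := LSeries_sub e1 e2
    rw [← (hasSum_LSeries_succ e1).tsum_eq] at this
    exact this
  have hterm : ∀ n : ℕ, b (n + 2) / ((n + 1 : ℕ) : ℂ) ^ s =
      (∑ i ∈ Finset.range (K + 1),
        risingCoeff s i * (b (n + 2) / ((n + 2 : ℕ) : ℂ) ^ (s + i))) +
      diffRemainder b (K + 1) n s := by
    intro n
    have hN : ((n + 2 : ℕ) : ℂ) ≠ 0 := by exact_mod_cast (by omega : n + 2 ≠ 0)
    have hprod : ((n + 1 : ℕ) : ℂ) ^ s =
        ((n + 2 : ℕ) : ℂ) ^ s * (1 - ((n + 2 : ℕ) : ℂ)⁻¹) ^ s := by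
      have hr : (0 : ℝ) ≤ 1 - ((n + 2 : ℕ) : ℝ)⁻¹ := by
        rw [sub_nonneg]
        apply inv_le_one_of_one_le₀
        push_cast
        linarith [n.cast_nonneg (α := ℝ)]
      have := Complex.mul_cpow_ofReal_nonneg (a := ((n + 2 : ℕ) : ℝ))
        (b := 1 - ((n + 2 : ℕ) : ℝ)⁻¹) (by positivity) hr s
      rw [show ((1 - ((n + 2 : ℕ) : ℝ)⁻¹ : ℝ) : ℂ) = 1 - ((n + 2 : ℕ) : ℂ)⁻¹ by push_cast; rfl,
        Complex.ofReal_natCast] at this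
      rw [← this]
      congr 1
      rw [mul_sub, mul_one, mul_inv_cancel₀ hN]
      push_cast
      ring
    unfold diffRemainder
    rw [mul_sub, Finset.mul_sum, hprod]
    have : ∀ i ∈ Finset.range (K + 1), risingCoeff s i * (b (n + 2) / ((n + 2 : ℕ) : ℂ) ^ (s + i)) =
        b (n + 2) / ((n + 2 : ℕ) : ℂ) ^ s * (risingCoeff s i * (((n + 2 : ℕ) : ℂ)⁻¹) ^ i) := by
      intro i _
      rw [Complex.cpow_add _ _ hN, Complex.cpow_natCast, inv_pow]
      simp only [div_eq_mul_inv, mul_inv]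
      ring
    rw [Finset.sum_congr rfl this]
    simp only [div_eq_mul_inv, mul_inv]
    ring
  have hS := hasSum_sum (s := Finset.range (K + 1)) (fun i _ => (hZ i).mul_left (risingCoeff s i))
  have hR : Summable fun n => diffRemainder b (K + 1) n s := by
    obtain ⟨u, hu, h⟩ := exists_summable_norm_diffRemainder_le hb (K + 1) ‖s‖
    refine Summable.of_norm_bounded hu fun n => h n s le_rfl ?_
    push_cast
    linarith [K.cast_nonneg (α := ℝ)]
  rw [hΔ, tsum_congr hterm, (hS.add hR.hasSum).tsum_eq, Finset.sum_range_succ']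
  simp [risingCoeff]
  ring

theorem MeromorphicOn.comp_add_const {F : ℂ → ℂ} {U : Set ℂ} (hF : MeromorphicOn F U) (c : ℂ) :
    MeromorphicOn (fun s => F (s + c)) {s | s + c ∈ U} := by
  intro s hs
  exact MeromorphicAt.comp_analyticAt (f := F) (g := fun s => s + c) (hF (s + c) hs) (by fun_prop)

theorem ExtendsMeromorphically.comp_add_one {Z : ℂ → ℂ} (h : ExtendsMeromorphically Z) :
    ExtendsMeromorphically fun s => Z (s + 1) := by
  intro M
  obtain ⟨F, hF, hFZ⟩ := h M
  refine ⟨fun s => F (s + 1), (hF.comp_add_const 1).mono_set fun s hs => ?_, fun s hs => hFZ _ ?_⟩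
  · show -(M : ℝ) < (s + 1).re
    have : -(M : ℝ) < s.re := hs
    simp only [Complex.add_re, Complex.one_re]
    linarith
  · simp only [Complex.add_re, Complex.one_re]
    linarith

/-- In the expansion at `s = w - 1` the leading term is `(w - 1) * LSeries b w`; all other values of
the series lie at least one unit further right. Solving for the leading term enlarges the half-plane
by one unit, at the possible cost of poles. -/
theorem extendsMeromorphically_LSeries_of_sub {b : ℕ → ℂ}
    (hb : ∃ C : ℝ, 0 ≤ C ∧ ∀ n ≠ 0, ‖b n‖ ≤ C * √n) (h1 : b 1 = 0) {Y : ℂ → ℂ}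
    (hY : ExtendsMeromorphically Y)
    (hd : ∀ s, LSeries (fun n => b (n + 1) - b n) s = Y (s + 1)) :
    ExtendsMeromorphically (LSeries b) := by
  have key : ∀ m : ℕ, ∃ F : ℂ → ℂ, MeromorphicOn F {s | 3 - (m : ℝ) < s.re} ∧
      ∀ s : ℂ, 3 < s.re → F s = LSeries b s := by
    intro m
    induction m with
    | zero =>
      refine ⟨LSeries b, fun s hs => (analyticAt_LSeries_of_sqrt hb ?_).meromorphicAt,
        fun s _ => rfl⟩
      have : 3 - ((0 : ℕ) : ℝ) < s.re := hs
      norm_num at this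
      linarith
    | succ m ih =>
      obtain ⟨F, hF, hFZ⟩ := ih
      obtain ⟨G, hG, hGY⟩ := hY m
      refine ⟨fun w => (w - 1)⁻¹ * (G w - (∑ i ∈ Finset.range m,
        risingCoeff (w - 1) (i + 2) * F (w + (i + 1 : ℕ))) -
          ∑' n, diffRemainder b (m + 1 + 1) n (w - 1)), ?_, fun w hw => ?_⟩
      · intro w hw
        have hw' : 2 - (m : ℝ) < w.re := by
          have : 3 - ((m + 1 : ℕ) : ℝ) < w.re := hw
          push_cast at this
          linarith
        have e1 : MeromorphicAt G w := hG w (show -(m : ℝ) < w.re by linarith)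
        have e2 : ∀ i : ℕ, MeromorphicAt (fun w => F (w + (i + 1 : ℕ))) w := fun i =>
          hF.comp_add_const _ w (by
            show 3 - (m : ℝ) < (w + (i + 1 : ℕ)).re
            simp only [Complex.add_re, Complex.natCast_re]
            push_cast
            linarith [i.cast_nonneg (α := ℝ)])
        have e3 : MeromorphicAt (fun w => ∑' n, diffRemainder b (m + 1 + 1) n (w - 1)) w := by
          refine MeromorphicAt.comp_analyticAt (f := fun s => ∑' n, diffRemainder b (m + 1 + 1) n s)
            (g := fun w => w - 1)
            (analyticAt_tsum_diffRemainder hb (m + 1 + 1) ?_).meromorphicAt (by fun_prop)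
          simp only [Complex.sub_re, Complex.one_re]
          push_cast
          linarith
        have e4 : ∀ i : ℕ, MeromorphicAt (fun w => risingCoeff (w - 1) i) w := fun i => by
          have : Differentiable ℂ fun w => risingCoeff (w - 1) i :=
            (differentiable_risingCoeff i).comp (by fun_prop)
          exact (this.analyticAt w).meromorphicAt
        have e5 : MeromorphicAt (fun w : ℂ => (w - 1)⁻¹) w := by fun_prop
        refine e5.fun_mul ((e1.fun_sub (MeromorphicAt.fun_sum fun i _ => ?_)).fun_sub e3)
        exact (e4 _).fun_mul (e2 i)
      · have hw1 : w - 1 ≠ 0 := by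
          intro h
          have := congrArg Complex.re h
          simp only [Complex.sub_re, Complex.one_re, Complex.zero_re] at this
          linarith
        have h2 := LSeries_sub_eq hb h1 (m + 1) (s := w - 1) (by
          simp only [Complex.sub_re, Complex.one_re]; linarith)
        rw [hd, sub_add_cancel, Finset.sum_range_succ'] at h2
        have h3 : ∀ i ∈ Finset.range m, risingCoeff (w - 1) (i + 2) * F (w + (i + 1 : ℕ)) =
            risingCoeff (w - 1) (i + 1 + 1) * LSeries b (w - 1 + (i + 1 + 1 : ℕ)) := by
          intro i _
          rw [hFZ]
          · congr 2
            push_cast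
            ring
          · simp only [Complex.add_re, Complex.natCast_re]
            linarith [(i + 1).cast_nonneg (α := ℝ)]
        simp only [Finset.sum_congr rfl h3, hGY w hw, h2]
        rw [inv_mul_eq_iff_eq_mul₀ hw1]
        have h4 : risingCoeff (w - 1) (0 + 1) = w - 1 := by simp [risingCoeff]
        have h5 : w - 1 + ((0 + 1 : ℕ) : ℂ) = w := by simp
        rw [h4, h5]
        ring
  intro M
  obtain ⟨F, hF, h⟩ := key (M + 3)
  refine ⟨F, hF.mono_set fun s hs => ?_, h⟩
  have : -(M : ℝ) < s.re := hs
  show 3 - ((M + 3 : ℕ) : ℝ) < s.re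
  push_cast
  linarith

theorem LSeries_div (a : ℕ → ℂ) (s : ℂ) : LSeries (fun n => a n / n) s = LSeries a (s + 1) := by
  refine tsum_congr fun n => ?_
  rcases eq_or_ne n 0 with rfl | hn
  · simp
  · rw [LSeries.term_of_ne_zero hn, LSeries.term_of_ne_zero hn,
      Complex.cpow_add _ _ (by exact_mod_cast hn), Complex.cpow_one, div_div, mul_comm]

theorem ExtendsMeromorphically.congr {Y Z : ℂ → ℂ} (h : ExtendsMeromorphically Y)
    (hYZ : ∀ s : ℂ, 3 < s.re → Y s = Z s) : ExtendsMeromorphically Z := fun M =>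
  (h M).imp fun _ hF => ⟨hF.1, fun s hs => (hF.2 s hs).trans (hYZ s hs)⟩

/-- Induction along the generation of the class. The constant sequence gives `ζ`, division by `n`
shifts `s` by one, and an iterated sum has first difference `a n / n`, so its series is governed by
that of `a` at `s + 1`. -/
theorem IsHarmonic.extendsMeromorphically {a : ℕ → ℂ} (ha : IsHarmonic a) :
    ExtendsMeromorphically (LSeries a) := by
  induction ha with
  | one =>
    intro M
    refine ⟨riemannZeta, fun s _ => meromorphicAt_riemannZeta s, fun s hs => ?_⟩
    exact (LSeries_one_eq_riemannZeta (by linarith)).symm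
  | @add a b ha hb iha ihb =>
    intro M
    obtain ⟨F, hF, hFZ⟩ := iha M
    obtain ⟨G, hG, hGZ⟩ := ihb M
    refine ⟨F + G, hF.add hG, fun s hs => ?_⟩
    have h1 := LSeriesSummable.of_sqrt ha.exists_bound (show 3 / 2 < s.re by linarith)
    have h2 := LSeriesSummable.of_sqrt hb.exists_bound (show 3 / 2 < s.re by linarith)
    rw [Pi.add_apply, hFZ s hs, hGZ s hs]
    exact (LSeries_add h1 h2).symm
  | @const_mul c a ha iha =>
    intro M
    obtain ⟨F, hF, hFZ⟩ := iha M
    refine ⟨fun s => c * F s, fun s hs => (MeromorphicAt.const c s).fun_mul (hF s hs),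
      fun s hs => ?_⟩
    simp only [hFZ s hs]
    exact (LSeries_smul a c s).symm
  | @div a ha iha =>
    exact iha.comp_add_one.congr fun s _ => (LSeries_div a s).symm
  | @sum a ha iha =>
    refine extendsMeromorphically_LSeries_of_sub ha.sum.exists_bound (by simp) iha fun s => ?_
    rw [← LSeries_div]
    simp [Finset.sum_range_succ]
  | @congr a b ha h iha =>
    refine iha.congr fun s _ => LSeries_congr (fun hn => h _ hn) s

theorem IsHarmonic.exists_meromorphicOn_univ {a : ℕ → ℂ} (ha : IsHarmonic a) :
    ∃ F : ℂ → ℂ, MeromorphicOn F Set.univ ∧ ∀ s : ℂ, 3 < s.re → F s = LSeries a s :=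
  ha.extendsMeromorphically.exists_meromorphicOn_univ fun s hs =>
    analyticAt_LSeries_of_sqrt ha.exists_bound (by linarith)


/-! ### Coefficients of the one-variable Dirichlet series are harmonic. -/

/-- `x ^ (-k)` for natural numbers `k` and `x`. -/
noncomputable def invPow (k x : ℕ) : ℂ := (x : ℂ)⁻¹ ^ k

theorem norm_invPow_le_one (k x : ℕ) : ‖invPow k x‖ ≤ 1 := by
  rw [invPow, norm_pow, norm_inv, Complex.norm_natCast]
  exact pow_le_one₀ (by positivity) (Nat.cast_inv_le_one x)

theorem norm_invPow_le {k j x y : ℕ} (hjk : j ≤ k) (hyx : y + 1 ≤ x) :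
    ‖invPow k x‖ ≤ ((y + 1 : ℕ) : ℝ)⁻¹ ^ j := by
  rw [invPow, norm_pow, norm_inv, Complex.norm_natCast]
  have h1 : (x : ℝ)⁻¹ ≤ ((y + 1 : ℕ) : ℝ)⁻¹ :=
    inv_anti₀ (by positivity) (by exact_mod_cast hyx)
  calc ((x : ℝ)⁻¹) ^ k ≤ (x : ℝ)⁻¹ ^ j := pow_le_pow_of_le_one (by positivity)
        (Nat.cast_inv_le_one x) hjk
    _ ≤ _ := pow_le_pow_left₀ (by positivity) h1 j

theorem invPow_add (j k x : ℕ) : invPow (j + k) x = invPow j x * invPow k x := pow_add _ _ _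

theorem summable_inv_sq : Summable fun n : ℕ => ((n + 1 : ℕ) : ℝ)⁻¹ ^ 2 := by
  have := (summable_nat_add_iff 1).mpr (Real.summable_nat_pow_inv.mpr one_lt_two)
  simpa using this

theorem summable_of_norm_le_inv_sq_mul {g : ℕ × ℕ → ℂ}
    (h : ∀ x, ‖g x‖ ≤ ((x.1 + 1 : ℕ) : ℝ)⁻¹ ^ 2 * ((x.2 + 1 : ℕ) : ℝ)⁻¹ ^ 2) : Summable g :=
  Summable.of_norm_bounded (summable_inv_sq.mul_of_nonneg summable_inv_sq
    (fun _ => by positivity) (fun _ => by positivity)) h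

/-- Only the shape of the expansion matters for harmonicity, so the binomial coefficients are hidden
behind existential `α` and `β`. -/
theorem exists_invPow_mul_eq_of_add {b c : ℕ} (hb : 1 ≤ b) (hc : 1 ≤ c) :
    ∃ α β : ℕ → ℂ, ∀ u v y : ℕ, u ≠ 0 → v ≠ 0 → u + v = y → invPow b u * invPow c v =
      ∑ ω ∈ Finset.range b, α ω * (invPow (ω + 1) u * invPow (b + c - 1 - ω) y) +
      ∑ ω ∈ Finset.range c, β ω * (invPow (ω + 1) v * invPow (b + c - 1 - ω) y) := by
  refine ⟨fun ω => ((b + c - 2 - ω).choose (c - 1) : ℂ),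
    fun ω => ((b + c - 2 - ω).choose (b - 1) : ℂ), fun u v y hu hv h => ?_⟩
  have hu' : (u : ℂ) ≠ 0 := by exact_mod_cast hu
  have hv' : (v : ℂ) ≠ 0 := by exact_mod_cast hv
  have hy' : (y : ℂ) ≠ 0 := by exact_mod_cast (by omega : y ≠ 0)
  have := partialFraction hu' hv' hy' (by rw [← h]; push_cast; rfl) hb hc
  simp only [mul_assoc] at this
  exact this

theorem exists_invPow_mul_eq_of_sub {b c : ℕ} (hb : 1 ≤ b) (hc : 1 ≤ c) :
    ∃ α β : ℕ → ℂ, ∀ u v y : ℕ, u ≠ 0 → y ≠ 0 → u + y = v → invPow b u * invPow c v =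
      ∑ ω ∈ Finset.range b, α ω * (invPow (ω + 1) u * invPow (b + c - 1 - ω) y) +
      ∑ ω ∈ Finset.range c, β ω * (invPow (ω + 1) v * invPow (b + c - 1 - ω) y) := by
  refine ⟨fun ω => (-1) ^ b * (-1) ^ (ω + 1) * ((b + c - 2 - ω).choose (c - 1) : ℂ),
    fun ω => (-1) ^ b * ((b + c - 2 - ω).choose (b - 1) : ℂ), fun u v y hu hy h => ?_⟩
  have hu' : -(u : ℂ) ≠ 0 := neg_ne_zero.mpr (by exact_mod_cast hu)
  have hv' : (v : ℂ) ≠ 0 := by exact_mod_cast (by omega : v ≠ 0)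
  have hy' : (y : ℂ) ≠ 0 := by exact_mod_cast hy
  have := partialFraction hu' hv' hy' (by rw [← h]; push_cast; ring) hb hc
  have hneg : ∀ k : ℕ, (-(u : ℂ))⁻¹ ^ k = (-1) ^ k * invPow k u := fun k => by
    rw [inv_neg, neg_pow, invPow]
  have hsq : ((-1 : ℂ) ^ b) * (-1) ^ b = 1 := by rw [← mul_pow]; norm_num
  simp only [hneg] at this
  calc invPow b u * invPow c v = (-1) ^ b * ((-1) ^ b * invPow b u * (v : ℂ)⁻¹ ^ c) := by
        rw [← mul_assoc, ← mul_assoc, hsq, one_mul, invPow, invPow]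
    _ = _ := by
        rw [this, mul_add, Finset.mul_sum, Finset.mul_sum]
        simp only [invPow]
        congr 1 <;> exact Finset.sum_congr rfl fun ω _ => by ring

namespace IsHarmonic

theorem invPow_mul {f : ℕ → ℂ} (hf : IsHarmonic f) (k : ℕ) : IsHarmonic fun n => invPow k n * f n :=
  hf.inv_pow_mul k

/-- The reduction step for coefficients: two coupled factors `u`, `v` are traded for one of them and
a third form `y`, until only known harmonic operations remain. All exponents that arise are at least
`1`, as `hu` and `hv` demand. The index type may depend on `N`, since some coefficients are finite
sums whose range depends on `N`. -/
theorem tsum_of_expansion {κ : ℕ → Type} {w : ∀ N, κ N → ℂ} {u v y : ∀ N, κ N → ℕ} {b c : ℕ}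
    (hb : 1 ≤ b) (hc : 1 ≤ c)
    (hex : ∃ α β : ℕ → ℂ, ∀ N, N ≠ 0 → ∀ x, invPow b (u N x) * invPow c (v N x) =
      ∑ ω ∈ Finset.range b, α ω * (invPow (ω + 1) (u N x) * invPow (b + c - 1 - ω) (y N x)) +
      ∑ ω ∈ Finset.range c, β ω * (invPow (ω + 1) (v N x) * invPow (b + c - 1 - ω) (y N x)))
    (hu : ∀ i k, 1 ≤ i → 1 ≤ k →
      (∀ N, Summable fun x => w N x * (invPow i (u N x) * invPow k (y N x))) ∧
      IsHarmonic fun N => ∑' x, w N x * (invPow i (u N x) * invPow k (y N x)))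
    (hv : ∀ i k, 1 ≤ i → 1 ≤ k →
      (∀ N, Summable fun x => w N x * (invPow i (v N x) * invPow k (y N x))) ∧
      IsHarmonic fun N => ∑' x, w N x * (invPow i (v N x) * invPow k (y N x))) :
    IsHarmonic fun N => ∑' x, w N x * (invPow b (u N x) * invPow c (v N x)) := by
  obtain ⟨α, β, h⟩ := hex
  have key : IsHarmonic fun N =>
      ∑ ω ∈ Finset.range b, α ω * ∑' x, w N x * (invPow (ω + 1) (u N x) *
        invPow (b + c - 1 - ω) (y N x)) +
      ∑ ω ∈ Finset.range c, β ω * ∑' x, w N x * (invPow (ω + 1) (v N x) *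
        invPow (b + c - 1 - ω) (y N x)) := by
    refine (finset_sum _ _ fun ω hω => ?_).add (finset_sum _ _ fun ω hω => ?_)
    · have := Finset.mem_range.mp hω
      exact ((hu _ _ (by omega) (by omega)).2).const_mul _
    · have := Finset.mem_range.mp hω
      exact ((hv _ _ (by omega) (by omega)).2).const_mul _
  refine key.congr fun N hN => ?_
  have h1 : HasSum (fun x => ∑ ω ∈ Finset.range b, α ω * (w N x * (invPow (ω + 1) (u N x) *
      invPow (b + c - 1 - ω) (y N x)))) _ := hasSum_sum fun ω hω => by
    have := Finset.mem_range.mp hω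
    exact ((hu (ω + 1) (b + c - 1 - ω) (by omega) (by omega)).1 N).hasSum.mul_left (α ω)
  have h2 : HasSum (fun x => ∑ ω ∈ Finset.range c, β ω * (w N x * (invPow (ω + 1) (v N x) *
      invPow (b + c - 1 - ω) (y N x)))) _ := hasSum_sum fun ω hω => by
    have := Finset.mem_range.mp hω
    exact ((hv (ω + 1) (b + c - 1 - ω) (by omega) (by omega)).1 N).hasSum.mul_left (β ω)
  rw [← (h1.add h2).tsum_eq]
  refine tsum_congr fun x => ?_
  rw [h N hN x, mul_add, Finset.mul_sum, Finset.mul_sum]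
  congr 1 <;> exact Finset.sum_congr rfl fun ω _ => by ring

theorem tsum_of_sub {κ : ℕ → Type} {w : ∀ N, κ N → ℂ} {u v y : ∀ N, κ N → ℕ} {b c : ℕ}
    (hb : 1 ≤ b) (hc : 1 ≤ c)
    (h : ∀ N, N ≠ 0 → ∀ x, u N x ≠ 0 ∧ y N x ≠ 0 ∧ u N x + y N x = v N x)
    (hu : ∀ i k, 1 ≤ i → 1 ≤ k →
      (∀ N, Summable fun x => w N x * (invPow i (u N x) * invPow k (y N x))) ∧
      IsHarmonic fun N => ∑' x, w N x * (invPow i (u N x) * invPow k (y N x)))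
    (hv : ∀ i k, 1 ≤ i → 1 ≤ k →
      (∀ N, Summable fun x => w N x * (invPow i (v N x) * invPow k (y N x))) ∧
      IsHarmonic fun N => ∑' x, w N x * (invPow i (v N x) * invPow k (y N x))) :
    IsHarmonic fun N => ∑' x, w N x * (invPow b (u N x) * invPow c (v N x)) := by
  obtain ⟨α, β, hex⟩ := exists_invPow_mul_eq_of_sub hb hc
  exact tsum_of_expansion hb hc ⟨α, β, fun N hN x =>
    hex _ _ _ (h N hN x).1 (h N hN x).2.1 (h N hN x).2.2⟩ hu hv

theorem tsum_of_add {κ : ℕ → Type} {w : ∀ N, κ N → ℂ} {u v y : ∀ N, κ N → ℕ} {b c : ℕ}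
    (hb : 1 ≤ b) (hc : 1 ≤ c)
    (h : ∀ N, N ≠ 0 → ∀ x, u N x ≠ 0 ∧ v N x ≠ 0 ∧ u N x + v N x = y N x)
    (hu : ∀ i k, 1 ≤ i → 1 ≤ k →
      (∀ N, Summable fun x => w N x * (invPow i (u N x) * invPow k (y N x))) ∧
      IsHarmonic fun N => ∑' x, w N x * (invPow i (u N x) * invPow k (y N x)))
    (hv : ∀ i k, 1 ≤ i → 1 ≤ k →
      (∀ N, Summable fun x => w N x * (invPow i (v N x) * invPow k (y N x))) ∧
      IsHarmonic fun N => ∑' x, w N x * (invPow i (v N x) * invPow k (y N x))) :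
    IsHarmonic fun N => ∑' x, w N x * (invPow b (u N x) * invPow c (v N x)) := by
  obtain ⟨α, β, hex⟩ := exists_invPow_mul_eq_of_add hb hc
  exact tsum_of_expansion hb hc ⟨α, β, fun N hN x =>
    hex _ _ _ (h N hN x).1 (h N hN x).2.1 (h N hN x).2.2⟩ hu hv

theorem summable_invPow_mul {f : ℕ → ℂ} (hf : IsHarmonic f) {p j : ℕ} (hp : 1 ≤ p) (hj : 1 ≤ j)
    (N : ℕ) : Summable fun m : ℕ => invPow p (m + 1) * f (m + 1) * invPow j (m + 1 + N) := by
  obtain ⟨p, rfl⟩ := Nat.exists_eq_add_of_le' hp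
  refine (summable_div_mul_inv_pow (hf.invPow_mul p) N hj).congr fun m => ?_
  simp only [invPow]
  push_cast
  ring

theorem tsum_invPow_mul {f : ℕ → ℂ} (hf : IsHarmonic f) {p j : ℕ} (hp : 1 ≤ p) (hj : 1 ≤ j) :
    IsHarmonic fun N => ∑' m : ℕ, invPow p (m + 1) * f (m + 1) * invPow j (m + 1 + N) := by
  obtain ⟨p, rfl⟩ := Nat.exists_eq_add_of_le' hp
  refine (harmonic_tailDiv (hf.invPow_mul p) hj).congr fun N _ => tsum_congr fun m => ?_
  simp only [invPow]
  push_cast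
  ring

theorem sum_Ico_eq_conv (f g : ℕ → ℂ) {q : ℕ} (N : ℕ) :
    ∑ m ∈ Finset.Ico 1 N, f (N - m) * (invPow (q + 1) m * g m) =
      conv f (fun n => invPow q n * g n) N := by
  rcases N with - | N
  · simp [conv]
  rw [conv, Finset.range_eq_Ico, Finset.sum_eq_sum_Ico_succ_bot (show 0 < N + 1 by omega)]
  simp only [Nat.cast_zero, div_zero, mul_zero, zero_add]
  refine Finset.sum_congr rfl fun m _ => ?_
  simp only [invPow]
  ring

theorem sum_Ico_mul {f g : ℕ → ℂ} (hf : IsHarmonic f) (hg : IsHarmonic g) {q : ℕ} (hq : 1 ≤ q) :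
    IsHarmonic fun N => ∑ m ∈ Finset.Ico 1 N, f (N - m) * (invPow q m * g m) := by
  obtain ⟨q, rfl⟩ := Nat.exists_eq_add_of_le' hq
  exact (harmonic_conv hf (hg.invPow_mul q)).congr fun N _ => (sum_Ico_eq_conv f g N).symm

theorem sum_Ico {g : ℕ → ℂ} (hg : IsHarmonic g) {q : ℕ} (hq : 1 ≤ q) :
    IsHarmonic fun N => ∑ m ∈ Finset.Ico 1 N, invPow q m * g m :=
  (sum_Ico_mul one hg hq).congr fun N _ => by simp

/-- The extra factor `N` is absorbed by `conv_div`. It allows a missing power of `l + m` to be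
written as a product with `1 / (l + m)` when double tails are summed along `l + m`. -/
theorem mul_sum_Ico {p q : ℕ} (hp : 1 ≤ p) (hq : 1 ≤ q) :
    IsHarmonic fun N => N * ∑ m ∈ Finset.Ico 1 N, invPow p (N - m) * invPow q m := by
  obtain ⟨p, rfl⟩ := Nat.exists_eq_add_of_le' hp
  obtain ⟨q, rfl⟩ := Nat.exists_eq_add_of_le' hq
  have hP : IsHarmonic (invPow p) := inv_pow p
  have hQ : IsHarmonic (invPow q) := inv_pow q
  refine ((harmonic_conv hP hQ).add (harmonic_conv hQ hP)).congr fun N hN => ?_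
  have h := conv_div (invPow p) (invPow q) hN
  have h1 := sum_Ico_eq_conv (fun n => invPow p n / n) (fun _ => 1) (q := q) N
  simp only [mul_one] at h1
  rw [show (fun n => invPow q n) = invPow q from rfl, h] at h1
  have hN' : (N : ℂ) ≠ 0 := by exact_mod_cast hN
  rw [eq_div_iff hN', mul_comm] at h1
  rw [← h1]
  congr 1

/-- The double tails of Tornheim type are harmonic. -/
theorem tsum_invPow_add {p q j : ℕ} (a : ℕ) (hp : 1 ≤ p) (hq : 1 ≤ q) (hj : 1 ≤ j)
    (hs : ∀ N, Summable fun x : ℕ × ℕ => invPow q (x.1 + 1) * invPow p (x.2 + 1) *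
      invPow a (x.1 + 1 + (x.2 + 1)) * invPow j (x.1 + 1 + (x.2 + 1) + N)) :
    IsHarmonic fun N => ∑' x : ℕ × ℕ, invPow q (x.1 + 1) * invPow p (x.2 + 1) *
      invPow a (x.1 + 1 + (x.2 + 1)) * invPow j (x.1 + 1 + (x.2 + 1) + N) := by
  have hf := mul_sum_Ico hp hq
  refine (hf.tsum_invPow_mul (show 1 ≤ a + 1 by omega) hj).congr fun N _ => ?_
  rw [(hf.summable_invPow_mul (show 1 ≤ a + 1 by omega) hj N).tsum_eq_zero_add]
  simp only [zero_add, Finset.Ico_self, Finset.sum_empty, mul_zero, zero_mul]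
  -- Grouping the double sum by the value of `l + m` leaves a finite convolution inside a single
  -- tail.
  rw [← Finset.HasAntidiagonal.sigmaAntidiagonalEquivProd.tsum_eq]
  have hs' := (Finset.HasAntidiagonal.sigmaAntidiagonalEquivProd.summable_iff).mpr (hs N)
  refine Eq.trans ?_ hs'.tsum_sigma.symm
  refine tsum_congr fun k => ?_
  simp only [Function.comp_apply]
  rw [tsum_fintype]
  refine Eq.trans ?_ (Finset.sum_coe_sort (Finset.HasAntidiagonal.antidiagonal k) (fun x : ℕ × ℕ =>
    invPow q (x.1 + 1) * invPow p (x.2 + 1) *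
      invPow a (x.1 + 1 + (x.2 + 1)) * invPow j (x.1 + 1 + (x.2 + 1) + N))).symm
  rw [Finset.Nat.sum_antidiagonal_eq_sum_range_succ_mk, Finset.sum_Ico_eq_sum_range,
    Finset.mul_sum, Finset.mul_sum, Finset.sum_mul]
  refine Finset.sum_congr rfl fun m hm => ?_
  have hm := Finset.mem_range.mp hm
  have e1 : k + 1 + 1 - (m + 1) = k - m + 1 := by omega
  have e2 : m + 1 + (k - m + 1) = k + 1 + 1 := by omega
  have hK : ((k + 1 + 1 : ℕ) : ℂ) ≠ 0 := by
    exact_mod_cast Nat.succ_ne_zero (k + 1)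
  simp only [add_comm 1 m, e1, e2]
  have e3 : invPow (a + 1) (k + 1 + 1) * ((k + 1 + 1 : ℕ) : ℂ) = invPow a (k + 1 + 1) := by
    rw [invPow, invPow, pow_succ, mul_assoc, inv_mul_cancel₀ hK, mul_one]
  rw [← e3]
  ring

end IsHarmonic

namespace IsHarmonic

theorem norm_five_le {x₁ x₂ x₃ x₄ x₅ : ℂ} {A B : ℝ} (h₁ : ‖x₁‖ ≤ A ^ 1) (h₂ : ‖x₂‖ ≤ B ^ 1)
    (h₃ : ‖x₃‖ ≤ 1) (h₄ : ‖x₄‖ ≤ B ^ 1) (h₅ : ‖x₅‖ ≤ A ^ 1) :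
    ‖x₁ * x₂ * x₃ * (x₄ * x₅)‖ ≤ B ^ 2 * A ^ 2 :=
  (norm_mul_le_of_le (norm_mul_le_of_le (norm_mul_le_of_le h₁ h₂) h₃)
    (norm_mul_le_of_le h₄ h₅)).trans_eq (by ring)

/-- The coefficients of `ζ₃(· ; A₃)` as a Dirichlet series in the exponent of `n`. -/
theorem coeff_simple {p q a b c : ℕ} (hp : 1 ≤ p) (hq : 1 ≤ q) (ha : 1 ≤ a) (hb : 1 ≤ b)
    (hc : 1 ≤ c) : IsHarmonic fun N => ∑' x : ℕ × ℕ, invPow p (x.2 + 1) * invPow q (x.1 + 1) *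
      invPow a (x.1 + 1 + (x.2 + 1)) *
      (invPow b (x.1 + 1 + N) * invPow c (x.1 + 1 + (x.2 + 1) + N)) := by
  -- With `l = x.2 + 1` and `m = x.1 + 1`, the two forms involving `N` differ by `l`. What remains
  -- is an iterated tail when `m + N` survives and a double tail when `l + m + N` does.
  refine tsum_of_sub (κ := fun _ => ℕ × ℕ) (y := fun _ x => x.2 + 1) hb hc
    (fun N _ x => ⟨by omega, by omega, by omega⟩) (fun i k hi hk => ?_) (fun i k hi hk => ?_)
  · have hs : ∀ N, Summable fun x : ℕ × ℕ => invPow p (x.2 + 1) * invPow q (x.1 + 1) *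
        invPow a (x.1 + 1 + (x.2 + 1)) * (invPow i (x.1 + 1 + N) * invPow k (x.2 + 1)) :=
      fun N => summable_of_norm_le_inv_sq_mul fun x => norm_five_le
        (norm_invPow_le hp le_rfl) (norm_invPow_le hq le_rfl) (norm_invPow_le_one _ _)
        (norm_invPow_le hi (by omega)) (norm_invPow_le hk le_rfl)
    refine ⟨hs, ?_⟩
    refine ((one.tsum_invPow_mul (show 1 ≤ p + k by omega) ha).tsum_invPow_mul hq hi).congr
      fun N _ => ?_
    rw [(hs N).tsum_prod]
    refine tsum_congr fun m => ?_
    rw [← tsum_mul_left, ← tsum_mul_right]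
    refine tsum_congr fun l => ?_
    rw [invPow_add, add_comm (l + 1)]
    ring
  · have hs : ∀ N, Summable fun x : ℕ × ℕ => invPow p (x.2 + 1) * invPow q (x.1 + 1) *
        invPow a (x.1 + 1 + (x.2 + 1)) *
        (invPow i (x.1 + 1 + (x.2 + 1) + N) * invPow k (x.2 + 1)) :=
      fun N => summable_of_norm_le_inv_sq_mul fun x => norm_five_le
        (norm_invPow_le hp le_rfl) (norm_invPow_le hq le_rfl) (norm_invPow_le_one _ _)
        (norm_invPow_le hi (by omega)) (norm_invPow_le hk le_rfl)
    have e : ∀ N (x : ℕ × ℕ), invPow p (x.2 + 1) * invPow q (x.1 + 1) *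
        invPow a (x.1 + 1 + (x.2 + 1)) *
        (invPow i (x.1 + 1 + (x.2 + 1) + N) * invPow k (x.2 + 1)) =
        invPow q (x.1 + 1) * invPow (p + k) (x.2 + 1) * invPow a (x.1 + 1 + (x.2 + 1)) *
          invPow i (x.1 + 1 + (x.2 + 1) + N) := fun N x => by
      rw [invPow_add]
      ring
    refine ⟨hs, ?_⟩
    simp only [e] at hs ⊢
    exact tsum_invPow_add a (by omega) hq hi hs

theorem tsum_mul_tsum_prod {f g : ℕ → ℂ} (hf : Summable f) (hg : Summable g) :
    (∑' m, f m) * ∑' n, g n = ∑' x : ℕ × ℕ, f x.1 * g x.2 :=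
  tsum_mul_tsum_of_summable_norm hf.norm hg.norm

/-- The product of two simple tails. -/
theorem tsum_mul_tails {p q i j : ℕ} (hp : 1 ≤ p) (hq : 1 ≤ q) (hi : 1 ≤ i) (hj : 1 ≤ j) :
    IsHarmonic fun N => ∑' x : ℕ × ℕ, (invPow p (x.1 + 1) * invPow i (x.1 + 1 + N)) *
      (invPow q (x.2 + 1) * invPow j (x.2 + 1 + N)) := by
  refine ((one.tsum_invPow_mul hp hi).mul (one.tsum_invPow_mul hq hj)).congr fun N _ => ?_
  rw [tsum_mul_tsum_prod (one.summable_invPow_mul hp hi N) (one.summable_invPow_mul hq hj N)]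
  exact tsum_congr fun x => by ring

/-- The forms `l + N` and `l + N + n` differ by `n`. One part is a tail times a constant, the other
a double tail. The condition `2 ≤ p` secures absolute convergence without help from the factors
containing `N`; it holds where this is used, because a power of `l` has been gained. -/
theorem coeff_middle_aux {p q a c : ℕ} (hp : 2 ≤ p) (hq : 1 ≤ q) (ha : 1 ≤ a) (hc : 1 ≤ c) :
    (∀ N, Summable fun x : ℕ × ℕ => invPow p (x.1 + 1) * invPow q (x.2 + 1) *
      (invPow a (x.1 + 1 + N) * invPow c (x.1 + 1 + N + (x.2 + 1)))) ∧
    IsHarmonic fun N => ∑' x : ℕ × ℕ, invPow p (x.1 + 1) * invPow q (x.2 + 1) *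
      (invPow a (x.1 + 1 + N) * invPow c (x.1 + 1 + N + (x.2 + 1))) := by
  refine ⟨fun N => summable_of_norm_le_inv_sq_mul fun x => ?_, ?_⟩
  · exact (norm_mul_le_of_le (norm_mul_le_of_le (norm_invPow_le hp le_rfl)
      (norm_invPow_le hq le_rfl)) (norm_mul_le_of_le (norm_invPow_le_one _ _)
      (norm_invPow_le hc (show x.2 + 1 ≤ _ by omega)))).trans_eq (by ring)
  refine tsum_of_sub (κ := fun _ => ℕ × ℕ) (y := fun _ x => x.2 + 1) ha hc
    (fun N _ x => ⟨by omega, by omega, by omega⟩) (fun i k hi hk => ⟨fun N => ?_, ?_⟩)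
    (fun i k hi hk => ?_)
  · refine summable_of_norm_le_inv_sq_mul fun x => ?_
    exact (norm_mul_le_of_le (norm_mul_le_of_le (norm_invPow_le hp le_rfl)
      (norm_invPow_le hq le_rfl)) (norm_mul_le_of_le (norm_invPow_le_one _ _)
      (norm_invPow_le hk le_rfl))).trans_eq (by ring)
  · have h1 := one.tsum_invPow_mul (show 1 ≤ p by omega) hi
    have h2 : IsHarmonic fun _ => ∑' m : ℕ, invPow (q + k) (m + 1) := const _
    have s2 : Summable fun m : ℕ => invPow (q + k) (m + 1) :=
      Summable.of_norm_bounded summable_inv_sq fun m => norm_invPow_le (by omega) le_rfl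
    refine (h1.mul h2).congr fun N _ => ?_
    rw [tsum_mul_tsum_prod (one.summable_invPow_mul (by omega) hi N) s2]
    refine tsum_congr fun x => ?_
    rw [invPow_add]
    ring
  · have e : ∀ N (x : ℕ × ℕ), invPow p (x.1 + 1) * invPow q (x.2 + 1) *
        (invPow i (x.1 + 1 + N + (x.2 + 1)) * invPow k (x.2 + 1)) =
        invPow p (x.1 + 1) * invPow (q + k) (x.2 + 1) * invPow 0 (x.1 + 1 + (x.2 + 1)) *
          invPow i (x.1 + 1 + (x.2 + 1) + N) := fun N x => by
      rw [invPow_add, add_right_comm (x.1 + 1) N]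
      simp [invPow]
      ring
    have hs : ∀ N, Summable fun x : ℕ × ℕ => invPow p (x.1 + 1) * invPow (q + k) (x.2 + 1) *
        invPow 0 (x.1 + 1 + (x.2 + 1)) * invPow i (x.1 + 1 + (x.2 + 1) + N) := fun N =>
      summable_of_norm_le_inv_sq_mul fun x => (norm_mul_le_of_le (norm_mul_le_of_le
        (norm_mul_le_of_le (norm_invPow_le hp le_rfl)
        (norm_invPow_le (show 2 ≤ q + k by omega) le_rfl)) (norm_invPow_le_one _ _))
        (norm_invPow_le_one _ _)).trans_eq (by ring)
    simp only [e]
    exact ⟨hs, tsum_invPow_add 0 (by omega) (by omega) hi hs⟩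

/-- The coefficients of `ζ₃(· ; A₃)` as a Dirichlet series in the exponent of `m`. -/
theorem coeff_middle {p q a b c : ℕ} (hp : 1 ≤ p) (hq : 1 ≤ q) (ha : 1 ≤ a) (hb : 1 ≤ b)
    (hc : 1 ≤ c) : IsHarmonic fun N => ∑' x : ℕ × ℕ, invPow p (x.1 + 1) * invPow q (x.2 + 1) *
      invPow a (x.1 + 1 + N) *
      (invPow b (x.2 + 1 + N) * invPow c (x.1 + 1 + N + (x.2 + 1))) := by
  -- Here `(l + N + n) - (n + N) = l`. Keeping `n + N` decouples `l` from `n` into a product of two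
  -- tails; keeping the full sum leads to `coeff_middle_aux`.
  refine tsum_of_sub (κ := fun _ => ℕ × ℕ) (y := fun _ x => x.1 + 1) hb hc
    (fun N _ x => ⟨by omega, by omega, by omega⟩) (fun i k hi hk => ⟨fun N => ?_, ?_⟩)
    (fun i k hi hk => ?_)
  · refine summable_of_norm_le_inv_sq_mul fun x => ?_
    exact (norm_mul_le_of_le (norm_mul_le_of_le (norm_mul_le_of_le (norm_invPow_le hp le_rfl)
      (norm_invPow_le hq le_rfl)) (norm_invPow_le_one _ _)) (norm_mul_le_of_le
      (norm_invPow_le hi (show x.2 + 1 ≤ _ by omega))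
      (norm_invPow_le hk le_rfl))).trans_eq (by ring)
  · refine (tsum_mul_tails (show 1 ≤ p + k by omega) hq ha hi).congr fun N _ =>
      tsum_congr fun x => ?_
    rw [invPow_add]
    ring
  · have e : ∀ N (x : ℕ × ℕ), invPow p (x.1 + 1) * invPow q (x.2 + 1) * invPow a (x.1 + 1 + N) *
        (invPow i (x.1 + 1 + N + (x.2 + 1)) * invPow k (x.1 + 1)) =
        invPow (p + k) (x.1 + 1) * invPow q (x.2 + 1) *
          (invPow a (x.1 + 1 + N) * invPow i (x.1 + 1 + N + (x.2 + 1))) := fun N x => by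
      rw [invPow_add]
      ring
    simp only [e]
    exact coeff_middle_aux (by omega) hq ha hi

theorem summable_Ico_prod {N : ℕ} {g : ↥(Finset.Ico 1 N) × ℕ → ℂ}
    (h : ∀ x, ‖g x‖ ≤ ((x.2 + 1 : ℕ) : ℝ)⁻¹ ^ 2) : Summable g := by
  have h1 : Summable fun _ : ↥(Finset.Ico 1 N) => (1 : ℝ) := (hasSum_fintype _).summable
  refine Summable.of_norm_bounded (h1.mul_of_nonneg summable_inv_sq (fun _ => zero_le_one)
    (fun _ => by positivity)) fun x => ?_
  rw [one_mul]
  exact h x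

theorem tsum_Ico_prod {N : ℕ} {g : ℕ → ℕ → ℂ}
    (h : Summable fun x : ↥(Finset.Ico 1 N) × ℕ => g x.1 x.2) :
    ∑' x : ↥(Finset.Ico 1 N) × ℕ, g x.1 x.2 = ∑ m ∈ Finset.Ico 1 N, ∑' n, g m n := by
  rw [h.tsum_prod, tsum_fintype]
  exact Finset.sum_coe_sort (Finset.Ico 1 N) fun m => ∑' n, g m n

/-- The coefficients of `ζ₃(· ; A₃)` as a Dirichlet series in the exponent of `l + m`. -/
theorem coeff_add {p q r b c : ℕ} (hq : 1 ≤ q) (hr : 1 ≤ r) (hb : 1 ≤ b)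
    (hc : 1 ≤ c) : IsHarmonic fun N => ∑' x : ↥(Finset.Ico 1 N) × ℕ,
      invPow p (N - x.1.1) * invPow q x.1.1 * invPow r (x.2 + 1) *
      (invPow b (x.1.1 + (x.2 + 1)) * invPow c (N + (x.2 + 1))) := by
  -- With `l + m = N`, the forms `N + n` and `m + n` differ by `l = N - m`. The results are a
  -- convolution containing a tail in `m`, and a convolution times a tail in `N`.
  refine tsum_of_sub (κ := fun N => ↥(Finset.Ico 1 N) × ℕ) (y := fun N x => N - x.1.1) hb hc
    (fun N _ x => ?_) (fun i k hi hk => ?_) (fun i k hi hk => ?_)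
  · have := Finset.mem_Ico.mp x.1.2
    exact ⟨by omega, by omega, by omega⟩
  · have hs : ∀ N, Summable fun x : ↥(Finset.Ico 1 N) × ℕ =>
        invPow p (N - x.1.1) * invPow q x.1.1 * invPow r (x.2 + 1) *
          (invPow i (x.1.1 + (x.2 + 1)) * invPow k (N - x.1.1)) := fun N =>
      summable_Ico_prod fun x => (norm_mul_le_of_le (norm_mul_le_of_le (norm_mul_le_of_le
        (norm_invPow_le_one _ _) (norm_invPow_le_one _ _)) (norm_invPow_le hr le_rfl))
        (norm_mul_le_of_le (norm_invPow_le hi (show x.2 + 1 ≤ _ by omega))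
        (norm_invPow_le_one _ _))).trans_eq (by ring)
    refine ⟨hs, ?_⟩
    refine (sum_Ico_mul (inv_pow (p + k)) (one.tsum_invPow_mul hr hi) hq).congr fun N _ => ?_
    refine Eq.trans (Finset.sum_congr rfl fun m _ => ?_) (tsum_Ico_prod (g := fun m n => invPow p (N - m) * invPow q m * invPow r (n + 1) *
      (invPow i (m + (n + 1)) * invPow k (N - m))) (hs N)).symm
    rw [← tsum_mul_left, ← tsum_mul_left]
    refine tsum_congr fun n => ?_
    rw [add_comm (n + 1)]
    simp only [invPow]
    ring
  · have hs : ∀ N, Summable fun x : ↥(Finset.Ico 1 N) × ℕ =>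
        invPow p (N - x.1.1) * invPow q x.1.1 * invPow r (x.2 + 1) *
          (invPow i (N + (x.2 + 1)) * invPow k (N - x.1.1)) := fun N =>
      summable_Ico_prod fun x => (norm_mul_le_of_le (norm_mul_le_of_le (norm_mul_le_of_le
        (norm_invPow_le_one _ _) (norm_invPow_le_one _ _)) (norm_invPow_le hr le_rfl))
        (norm_mul_le_of_le (norm_invPow_le hi (show x.2 + 1 ≤ _ by omega))
        (norm_invPow_le_one _ _))).trans_eq (by ring)
    refine ⟨hs, ?_⟩
    refine ((sum_Ico_mul (inv_pow (p + k)) one hq).mul (one.tsum_invPow_mul hr hi)).congr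
      fun N _ => ?_
    refine Eq.trans ?_ (tsum_Ico_prod (g := fun m n => invPow p (N - m) * invPow q m * invPow r (n + 1) *
      (invPow i (N + (n + 1)) * invPow k (N - m))) (hs N)).symm
    rw [Finset.sum_mul]
    refine Finset.sum_congr rfl fun m _ => ?_
    rw [← tsum_mul_left]
    refine tsum_congr fun n => ?_
    rw [add_comm (n + 1)]
    simp only [invPow]
    ring

/-- The pairs `(l, n)` of positive integers with `l + n < N`. -/
abbrev pairsBelow (N : ℕ) : Finset (Σ _ : ℕ, ℕ) :=
  (Finset.Ico 1 N).sigma fun l => Finset.Ico 1 (N - l)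

theorem mem_pairsBelow {N : ℕ} {x : Σ _ : ℕ, ℕ} (h : x ∈ pairsBelow N) :
    1 ≤ x.1 ∧ 1 ≤ x.2 ∧ x.1 + x.2 < N := by
  simp only [pairsBelow, Finset.mem_sigma, Finset.mem_Ico] at h
  omega

theorem tsum_pairsBelow {N : ℕ} (g : ℕ → ℕ → ℂ) : ∑' x : ↥(pairsBelow N), g x.1.1 x.1.2 =
    ∑ l ∈ Finset.Ico 1 N, ∑ n ∈ Finset.Ico 1 (N - l), g l n := by
  rw [tsum_fintype, Finset.sum_coe_sort (pairsBelow N) (fun x => g x.1 x.2), Finset.sum_sigma]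

theorem sum_pairsBelow_comm {N : ℕ} (g : ℕ → ℕ → ℂ) :
    ∑ l ∈ Finset.Ico 1 N, ∑ n ∈ Finset.Ico 1 (N - l), g l n =
      ∑ n ∈ Finset.Ico 1 N, ∑ l ∈ Finset.Ico 1 (N - n), g l n := by
  refine Finset.sum_comm' fun l n => ?_
  simp only [Finset.mem_Ico]
  omega

theorem sum_Ico_sub (f : ℕ → ℂ) (N : ℕ) :
    ∑ l ∈ Finset.Ico 1 N, f (N - l) = ∑ v ∈ Finset.Ico 1 N, f v := by
  refine Finset.sum_nbij' (fun l => N - l) (fun l => N - l) (fun l hl => ?_) (fun l hl => ?_)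
    (fun l hl => ?_) (fun l hl => ?_) (fun _ _ => rfl) <;>
  · simp only [Finset.mem_Ico] at hl ⊢
    omega

/-- With `v = N - l` and `u = N - n` the range is `u + v > N`. It is the full square minus the part
`u ≤ l`, a product of harmonic sums minus a convolution. -/
theorem coeff_total_aux₁ {x y : ℕ} (hx : 1 ≤ x) (hy : 1 ≤ y) : IsHarmonic fun N =>
    ∑ l ∈ Finset.Ico 1 N, ∑ n ∈ Finset.Ico 1 (N - l), invPow x (N - l) * invPow y (N - n) := by
  have hS : ∀ {x : ℕ}, 1 ≤ x → IsHarmonic fun N => ∑ m ∈ Finset.Ico 1 N, invPow x m := fun hx =>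
    (one.sum_Ico hx).congr fun N _ => by simp
  refine (((hS hx).mul (hS hy)).sub (sum_Ico_mul ((hS hy).add (inv_pow y)) one hx)).congr
    fun N _ => ?_
  rw [Finset.sum_mul, ← Finset.sum_sub_distrib, ← sum_Ico_sub]
  refine Finset.sum_congr rfl fun l hl => ?_
  have hl := Finset.mem_Ico.mp hl
  rw [← Finset.mul_sum, show N - (N - l) = l by omega]
  have h1 : ∑ n ∈ Finset.Ico 1 (N - l), invPow y (N - n) = ∑ u ∈ Finset.Ico (l + 1) N, invPow y u := by
    refine Finset.sum_nbij' (fun l => N - l) (fun l => N - l) (fun l hl => ?_) (fun l hl => ?_)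
      (fun l hl => ?_) (fun l hl => ?_) (fun _ _ => rfl) <;>
    · simp only [Finset.mem_Ico] at hl ⊢
      omega
  have h2 := Finset.sum_Ico_consecutive (invPow y) (show 1 ≤ l + 1 by omega) (show l + 1 ≤ N by omega)
  rw [Finset.sum_Ico_succ_top hl.1] at h2
  rw [h1, ← h2]
  simp only [invPow]
  ring

theorem coeff_total_aux₂ {r x i : ℕ} (hr : 1 ≤ r) (hx : 1 ≤ x) (hi : 1 ≤ i) : IsHarmonic fun N =>
    ∑' z : ↥(pairsBelow N), invPow x (N - z.1.1) * (invPow r z.1.2 * invPow i (N - z.1.2)) := by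
  -- Since `n + (N - n) = N`, the third form is constant on the range of summation and comes out as
  -- a power of `1 / N`.
  refine tsum_of_add (κ := fun N => ↥(pairsBelow N)) (y := fun N _ => N) hr hi (fun N _ z => ?_)
    (fun j k hj hk => ⟨fun N => (hasSum_fintype _).summable, ?_⟩)
    (fun j k hj hk => ⟨fun N => (hasSum_fintype _).summable, ?_⟩)
  · have := mem_pairsBelow z.2
    exact ⟨by omega, by omega, by omega⟩
  · refine ((((one.sum_Ico hj)).sum_Ico hx).invPow_mul k).congr fun N _ => ?_
    refine Eq.trans ?_ (tsum_pairsBelow fun l n =>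
      invPow x (N - l) * (invPow j n * invPow k N)).symm
    rw [← sum_Ico_sub, Finset.mul_sum]
    refine Finset.sum_congr rfl fun l _ => ?_
    rw [Finset.mul_sum, Finset.mul_sum]
    exact Finset.sum_congr rfl fun n _ => by ring
  · refine ((coeff_total_aux₁ hx hj).invPow_mul k).congr fun N _ => ?_
    refine Eq.trans ?_ (tsum_pairsBelow fun l n =>
      invPow x (N - l) * (invPow j (N - n) * invPow k N)).symm
    rw [Finset.mul_sum]
    refine Finset.sum_congr rfl fun l _ => ?_
    rw [Finset.mul_sum]
    exact Finset.sum_congr rfl fun n _ => by ring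

theorem coeff_total_aux₃ {p r b i : ℕ} (hp : 1 ≤ p) (hr : 1 ≤ r) (hb : 1 ≤ b) (hi : 1 ≤ i) :
    IsHarmonic fun N => ∑' z : ↥(pairsBelow N), invPow r z.1.2 * invPow i (N - z.1.2) *
      (invPow p z.1.1 * invPow b (N - z.1.1)) := by
  refine tsum_of_add (κ := fun N => ↥(pairsBelow N)) (y := fun N _ => N) hp hb (fun N _ z => ?_)
    (fun j k hj hk => ⟨fun N => (hasSum_fintype _).summable, ?_⟩)
    (fun j k hj hk => ⟨fun N => (hasSum_fintype _).summable, ?_⟩)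
  · have := mem_pairsBelow z.2
    exact ⟨by omega, by omega, by omega⟩
  · refine ((sum_Ico_mul ((one.sum_Ico hj).invPow_mul i) one hr).invPow_mul k).congr fun N _ => ?_
    refine Eq.trans ?_ (tsum_pairsBelow fun l n =>
      invPow r n * invPow i (N - n) * (invPow j l * invPow k N)).symm
    rw [sum_pairsBelow_comm, Finset.mul_sum]
    refine Finset.sum_congr rfl fun n _ => ?_
    rw [Finset.mul_sum, Finset.sum_mul, Finset.mul_sum]
    exact Finset.sum_congr rfl fun l _ => by ring
  · refine ((coeff_total_aux₂ hr hj hi).invPow_mul k).congr fun N _ => ?_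
    rw [← tsum_mul_left]
    exact tsum_congr fun z => by ring

/-- The coefficients of `ζ₃(· ; A₃)` as a Dirichlet series in the exponent of `l + m + n`. -/
theorem coeff_total {p q r a b : ℕ} (hp : 1 ≤ p) (hq : 1 ≤ q) (hr : 1 ≤ r) (ha : 1 ≤ a)
    (hb : 1 ≤ b) : IsHarmonic fun N => ∑' z : ↥(pairsBelow N),
      invPow p z.1.1 * invPow r z.1.2 * invPow b (N - z.1.1) *
      (invPow q (N - z.1.1 - z.1.2) * invPow a (N - z.1.2)) := by
  -- With `m = N - l - n`, the form `l + m = N - n` exceeds `m` by `l`. Keeping `m` gives nested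
  -- convolutions; keeping `N - n` leaves `l, N - l, n, N - n`, which are split further using the
  -- constant sum `N`.
  refine tsum_of_sub (κ := fun N => ↥(pairsBelow N)) (y := fun N z => z.1.1) hq ha (fun N _ z => ?_)
    (fun j k hj hk => ⟨fun N => (hasSum_fintype _).summable, ?_⟩)
    (fun j k hj hk => ⟨fun N => (hasSum_fintype _).summable, ?_⟩)
  · have := mem_pairsBelow z.2
    exact ⟨by omega, by omega, by omega⟩
  · refine (sum_Ico_mul ((sum_Ico_mul (inv_pow j) one hr).invPow_mul b) one
      (show 1 ≤ p + k by omega)).congr fun N _ => ?_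
    refine Eq.trans ?_ (tsum_pairsBelow fun l n => invPow p l * invPow r n * invPow b (N - l) *
      (invPow j (N - l - n) * invPow k l)).symm
    refine Finset.sum_congr rfl fun l _ => ?_
    rw [invPow_add, Finset.mul_sum, Finset.sum_mul]
    refine Finset.sum_congr rfl fun n _ => ?_
    simp only [invPow]
    ring
  · refine (coeff_total_aux₃ (show 1 ≤ p + k by omega) hr hb hj).congr fun N _ => ?_
    refine tsum_congr fun z => ?_
    rw [invPow_add]
    ring

end IsHarmonic


/-! ### Continuation of the twelve functions on the left-hand side. -/

theorem hasSum_LSeries_fiber {ι : Type} {form : ι → ℕ} (hform : ∀ i, form i ≠ 0) {w : ι → ℂ}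
    {s : ℂ} (hs : Summable fun i => w i * (form i : ℂ) ^ (-s)) :
    HasSum (fun i => w i * (form i : ℂ) ^ (-s))
      (LSeries (fun N => ∑' x : {i // form i = N}, w x) s) := by
  have h : LSeries (fun N => ∑' x : {i // form i = N}, w x) s =
      ∑' i, w i * (form i : ℂ) ^ (-s) := by
    rw [← (Equiv.sigmaFiberEquiv form).tsum_eq]
    have hs' := ((Equiv.sigmaFiberEquiv form).summable_iff).mpr hs
    refine Eq.trans ?_ hs'.tsum_sigma.symm
    refine tsum_congr fun N => ?_
    rcases eq_or_ne N 0 with rfl | hN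
    · have : IsEmpty {i // form i = 0} := ⟨fun x => hform x.1 x.2⟩
      simp
    · rw [LSeries.term_of_ne_zero hN, div_eq_mul_inv, ← Complex.cpow_neg, ← tsum_mul_right]
      refine tsum_congr fun x => ?_
      simp [Equiv.sigmaFiberEquiv, x.2]
  rw [h]
  exact hs.hasSum

/-- Grouping the terms by the value of the linear form that carries `s` yields an ordinary Dirichlet
series with harmonic coefficients. -/
theorem exists_isMeromorphicContinuation_of_isHarmonic {ι : Type} {form : ι → ℕ}
    (hform : ∀ i, form i ≠ 0) {w : ι → ℂ}
    (hs : ∀ s : ℂ, 3 < s.re → Summable fun i => w i * (form i : ℂ) ^ (-s))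
    (hA : IsHarmonic fun N => ∑' x : {i // form i = N}, w x) :
    ∃ F, IsMeromorphicContinuation (fun i s => w i * (form i : ℂ) ^ (-s)) F := by
  obtain ⟨G, hG, hGA⟩ := hA.exists_meromorphicOn_univ
  refine ⟨_, exists_isMeromorphicContinuation hG 3 (fun s hs => ?_) fun s hs' => ?_⟩
  · refine (analyticAt_LSeries_of_sqrt hA.exists_bound (by linarith)).congr ?_
    filter_upwards [(isOpen_lt continuous_const Complex.continuous_re).mem_nhds hs] with z hz
    exact (hGA z hz).symm
  · rw [hGA s hs']
    exact hasSum_LSeries_fiber hform (hs s hs')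

theorem tsum_fiber {ι κ : Type} {form : ι → ℕ} {N : ℕ} (w : ι → ℂ) (g : κ → ι)
    (hg : Function.Injective g) (h : ∀ k, form (g k) = N) (h' : ∀ i, form i = N → ∃ k, g k = i) :
    ∑' k, w (g k) = ∑' x : {i // form i = N}, w x := by
  have hb : Function.Bijective fun k => (⟨g k, h k⟩ : {i // form i = N}) := by
    refine ⟨fun x y hxy => hg (congrArg Subtype.val hxy), fun x => ?_⟩
    obtain ⟨k, hk⟩ := h' x.1 x.2
    exact ⟨k, Subtype.ext hk⟩
  exact (Equiv.ofBijective _ hb).tsum_eq fun x => w x.1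

theorem summable_pnat_inv_sq : Summable fun n : ℕ+ => ((n : ℕ) : ℝ)⁻¹ ^ 2 := by
  have := (Real.summable_nat_pow_inv (p := 2)).mpr one_lt_two
  simp only [← inv_pow] at this
  exact this.comp_injective PNat.coe_injective

theorem summable_of_norm_le_inv_sq_mul_mul {g : ℕ+ × ℕ+ × ℕ+ → ℂ}
    (h : ∀ l m n : ℕ+, ‖g (l, m, n)‖ ≤ ((l : ℕ) : ℝ)⁻¹ ^ 2 * (((m : ℕ) : ℝ)⁻¹ ^ 2 *
      ((n : ℕ) : ℝ)⁻¹ ^ 2)) : Summable g :=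
  Summable.of_norm_bounded (summable_pnat_inv_sq.mul_of_nonneg
    (summable_pnat_inv_sq.mul_of_nonneg summable_pnat_inv_sq (fun _ => by positivity)
      (fun _ => by positivity)) (fun _ => by positivity)
    (fun _ => mul_nonneg (by positivity) (by positivity))) fun x => h x.1 x.2.1 x.2.2

theorem norm_invPow_le_of_le {k j y x : ℕ} (hjk : j ≤ k) (hy : 1 ≤ y) (hyx : y ≤ x) :
    ‖invPow k x‖ ≤ (y : ℝ)⁻¹ ^ j := by
  obtain ⟨y, rfl⟩ := Nat.exists_eq_add_of_le' hy
  exact norm_invPow_le hjk hyx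

theorem norm_natCast_cpow_neg_le {k x : ℕ} {s : ℂ} (hs : k ≤ s.re) (hx : 1 ≤ x) :
    ‖(x : ℂ) ^ (-s)‖ ≤ (x : ℝ)⁻¹ ^ k := by
  rw [Complex.norm_natCast_cpow_of_pos hx, inv_pow, ← Real.rpow_natCast,
    ← Real.rpow_neg (by positivity)]
  exact Real.rpow_le_rpow_of_exponent_le (by exact_mod_cast hx) (by simpa using hs)

theorem exists_continuation_simple {p q a b c : ℕ} (hp : 1 ≤ p) (hq : 1 ≤ q) (ha : 1 ≤ a)
    (hb : 1 ≤ b) (hc : 1 ≤ c) : ∃ F, IsMeromorphicContinuation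
      (fun (x : ℕ+ × ℕ+ × ℕ+) s => zetaA3Term x ![p, q, s, a, b, c]) F := by
  have key := exists_isMeromorphicContinuation_of_isHarmonic (ι := ℕ+ × ℕ+ × ℕ+)
    (form := fun x => x.2.2) (fun x => x.2.2.ne_zero)
    (w := fun x => invPow p x.1 * invPow q x.2.1 * invPow a (x.2.1 + x.1) *
      (invPow b (x.2.1 + x.2.2) * invPow c (x.2.1 + x.1 + x.2.2)))
    (fun s hs => summable_of_norm_le_inv_sq_mul_mul fun l m n => ?_) ?_
  · refine key.imp fun F hF => ?_
    convert hF using 1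
    funext x s
    simp [zetaA3Term, invPow, Complex.cpow_neg]
    ring
  · have hl := l.pos
    have hm := m.pos
    have hn := n.pos
    exact (norm_mul_le_of_le (norm_mul_le_of_le (norm_mul_le_of_le (norm_mul_le_of_le
      (norm_invPow_le_of_le hp hl le_rfl) (norm_invPow_le_of_le hq hm le_rfl))
      (norm_invPow_le_of_le ha hm (by dsimp only; omega))) (norm_mul_le_of_le
      (norm_invPow_le_one _ _) (norm_invPow_le_of_le hc hl (by dsimp only; omega))))
      (norm_natCast_cpow_neg_le (k := 2) (by push_cast; linarith) hn)).trans_eq (by ring)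
  · refine (IsHarmonic.coeff_simple hp hq ha hb hc).congr fun N hN => ?_
    refine tsum_fiber (form := fun x : ℕ+ × ℕ+ × ℕ+ => (x.2.2 : ℕ)) (fun x => invPow p x.1 *
      invPow q x.2.1 * invPow a (x.2.1 + x.1) * (invPow b (x.2.1 + x.2.2) *
      invPow c (x.2.1 + x.1 + x.2.2))) (fun x : ℕ × ℕ =>
      (x.2.succPNat, x.1.succPNat, ⟨N, Nat.pos_of_ne_zero hN⟩)) ?_ (fun _ => rfl) ?_
    · rintro ⟨x, y⟩ ⟨z, w⟩ h
      obtain ⟨h1, h2⟩ := Prod.mk.inj h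
      exact Prod.ext (Nat.succPNat_injective (Prod.mk.inj h2).1) (Nat.succPNat_injective h1)
    · rintro ⟨l, m, n⟩ h
      exact ⟨(m.natPred, l.natPred), Prod.ext (PNat.succPNat_natPred l)
        (Prod.ext (PNat.succPNat_natPred m) (PNat.eq h.symm))⟩

theorem exists_continuation_middle {p q a b c : ℕ} (hp : 1 ≤ p) (hq : 1 ≤ q) (ha : 1 ≤ a)
    (hb : 1 ≤ b) (hc : 1 ≤ c) : ∃ F, IsMeromorphicContinuation
      (fun (x : ℕ+ × ℕ+ × ℕ+) s => zetaA3Term x ![p, s, q, a, b, c]) F := by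
  have key := exists_isMeromorphicContinuation_of_isHarmonic (ι := ℕ+ × ℕ+ × ℕ+)
    (form := fun x => x.2.1) (fun x => x.2.1.ne_zero)
    (w := fun x => invPow p x.1 * invPow q x.2.2 * invPow a (x.1 + x.2.1) *
      (invPow b (x.2.2 + x.2.1) * invPow c (x.1 + x.2.1 + x.2.2)))
    (fun s hs => summable_of_norm_le_inv_sq_mul_mul fun l m n => ?_) ?_
  · refine key.imp fun F hF => ?_
    convert hF using 1
    funext x s
    simp [zetaA3Term, invPow, Complex.cpow_neg, add_comm]
    ring
  · have hl := l.pos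
    have hm := m.pos
    have hn := n.pos
    exact (norm_mul_le_of_le (norm_mul_le_of_le (norm_mul_le_of_le (norm_mul_le_of_le
      (norm_invPow_le_of_le hp hl le_rfl) (norm_invPow_le_of_le hq hn le_rfl))
      (norm_invPow_le_of_le ha hl (by dsimp only; omega))) (norm_mul_le_of_le
      (norm_invPow_le_one _ _) (norm_invPow_le_of_le hc hn (by dsimp only; omega))))
      (norm_natCast_cpow_neg_le (k := 2) (by push_cast; linarith) hm)).trans_eq (by ring)
  · refine (IsHarmonic.coeff_middle hp hq ha hb hc).congr fun N hN => ?_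
    refine tsum_fiber (form := fun x : ℕ+ × ℕ+ × ℕ+ => (x.2.1 : ℕ)) (fun x => invPow p x.1 *
      invPow q x.2.2 * invPow a (x.1 + x.2.1) * (invPow b (x.2.2 + x.2.1) *
      invPow c (x.1 + x.2.1 + x.2.2))) (fun x : ℕ × ℕ =>
      (x.1.succPNat, ⟨N, Nat.pos_of_ne_zero hN⟩, x.2.succPNat)) ?_ (fun _ => rfl) ?_
    · rintro ⟨x, y⟩ ⟨z, w⟩ h
      obtain ⟨h1, h2⟩ := Prod.mk.inj h
      exact Prod.ext (Nat.succPNat_injective h1) (Nat.succPNat_injective (Prod.mk.inj h2).2)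
    · rintro ⟨l, m, n⟩ h
      exact ⟨(l.natPred, n.natPred), Prod.ext (PNat.succPNat_natPred l)
        (Prod.ext (PNat.eq h.symm) (PNat.succPNat_natPred n))⟩

theorem exists_continuation_add {p q r b c : ℕ} (hp : 1 ≤ p) (hq : 1 ≤ q) (hr : 1 ≤ r)
    (hb : 1 ≤ b) (hc : 1 ≤ c) : ∃ F, IsMeromorphicContinuation
      (fun (x : ℕ+ × ℕ+ × ℕ+) s => zetaA3Term x ![p, q, r, s, b, c]) F := by
  have key := exists_isMeromorphicContinuation_of_isHarmonic (ι := ℕ+ × ℕ+ × ℕ+)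
    (form := fun x => x.1 + x.2.1) (fun x => by have := x.1.pos; omega)
    (w := fun x => invPow p x.1 * invPow q x.2.1 * invPow r x.2.2 *
      (invPow b (x.2.1 + x.2.2) * invPow c (x.1 + x.2.1 + x.2.2)))
    (fun s hs => summable_of_norm_le_inv_sq_mul_mul fun l m n => ?_) ?_
  · refine key.imp fun F hF => ?_
    convert hF using 1
    funext x s
    simp [zetaA3Term, invPow, Complex.cpow_neg]
    ring
  · have hl := l.pos
    have hm := m.pos
    have hn := n.pos
    have h1 := norm_natCast_cpow_neg_le (k := 2) (s := s) (by push_cast; linarith)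
      (show 1 ≤ (l : ℕ) + m by omega)
    -- Two powers of `l + m` are shared out, one to `l` and one to `m`, so that with `p`, `q` each
    -- index decays quadratically. In the case of `l + m + n` three powers are shared in the same
    -- way.
    have h2 : (((l : ℕ) + (m : ℕ) : ℕ) : ℝ)⁻¹ ^ 2 ≤ ((l : ℕ) : ℝ)⁻¹ * ((m : ℕ) : ℝ)⁻¹ := by
      rw [sq]
      have : (0 : ℝ) < ((l : ℕ) : ℝ) := by exact_mod_cast hl
      have : (0 : ℝ) < ((m : ℕ) : ℝ) := by exact_mod_cast hm
      gcongr <;> linarith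
    exact (norm_mul_le_of_le (norm_mul_le_of_le (norm_mul_le_of_le (norm_mul_le_of_le
      (norm_invPow_le_of_le hp hl le_rfl) (norm_invPow_le_of_le hq hm le_rfl))
      (norm_invPow_le_of_le hr hn le_rfl)) (norm_mul_le_of_le
      (norm_invPow_le_one _ _) (norm_invPow_le_of_le hc hn (by dsimp only; omega))))
      (h1.trans h2)).trans_eq (by ring)
  · refine (IsHarmonic.coeff_add (p := p) hq hr hb hc).congr fun N hN => ?_
    have hx : ∀ x : ↥(Finset.Ico 1 N), 0 < N - x.1 ∧ 0 < x.1 ∧ N - x.1 + x.1 = N := fun x => by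
      have := Finset.mem_Ico.mp x.2
      omega
    refine Eq.trans (tsum_congr fun x => ?_) (tsum_fiber (form := fun x : ℕ+ × ℕ+ × ℕ+ =>
      (x.1 + x.2.1 : ℕ)) (fun x => invPow p x.1 * invPow q x.2.1 * invPow r x.2.2 *
      (invPow b (x.2.1 + x.2.2) * invPow c (x.1 + x.2.1 + x.2.2)))
      (fun x : ↥(Finset.Ico 1 N) × ℕ =>
      (⟨N - x.1.1, (hx x.1).1⟩, ⟨x.1.1, (hx x.1).2.1⟩, x.2.succPNat)) ?_
      (fun x => (hx x.1).2.2) ?_)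
    · simp [(hx x.1).2.2]
    · rintro ⟨x, y⟩ ⟨z, w⟩ h
      obtain ⟨h1, h2⟩ := Prod.mk.inj (Prod.mk.inj h).2
      exact Prod.ext (Subtype.ext (congrArg PNat.val h1)) (Nat.succPNat_injective h2)
    · rintro ⟨l, m, n⟩ h
      have hl := l.pos
      have hm := m.pos
      dsimp only at h
      refine ⟨(⟨m, Finset.mem_Ico.mpr ⟨hm, by omega⟩⟩, n.natPred), ?_⟩
      refine Prod.ext (PNat.eq ?_) (Prod.ext rfl (by simp))
      show N - (m : ℕ) = l
      omega

theorem exists_continuation_total {p q r a b : ℕ} (hp : 1 ≤ p) (hq : 1 ≤ q) (hr : 1 ≤ r)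
    (ha : 1 ≤ a) (hb : 1 ≤ b) : ∃ F, IsMeromorphicContinuation
      (fun (x : ℕ+ × ℕ+ × ℕ+) s => zetaA3Term x ![p, q, r, a, b, s]) F := by
  have key := exists_isMeromorphicContinuation_of_isHarmonic (ι := ℕ+ × ℕ+ × ℕ+)
    (form := fun x => x.1 + x.2.1 + x.2.2) (fun x => by have := x.1.pos; omega)
    (w := fun x => invPow p x.1 * invPow r x.2.2 * invPow b (x.2.1 + x.2.2) *
      (invPow q x.2.1 * invPow a (x.1 + x.2.1)))
    (fun s hs => summable_of_norm_le_inv_sq_mul_mul fun l m n => ?_) ?_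
  · refine key.imp fun F hF => ?_
    convert hF using 1
    funext x s
    simp [zetaA3Term, invPow, Complex.cpow_neg]
    ring
  · have hl := l.pos
    have hm := m.pos
    have hn := n.pos
    have h1 := norm_natCast_cpow_neg_le (k := 3) (s := s) (by push_cast; linarith)
      (show 1 ≤ (l : ℕ) + m + n by omega)
    have h2 : (((l : ℕ) + (m : ℕ) + (n : ℕ) : ℕ) : ℝ)⁻¹ ^ 3 ≤
        ((l : ℕ) : ℝ)⁻¹ * ((m : ℕ) : ℝ)⁻¹ * ((n : ℕ) : ℝ)⁻¹ := by
      rw [pow_succ, sq]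
      have : (0 : ℝ) < ((l : ℕ) : ℝ) := by exact_mod_cast hl
      have : (0 : ℝ) < ((m : ℕ) : ℝ) := by exact_mod_cast hm
      have : (0 : ℝ) < ((n : ℕ) : ℝ) := by exact_mod_cast hn
      gcongr <;> linarith
    exact (norm_mul_le_of_le (norm_mul_le_of_le (norm_mul_le_of_le (norm_mul_le_of_le
      (norm_invPow_le_of_le hp hl le_rfl) (norm_invPow_le_of_le hr hn le_rfl))
      (norm_invPow_le_one _ _)) (norm_mul_le_of_le
      (norm_invPow_le_of_le hq hm le_rfl) (norm_invPow_le_one _ _)))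
      (h1.trans h2)).trans_eq (by ring)
  · refine (IsHarmonic.coeff_total hp hq hr ha hb).congr fun N hN => ?_
    have hx : ∀ x : ↥(IsHarmonic.pairsBelow N), 0 < x.1.1 ∧ 0 < N - x.1.1 - x.1.2 ∧ 0 < x.1.2 ∧
        N - x.1.1 - x.1.2 + x.1.2 = N - x.1.1 ∧ x.1.1 + (N - x.1.1 - x.1.2) = N - x.1.2 ∧
        x.1.1 + (N - x.1.1 - x.1.2) + x.1.2 = N := fun x => by
      have := IsHarmonic.mem_pairsBelow x.2
      omega
    refine Eq.trans (tsum_congr fun x => ?_) (tsum_fiber (form := fun x : ℕ+ × ℕ+ × ℕ+ =>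
      (x.1 + x.2.1 + x.2.2 : ℕ)) (fun x => invPow p x.1 * invPow r x.2.2 *
      invPow b (x.2.1 + x.2.2) * (invPow q x.2.1 * invPow a (x.1 + x.2.1)))
      (fun x : ↥(IsHarmonic.pairsBelow N) =>
      (⟨x.1.1, (hx x).1⟩, ⟨N - x.1.1 - x.1.2, (hx x).2.1⟩, ⟨x.1.2, (hx x).2.2.1⟩)) ?_
      (fun x => (hx x).2.2.2.2.2) ?_)
    · simp [(hx x).2.2.2.1, (hx x).2.2.2.2.1]
    · rintro ⟨⟨x, y⟩, h₁⟩ ⟨⟨z, w⟩, h₂⟩ h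
      obtain ⟨h1, h2⟩ := Prod.mk.inj h
      have e1 : x = z := congrArg PNat.val h1
      have e2 : y = w := congrArg PNat.val (Prod.mk.inj h2).2
      subst e1 e2
      rfl
    · rintro ⟨l, m, n⟩ h
      have hl := l.pos
      have hm := m.pos
      have hn := n.pos
      dsimp only at h
      refine ⟨⟨⟨l, n⟩, ?_⟩, ?_⟩
      · simp only [IsHarmonic.pairsBelow, Finset.mem_sigma, Finset.mem_Ico]
        omega
      · refine Prod.ext rfl (Prod.ext (PNat.eq ?_) rfl)
        show N - (l : ℕ) - n = m
        omega

/-- The symmetry `l ↔ n` of the root system. -/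
theorem exists_continuation_swap {e₀ e₁ e₂ e₃ e₄ e₅ : ℂ → ℂ}
    (h : ∃ F, IsMeromorphicContinuation (fun (x : ℕ+ × ℕ+ × ℕ+) s =>
      zetaA3Term x ![e₀ s, e₁ s, e₂ s, e₃ s, e₄ s, e₅ s]) F) :
    ∃ F, IsMeromorphicContinuation (fun (x : ℕ+ × ℕ+ × ℕ+) s =>
      zetaA3Term x ![e₂ s, e₁ s, e₀ s, e₄ s, e₃ s, e₅ s]) F := by
  obtain ⟨F, hF, σ, h⟩ := h
  refine ⟨F, hF, σ, fun s hs => ?_⟩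
  let t : ℕ+ × ℕ+ × ℕ+ ≃ ℕ+ × ℕ+ × ℕ+ :=
    { toFun := fun x => (x.2.2, x.2.1, x.1)
      invFun := fun x => (x.2.2, x.2.1, x.1)
      left_inv := fun _ => rfl
      right_inv := fun _ => rfl }
  refine (t.hasSum_iff.mpr (h s hs)).congr_fun fun x => ?_
  have e1 : ((x.1 : ℕ) : ℂ) + ((x.2.1 : ℕ) : ℂ) = (x.2.1 : ℕ) + (x.1 : ℕ) := add_comm _ _
  have e2 : ((x.2.1 : ℕ) : ℂ) + ((x.2.2 : ℕ) : ℂ) = (x.2.2 : ℕ) + (x.2.1 : ℕ) := add_comm _ _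
  have e3 : ((x.1 : ℕ) : ℂ) + ((x.2.1 : ℕ) : ℂ) + ((x.2.2 : ℕ) : ℂ) =
    (x.2.2 : ℕ) + (x.2.1 : ℕ) + (x.1 : ℕ) := by ring
  simp only [zetaA3Term, t, Function.comp_apply, Equiv.coe_fn_mk]
  rw [e3, e1, e2]
  simp only [Matrix.cons_val]
  congr 1
  ring

theorem exists_continuation_exponentsA3 {p q a b c : ℕ} (hp : 1 ≤ p) (hq : 1 ≤ q) (ha : 1 ≤ a)
    (hb : 1 ≤ b) (hc : 1 ≤ c) (i : Fin 12) : ∃ F, IsMeromorphicContinuation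
      (fun (x : ℕ+ × ℕ+ × ℕ+) s => zetaA3Term x (exponentsA3 p q a b c i s)) F := by
  -- The lemma for each case is decided by the slot that `s` occupies; slots `0` and `4` are reduced
  -- to `2` and `3` by the symmetry `l ↔ n`.
  fin_cases i
  · exact exists_continuation_simple hp hq ha hb hc
  · exact exists_continuation_simple hp ha hq hc hb
  · exact exists_continuation_swap (e₀ := fun _ => c) (e₁ := fun _ => a) (e₂ := fun _ => q)
      (e₃ := fun s => s) (e₄ := fun _ => p) (e₅ := fun _ => b)
      (exists_continuation_add hc ha hq hp hb)
  · exact exists_continuation_middle hq hc hb ha hp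
  · exact exists_continuation_swap (e₀ := fun _ => b) (e₁ := fun _ => q) (e₂ := fun _ => a)
      (e₃ := fun s => s) (e₄ := fun _ => p) (e₅ := fun _ => c)
      (exists_continuation_add hb hq ha hp hc)
  · exact exists_continuation_middle ha hb hc hq hp
  · exact exists_continuation_total ha hp hb hq hc
  · exact exists_continuation_add ha hc hb hp hq
  · exact exists_continuation_swap (e₀ := fun _ => p) (e₁ := fun _ => c) (e₂ := fun s => s)
      (e₃ := fun _ => b) (e₄ := fun _ => a) (e₅ := fun _ => q)
      (exists_continuation_simple hp hc hb ha hq)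
  · exact exists_continuation_total hq hp hc ha hb
  · exact exists_continuation_add hq hb hc hp ha
  · exact exists_continuation_swap (e₀ := fun _ => p) (e₁ := fun _ => b) (e₂ := fun s => s)
      (e₃ := fun _ => c) (e₄ := fun _ => q) (e₅ := fun _ => a)
      (exists_continuation_simple hp hb hc hq ha)


/-! ### The double sums `𝔗` and the Riemann zeta-function. -/

theorem norm_intCast_inv_pow_le (k : ℤ) {P : ℕ} (hP : 1 ≤ P) : ‖(k : ℂ)⁻¹ ^ P‖ ≤ |(k : ℝ)|⁻¹ := by
  rw [norm_pow, norm_inv, Complex.norm_intCast]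
  rcases eq_or_ne k 0 with rfl | hk
  · simp [show P ≠ 0 by omega]
  · have h1 : (1 : ℝ) ≤ |(k : ℝ)| := by exact_mod_cast Int.one_le_abs hk
    exact pow_le_of_le_one (by positivity) (inv_le_one_of_one_le₀ h1) (by omega)

theorem norm_inv_pow_mul_inv_pow_le (k : ℤ) {N P Q : ℕ} (hN : 1 ≤ N) (hP : 1 ≤ P) (hQ : 1 ≤ Q) :
    ‖(k : ℂ)⁻¹ ^ P * ((k : ℂ) + N)⁻¹ ^ Q‖ ≤ 2 * N * (1 / (k : ℝ) ^ 2) := by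
  rw [norm_mul]
  have h1 := norm_intCast_inv_pow_le k hP
  have h2 := norm_intCast_inv_pow_le (k + N) hQ
  push_cast at h2
  rcases eq_or_ne k 0 with rfl | hk
  · simp [show P ≠ 0 by omega]
  rcases eq_or_ne (k + N) 0 with hkN | hkN
  · have : (k : ℂ) + N = 0 := by exact_mod_cast hkN
    rw [this]
    simp [show Q ≠ 0 by omega]
    positivity
  have hk' : (0 : ℝ) < |(k : ℝ)| := by
    rw [abs_pos]
    exact_mod_cast hk
  have h3 : (1 : ℝ) ≤ |(k : ℝ) + N| := by exact_mod_cast Int.one_le_abs hkN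
  have hN' : (1 : ℝ) ≤ N := by exact_mod_cast hN
  have h4 : |(k : ℝ)| ≤ |(k : ℝ) + N| + N := by
    have := abs_sub ((k : ℝ) + N) N
    rw [add_sub_cancel_right, abs_of_nonneg (show (0 : ℝ) ≤ N by linarith)] at this
    exact this
  -- From `|k| ≤ |k + N| + N` and `|k + N| ≥ 1` follows `|k| ≤ 2 N |k + N|`. The loss of a factor
  -- `N` is paid for by the power `N ^ (-s)`.
  have h5 : |(k : ℝ) + N|⁻¹ ≤ 2 * N * |(k : ℝ)|⁻¹ := by
    rw [← div_eq_mul_inv, inv_le_comm₀ (by positivity) (by positivity), inv_div,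
      div_le_iff₀ (by positivity)]
    nlinarith
  calc ‖(k : ℂ)⁻¹ ^ P‖ * ‖((k : ℂ) + N)⁻¹ ^ Q‖ ≤ |(k : ℝ)|⁻¹ * (2 * N * |(k : ℝ)|⁻¹) :=
        mul_le_mul h1 (h2.trans h5) (norm_nonneg _) (by positivity)
    _ = 2 * N * (1 / (k : ℝ) ^ 2) := by
        rw [← sq_abs (k : ℝ)]
        field_simp

theorem summable_one_div_int_sq : Summable fun k : ℤ => 1 / (k : ℝ) ^ 2 :=
  Real.summable_one_div_int_pow.mpr one_lt_two

theorem summable_inv_pow_mul_inv_pow {N P Q : ℕ} (hN : 1 ≤ N) (hP : 1 ≤ P) (hQ : 1 ≤ Q) :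
    Summable fun k : ℤ => (k : ℂ)⁻¹ ^ P * ((k : ℂ) + N)⁻¹ ^ Q :=
  Summable.of_norm_bounded (summable_one_div_int_sq.mul_left (2 * (N : ℝ)))
    fun k => norm_inv_pow_mul_inv_pow_le k hN hP hQ

theorem hasSum_pnat_cpow_neg {s : ℂ} (hs : 1 < s.re) :
    HasSum (fun n : ℕ+ => ((n : ℕ) : ℂ) ^ (-s)) (riemannZeta s) := by
  have h1 := hasSum_LSeries_succ (LSeriesSummable_one_iff.mpr hs)
  rw [LSeries_one_eq_riemannZeta hs] at h1
  have h2 := (Equiv.pnatEquivNat.hasSum_iff).mpr h1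
  refine h2.congr_fun fun n => ?_
  simp only [Function.comp_apply, Equiv.pnatEquivNat, Equiv.coe_fn_mk, PNat.natPred_add_one,
    Pi.one_apply, one_div, Complex.cpow_neg]

/-- The value of `𝔗(P, s, Q; 1, 1)` in terms of the Riemann zeta-function. -/
noncomputable def tornheimValue (P Q : ℕ) (s : ℂ) : ℂ :=
  2 * (-1 : ℂ) ^ P * ∑ k ∈ Finset.range (P / 2 + 1), riemannZeta (2 * k) *
    ((P + Q - 1 - 2 * k).choose (Q - 1) : ℂ) * riemannZeta (s + P + Q - 2 * k) +
  2 * (-1 : ℂ) ^ P * ∑ k ∈ Finset.range (Q / 2 + 1), riemannZeta (2 * k) *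
    ((P + Q - 1 - 2 * k).choose (P - 1) : ℂ) * riemannZeta (s + P + Q - 2 * k)

/-- The sum over `l` is the two-pole line sum, a combination of powers of `1 / m`; weighted by `m ^
(-s)` and summed over `m`, each becomes a zeta value. The double sum runs over all integers `l`, as
the terms with `l = 0` or `l + m = 0` vanish by `0⁻¹ = 0`. -/
theorem hasSum_tornheim_int {P Q : ℕ} (hP : 1 ≤ P) (hQ : 1 ≤ Q) {s : ℂ} (hs : 3 < s.re) :
    HasSum (fun x : ℕ+ × ℤ => (x.2 : ℂ)⁻¹ ^ P * ((x.2 : ℂ) + (x.1 : ℕ))⁻¹ ^ Q *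
      ((x.1 : ℕ) : ℂ) ^ (-s)) (tornheimValue P Q s) := by
  have hsum : Summable fun x : ℕ+ × ℤ => (x.2 : ℂ)⁻¹ ^ P * ((x.2 : ℂ) + (x.1 : ℕ))⁻¹ ^ Q *
      ((x.1 : ℕ) : ℂ) ^ (-s) := by
    refine Summable.of_norm_bounded ((summable_pnat_inv_sq.mul_of_nonneg summable_one_div_int_sq
      (fun _ => by positivity) (fun _ => by positivity)).mul_left 2) fun x => ?_
    have hm : 1 ≤ (x.1 : ℕ) := x.1.pos
    have hm' : (((x.1 : ℕ)) : ℝ) ≠ 0 := by positivity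
    refine (norm_mul_le_of_le (norm_inv_pow_mul_inv_pow_le x.2 hm hP hQ)
      (norm_natCast_cpow_neg_le (k := 3) (by push_cast; linarith) hm)).trans_eq ?_
    field_simp
  have hfib : ∀ m : ℕ+, HasSum (fun l : ℤ => (l : ℂ)⁻¹ ^ P * ((l : ℂ) + (m : ℕ))⁻¹ ^ Q *
      ((m : ℕ) : ℂ) ^ (-s)) _ := fun m => by
    have h := hasSum_line_two hP hQ (m := ((m : ℕ) : ℤ)) (by exact_mod_cast m.ne_zero) (by
      simpa using summable_inv_pow_mul_inv_pow (N := m) m.pos hP hQ)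
    simp only [Int.cast_natCast] at h
    exact h.mul_right (((m : ℕ) : ℂ) ^ (-s))
  have h1 := hsum.hasSum.prod_fiberwise hfib
  have hpow : ∀ k : ℕ, 2 * k ≤ P ∨ 2 * k ≤ Q → HasSum (fun m : ℕ+ =>
      ((m : ℕ) : ℂ)⁻¹ ^ (P + Q - 2 * k) * ((m : ℕ) : ℂ) ^ (-s))
      (riemannZeta (s + P + Q - 2 * k)) := by
    intro k hk
    have e : s + P + Q - 2 * k = s + ((P + Q - 2 * k : ℕ) : ℂ) := by
      rw [Nat.cast_sub (by omega)]
      push_cast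
      ring
    rw [e]
    refine (hasSum_pnat_cpow_neg ?_).congr_fun fun m => ?_
    · have : (0 : ℝ) ≤ ((P + Q - 2 * k : ℕ) : ℝ) := Nat.cast_nonneg _
      simp only [Complex.add_re, Complex.natCast_re]
      linarith
    · have hm : ((m : ℕ) : ℂ) ≠ 0 := by exact_mod_cast m.ne_zero
      rw [neg_add, Complex.cpow_add _ _ hm, Complex.cpow_neg _ ((P + Q - 2 * k : ℕ) : ℂ),
        Complex.cpow_natCast, inv_pow, mul_comm]
  have h2 := ((hasSum_sum (s := Finset.range (P / 2 + 1)) fun k hk =>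
      (hpow k (Or.inl (by have := Finset.mem_range.mp hk; omega))).mul_left
        (riemannZeta (2 * k) * ((P + Q - 1 - 2 * k).choose (Q - 1) : ℂ))).mul_left
          (2 * (-1 : ℂ) ^ P)).add
    ((hasSum_sum (s := Finset.range (Q / 2 + 1)) fun k hk =>
      (hpow k (Or.inr (by have := Finset.mem_range.mp hk; omega))).mul_left
        (riemannZeta (2 * k) * ((P + Q - 1 - 2 * k).choose (P - 1) : ℂ))).mul_left
          (2 * (-1 : ℂ) ^ P))
  have h3 : ∑' x : ℕ+ × ℤ, (x.2 : ℂ)⁻¹ ^ P * ((x.2 : ℂ) + (x.1 : ℕ))⁻¹ ^ Q *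
      ((x.1 : ℕ) : ℂ) ^ (-s) = tornheimValue P Q s := by
    refine h1.unique (h2.congr_fun fun m => ?_)
    rw [add_mul, mul_assoc _ (Finset.sum _ _), Finset.sum_mul, mul_assoc _ (Finset.sum _ _),
      Finset.sum_mul]
    congr 2 <;> exact Finset.sum_congr rfl fun k _ => by ring
  rw [← h3]
  exact hsum.hasSum

theorem tornheimTerm_eq (P Q : ℕ) (i : TornheimIndex) (s : ℂ) : tornheimTerm P Q 1 1 i s =
    (i.1.1 : ℂ)⁻¹ ^ P * ((i.1.1 : ℂ) + (i.1.2 : ℕ))⁻¹ ^ Q * ((i.1.2 : ℕ) : ℂ) ^ (-s) := by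
  simp only [tornheimTerm, one_zpow, one_pow, mul_one, Complex.cpow_neg, inv_pow, one_div, mul_inv]
  ring

theorem hasSum_tornheimTerm {P Q : ℕ} (hP : 1 ≤ P) (hQ : 1 ≤ Q) {s : ℂ} (hs : 3 < s.re) :
    HasSum (fun i => tornheimTerm P Q 1 1 i s) (tornheimValue P Q s) := by
  simp only [tornheimTerm_eq]
  let f : ℤ × ℕ+ → ℂ := fun x => (x.1 : ℂ)⁻¹ ^ P * ((x.1 : ℂ) + (x.2 : ℕ))⁻¹ ^ Q *
    ((x.2 : ℕ) : ℂ) ^ (-s)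
  have h : HasSum f (tornheimValue P Q s) :=
    (Equiv.prodComm ℕ+ ℤ).hasSum_iff.mp (hasSum_tornheim_int hP hQ hs)
  refine (hasSum_subtype_iff_of_support_subset (s := {x : ℤ × ℕ+ | x.1 ≠ 0 ∧
    x.1 + ((x.2 : ℕ) : ℤ) ≠ 0}) fun x hx => ?_).mpr h
  refine ⟨fun h0 => hx ?_, fun h0 => hx ?_⟩
  · simp [f, h0, show P ≠ 0 by omega]
  · have : (x.1 : ℂ) + (x.2 : ℕ) = 0 := by exact_mod_cast h0
    simp [f, this, show Q ≠ 0 by omega]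

theorem analyticAt_tornheimValue {P Q : ℕ} {s : ℂ}
    (h : ∀ k ∈ Finset.range (max P Q / 2 + 1), s + P + Q - 2 * k ≠ 1) :
    AnalyticAt ℂ (tornheimValue P Q) s := by
  have hz : ∀ k : ℕ, k ≤ max P Q / 2 →
      AnalyticAt ℂ (fun z => riemannZeta (z + P + Q - 2 * k)) s := fun k hk =>
    AnalyticAt.fun_comp (g := riemannZeta) (f := fun z : ℂ => z + P + Q - 2 * k)
      (analyticAt_riemannZeta (h k (Finset.mem_range.mpr (by omega)))) (by fun_prop)
  unfold tornheimValue
  refine (analyticAt_const.fun_mul (Finset.analyticAt_fun_sum _ fun k hk => ?_)).fun_add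
    (analyticAt_const.fun_mul (Finset.analyticAt_fun_sum _ fun k hk => ?_))
  all_goals
    refine analyticAt_const.fun_mul (hz k ?_)
    have := Finset.mem_range.mp hk
    omega

theorem meromorphicOn_tornheimValue (P Q : ℕ) : MeromorphicOn (tornheimValue P Q) Set.univ := by
  intro s _
  have hz : ∀ k : ℕ, MeromorphicAt (fun z => riemannZeta (z + P + Q - 2 * k)) s := fun k =>
    MeromorphicAt.comp_analyticAt (f := riemannZeta) (g := fun z : ℂ => z + P + Q - 2 * k)
      (meromorphicAt_riemannZeta _) (by fun_prop)
  unfold tornheimValue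
  exact ((MeromorphicAt.const _ s).fun_mul (MeromorphicAt.fun_sum fun k _ =>
    (MeromorphicAt.const _ s).fun_mul (hz k))).fun_add
    ((MeromorphicAt.const _ s).fun_mul (MeromorphicAt.fun_sum fun k _ =>
      (MeromorphicAt.const _ s).fun_mul (hz k)))

theorem add_sub_two_mul_ne_one {P Q : ℕ} {s : ℂ} (hs : 3 < s.re) :
    ∀ k ∈ Finset.range (max P Q / 2 + 1), s + P + Q - 2 * k ≠ 1 := by
  intro k hk h
  have hk' : 2 * k ≤ P + Q := by
    have := Finset.mem_range.mp hk
    omega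
  have hk'' : (2 : ℝ) * k ≤ P + Q := by exact_mod_cast hk'
  have := congrArg Complex.re h
  simp at this
  linarith

theorem isMeromorphicContinuation_tornheim {P Q : ℕ} (hP : 1 ≤ P) (hQ : 1 ≤ Q) :
    IsMeromorphicContinuation (tornheimTerm P Q 1 1)
      (toMeromorphicNFOn (tornheimValue P Q) Set.univ) :=
  exists_isMeromorphicContinuation (meromorphicOn_tornheimValue P Q) 3
    (fun _ hs => analyticAt_tornheimValue (add_sub_two_mul_ne_one hs))
    fun _ hs => hasSum_tornheimTerm hP hQ hs

theorem IsMeromorphicContinuation.meromorphicContinuation_eq {ι : Type} {f : ι → ℂ → ℂ}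
    {F : ℂ → ℂ} (hF : IsMeromorphicContinuation f F) : meromorphicContinuation f = F := by
  have h : ∃ F, IsMeromorphicContinuation f F := ⟨F, hF⟩
  rw [meromorphicContinuation, dif_pos h]
  exact h.choose_spec.unique hF

theorem tornheimT_eq {P Q : ℕ} (hP : 1 ≤ P) (hQ : 1 ≤ Q) (s : ℂ) :
    tornheimT P s Q 1 1 = toMeromorphicNFOn (tornheimValue P Q) Set.univ s := by
  rw [tornheimT, (isMeromorphicContinuation_tornheim hP hQ).meromorphicContinuation_eq]

theorem tornheimT_eq_tornheimValue {P Q : ℕ} (hP : 1 ≤ P) (hQ : 1 ≤ Q) {s : ℂ}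
    (h : ∀ k ∈ Finset.range (max P Q / 2 + 1), s + P + Q - 2 * k ≠ 1) :
    tornheimT P s Q 1 1 = tornheimValue P Q s := by
  rw [tornheimT_eq hP hQ]
  exact toMeromorphicNFOn_eq_of_analyticAt (meromorphicOn_tornheimValue P Q) (Set.mem_univ s)
    (analyticAt_tornheimValue h)

theorem meromorphicAt_tornheimT {P Q : ℕ} (hP : 1 ≤ P) (hQ : 1 ≤ Q) (c s : ℂ) :
    MeromorphicAt (fun z => tornheimT P (z + c) Q 1 1) s := by
  simp only [tornheimT_eq hP hQ]
  exact ((meromorphicNFOn_toMeromorphicNFOn (tornheimValue P Q)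
    Set.univ).meromorphicOn.comp_add_const c) s (Set.mem_univ _)


/-! ### The triple lattice sum and its evaluation along lines. -/

/-- The general term of the triple sum over `N ≥ 1`, `m`, `l`. -/
noncomputable def latticeTerm (p q a b c : ℕ) (s : ℂ) (x : (ℕ+ × ℤ) × ℤ) : ℂ :=
  (x.2 : ℂ)⁻¹ ^ p * ((x.2 : ℂ) + x.1.2)⁻¹ ^ a * ((x.2 : ℂ) + x.1.2 + (x.1.1 : ℕ))⁻¹ ^ c *
    ((x.1.2 : ℂ)⁻¹ ^ q * ((x.1.2 : ℂ) + (x.1.1 : ℕ))⁻¹ ^ b * ((x.1.1 : ℕ) : ℂ) ^ (-s))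

theorem norm_line_le (l m : ℤ) {N p a c : ℕ} (hN : 1 ≤ N) (hp : 1 ≤ p) (ha : 1 ≤ a) (hc : 1 ≤ c) :
    ‖(l : ℂ)⁻¹ ^ p * ((l : ℂ) + m)⁻¹ ^ a * ((l : ℂ) + m + N)⁻¹ ^ c‖ ≤
      2 * N * (1 / ((l + m : ℤ) : ℝ) ^ 2) := by
  have h1 : ‖(l : ℂ)⁻¹ ^ p‖ ≤ 1 := by
    refine (norm_intCast_inv_pow_le l hp).trans ?_
    rcases eq_or_ne l 0 with rfl | hl
    · simp
    · exact inv_le_one_of_one_le₀ (by exact_mod_cast Int.one_le_abs hl)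
  have h2 := norm_inv_pow_mul_inv_pow_le (l + m) hN ha hc
  rw [Int.cast_add (R := ℂ)] at h2
  rw [mul_assoc]
  exact (norm_mul_le_of_le h1 h2).trans_eq (one_mul _)

theorem summable_latticeTerm {p q a b c : ℕ} (hp : 1 ≤ p) (hq : 1 ≤ q) (ha : 1 ≤ a)
    (hb : 1 ≤ b) (hc : 1 ≤ c) {s : ℂ} (hs : 4 < s.re) :
    Summable (latticeTerm p q a b c s) := by
  have h1 := (summable_pnat_inv_sq.mul_of_nonneg summable_one_div_int_sq
    (fun _ => by positivity) (fun _ => by positivity)).mul_of_nonneg summable_one_div_int_sq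
    (fun _ => mul_nonneg (by positivity) (by positivity)) (fun _ => by positivity)
  -- The majorant is `4 N⁻² m⁻² (l + m)⁻²`: two factors `2 N` from the two line bounds, against
  -- `N⁻⁴` from `4 < re s`. The shift `l ↦ l + m` makes it a product of independent series.
  have hinj : Function.Injective fun x : (ℕ+ × ℤ) × ℤ => (x.1, x.2 + x.1.2) := by
    rintro ⟨x, l⟩ ⟨y, k⟩ h
    obtain ⟨rfl, h2⟩ := Prod.mk.inj h
    exact Prod.ext rfl (add_right_cancel h2)
  refine Summable.of_norm_bounded ((h1.comp_injective hinj).mul_left 4) fun x => ?_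
  have hN : 1 ≤ (x.1.1 : ℕ) := x.1.1.pos
  have hN' : (((x.1.1 : ℕ)) : ℝ) ≠ 0 := by positivity
  refine (norm_mul_le_of_le (norm_line_le x.2 x.1.2 hN hp ha hc)
    (norm_mul_le_of_le (norm_inv_pow_mul_inv_pow_le x.1.2 hN hq hb)
      (norm_natCast_cpow_neg_le (k := 4) (by push_cast; linarith) hN))).trans_eq ?_
  simp only [Function.comp_apply]
  generalize 1 / ((x.2 + x.1.2 : ℤ) : ℝ) ^ 2 = A
  generalize 1 / (x.1.2 : ℝ) ^ 2 = B
  field_simp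
  ring

theorem hasSum_latticeTerm_fiber {p q a b c : ℕ} (hp : 1 ≤ p) (hq : 1 ≤ q) (ha : 1 ≤ a)
    (hb : 1 ≤ b) (hc : 1 ≤ c) (s : ℂ) (x : ℕ+ × ℤ) :
    HasSum (fun l : ℤ => latticeTerm p q a b c s (x, l))
      (lineSumThree p a c x.2 (x.1 : ℕ) *
        ((x.2 : ℂ)⁻¹ ^ q * ((x.2 : ℂ) + (x.1 : ℕ))⁻¹ ^ b * ((x.1 : ℕ) : ℂ) ^ (-s))) := by
  have hN : 1 ≤ (x.1 : ℕ) := x.1.pos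
  unfold latticeTerm
  -- The three-pole formula needs `m ≠ 0` and `m + N ≠ 0`. Otherwise the factor free of `l` is `0`,
  -- and so is every term of the line.
  by_cases h : (x.2 : ℂ)⁻¹ ^ q * ((x.2 : ℂ) + (x.1 : ℕ))⁻¹ ^ b = 0
  · simp only [h, zero_mul, mul_zero]
    exact hasSum_zero
  · rw [mul_eq_zero, not_or, pow_eq_zero_iff (by omega), pow_eq_zero_iff (by omega), inv_eq_zero,
      inv_eq_zero] at h
    have hsum : Summable fun l : ℤ =>
        (l : ℂ)⁻¹ ^ p * ((l : ℂ) + x.2)⁻¹ ^ a * ((l : ℂ) + x.2 + (x.1 : ℕ))⁻¹ ^ c := by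
      have h1 := (summable_one_div_int_sq.comp_injective (add_left_injective x.2)).mul_left
        (2 * ((x.1 : ℕ) : ℝ))
      exact Summable.of_norm_bounded h1 fun l => norm_line_le l x.2 hN hp ha hc
    have hline := hasSum_line_three hp ha hc (m := x.2) (n := ((x.1 : ℕ) : ℤ))
      (by exact_mod_cast h.1) (by omega) (by exact_mod_cast h.2)
      (by simpa only [Int.cast_natCast] using hsum)
    simp only [Int.cast_natCast] at hline
    exact hline.mul_right ((x.2 : ℂ)⁻¹ ^ q * ((x.2 : ℂ) + (x.1 : ℕ))⁻¹ ^ b *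
      ((x.1 : ℕ) : ℂ) ^ (-s))

/-- The monomials in `lineSumThree` only raise the exponents of `m`, `m + N` and `N` in the outer
double sum; this identifies the result as `𝔗` with shifted arguments. -/
theorem hasSum_tornheim_shift {q b : ℕ} (hq : 1 ≤ q) (hb : 1 ≤ b) (u v w : ℕ) {s : ℂ}
    (hs : 3 < s.re) : HasSum (fun x : ℕ+ × ℤ => (x.2 : ℂ)⁻¹ ^ u * ((x.1 : ℕ) : ℂ)⁻¹ ^ w *
      ((x.2 : ℂ) + (x.1 : ℕ))⁻¹ ^ v *
      ((x.2 : ℂ)⁻¹ ^ q * ((x.2 : ℂ) + (x.1 : ℕ))⁻¹ ^ b * ((x.1 : ℕ) : ℂ) ^ (-s)))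
      (tornheimT (q + u) (s + w) (b + v) 1 1) := by
  have hs' : 3 < (s + w).re := by
    have : (0 : ℝ) ≤ w := w.cast_nonneg
    simp only [Complex.add_re, Complex.natCast_re]
    linarith
  rw [tornheimT_eq_tornheimValue (by omega) (by omega) (add_sub_two_mul_ne_one hs')]
  refine (hasSum_tornheim_int (show 1 ≤ q + u by omega) (show 1 ≤ b + v by omega)
    hs').congr_fun fun x => ?_
  have hN : ((x.1 : ℕ) : ℂ) ≠ 0 := by exact_mod_cast x.1.ne_zero
  rw [neg_add, Complex.cpow_add _ _ hN, Complex.cpow_neg _ (w : ℂ), Complex.cpow_natCast, ← inv_pow]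
  ring

theorem hasSum_mul_sum_sum {ι : Type*} {W : ι → ℂ} (K : ℂ) (J : Finset ℕ) (Ω : ℕ → Finset ℕ)
    (z : ℕ → ℂ) (d : ℕ → ℕ → ℂ) (f : ℕ → ℕ → ι → ℂ) (t : ℕ → ℕ → ℂ)
    (h : ∀ j ∈ J, ∀ ω ∈ Ω j, HasSum (fun x => f j ω x * W x) (t j ω)) :
    HasSum (fun x => (K * ∑ j ∈ J, z j * ∑ ω ∈ Ω j, d j ω * f j ω x) * W x)
      (K * ∑ j ∈ J, z j * ∑ ω ∈ Ω j, d j ω * t j ω) := by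
  refine ((hasSum_sum fun j hj => (hasSum_sum fun ω hω =>
    (h j hj ω hω).mul_left (d j ω)).mul_left (z j)).mul_left K).congr_fun fun x => ?_
  rw [mul_assoc, Finset.sum_mul]
  congr 1
  refine Finset.sum_congr rfl fun j _ => ?_
  rw [mul_assoc, Finset.sum_mul]
  congr 1
  exact Finset.sum_congr rfl fun ω _ => by ring

/-- The right-hand side of the functional relation. -/
noncomputable def tornheimSide (p q a b c : ℕ) (s : ℂ) : ℂ :=
  2 * (-1 : ℂ) ^ p * ∑ j ∈ Finset.range (p / 2 + 1), riemannZeta (2 * j) *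
    ∑ ω ∈ Finset.range (p - 2 * j + 1),
      ((ω + a - 1).choose ω : ℂ) * ((p + c - 2 * j - ω - 1).choose (c - 1) : ℂ) *
        tornheimT (q + a + ω) s (p + b + c - 2 * j - ω) 1 1 +
  2 * (-1 : ℂ) ^ (p + a) * ∑ j ∈ Finset.range (c / 2 + 1), riemannZeta (2 * j) *
    ∑ ω ∈ Finset.range (c - 2 * j + 1),
      ((ω + a - 1).choose ω : ℂ) * ((p + c - 2 * j - ω - 1).choose (p - 1) : ℂ) *
        tornheimT q (s + a + ω) (p + b + c - 2 * j - ω) 1 1 +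
  2 * (-1 : ℂ) ^ p * ∑ j ∈ Finset.range (a / 2 + 1), riemannZeta (2 * j) *
    ∑ ω ∈ Finset.range p,
      ((ω + a - 2 * j).choose ω : ℂ) * ((p + c - 2 - ω).choose (c - 1) : ℂ) *
        tornheimT (q + a - 2 * j + ω + 1) s (p + b + c - 1 - ω) 1 1 +
  2 * (-1 : ℂ) ^ (p + a) * ∑ j ∈ Finset.range (a / 2 + 1), riemannZeta (2 * j) *
    ∑ ω ∈ Finset.range c,
      ((ω + a - 2 * j).choose ω : ℂ) * ((p + c - 2 - ω).choose (p - 1) : ℂ) *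
        tornheimT q (s + a - 2 * j + ω + 1) (p + b + c - ω - 1) 1 1

theorem hasSum_lineSumThree {p q a b c : ℕ} (hp : 1 ≤ p) (hq : 1 ≤ q)
    (hb : 1 ≤ b) (hc : 1 ≤ c) {s : ℂ} (hs : 3 < s.re) :
    HasSum (fun x : ℕ+ × ℤ => lineSumThree p a c x.2 (x.1 : ℕ) *
      ((x.2 : ℂ)⁻¹ ^ q * ((x.2 : ℂ) + (x.1 : ℕ))⁻¹ ^ b * ((x.1 : ℕ) : ℂ) ^ (-s)))
      (tornheimSide p q a b c s) := by
  have hm : ∀ u v : ℕ, HasSum (fun x : ℕ+ × ℤ => ((x.2 : ℂ)⁻¹ ^ u * ((x.2 : ℂ) + (x.1 : ℕ))⁻¹ ^ v) *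
      ((x.2 : ℂ)⁻¹ ^ q * ((x.2 : ℂ) + (x.1 : ℕ))⁻¹ ^ b * ((x.1 : ℕ) : ℂ) ^ (-s)))
      (tornheimT (q + u) s (b + v) 1 1) := fun u v => by
    simpa using hasSum_tornheim_shift hq hb u v 0 hs
  have hn : ∀ w v : ℕ, HasSum (fun x : ℕ+ × ℤ =>
      (((x.1 : ℕ) : ℂ)⁻¹ ^ w * ((x.2 : ℂ) + (x.1 : ℕ))⁻¹ ^ v) *
      ((x.2 : ℂ)⁻¹ ^ q * ((x.2 : ℂ) + (x.1 : ℕ))⁻¹ ^ b * ((x.1 : ℕ) : ℂ) ^ (-s)))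
      (tornheimT q (s + w) (b + v) 1 1) := fun w v => by
    simpa using hasSum_tornheim_shift hq hb 0 v w hs
  simp only [lineSumThree, add_mul]
  refine (((hasSum_mul_sum_sum _ _ _ _ _ _ _ fun j hj ω hω => ?_).add
    (hasSum_mul_sum_sum _ _ _ _ _ _ _ fun j hj ω hω => ?_)).add
    (hasSum_mul_sum_sum _ _ _ _ _ _ _ fun j hj ω hω => ?_)).add
    (hasSum_mul_sum_sum _ _ _ _ _ _ _ fun j hj ω hω => ?_) <;>
  have hj := Finset.mem_range.mp hj <;> have hω := Finset.mem_range.mp hω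
  · have := hm (a + ω) (p + c - 2 * j - ω)
    rwa [show q + (a + ω) = q + a + ω by omega,
      show b + (p + c - 2 * j - ω) = p + b + c - 2 * j - ω by omega] at this
  · have := hn (a + ω) (p + c - 2 * j - ω)
    rwa [show s + ((a + ω : ℕ) : ℂ) = s + a + ω by push_cast; ring,
      show b + (p + c - 2 * j - ω) = p + b + c - 2 * j - ω by omega] at this
  · have := hm (a - 2 * j + ω + 1) (p + c - 1 - ω)
    rwa [show q + (a - 2 * j + ω + 1) = q + a - 2 * j + ω + 1 by omega,
      show b + (p + c - 1 - ω) = p + b + c - 1 - ω by omega] at this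
  · have := hn (a - 2 * j + ω + 1) (p + c - 1 - ω)
    rwa [show s + ((a - 2 * j + ω + 1 : ℕ) : ℂ) = s + a - 2 * j + ω + 1 by
        push_cast [Nat.cast_sub (show 2 * j ≤ a by omega)]; ring,
      show b + (p + c - 1 - ω) = p + b + c - ω - 1 by omega] at this

theorem hasSum_latticeTerm {p q a b c : ℕ} (hp : 1 ≤ p) (hq : 1 ≤ q) (ha : 1 ≤ a)
    (hb : 1 ≤ b) (hc : 1 ≤ c) {s : ℂ} (hs : 4 < s.re) :
    HasSum (latticeTerm p q a b c s) (tornheimSide p q a b c s) := by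
  have h := (summable_latticeTerm hp hq ha hb hc hs).hasSum
  have h1 := h.prod_fiberwise fun x => hasSum_latticeTerm_fiber hp hq ha hb hc s x
  rwa [h1.unique (hasSum_lineSumThree hp hq hb hc (by linarith))] at h

/-! ### Decomposition into Weyl chambers. -/

/-- The parametrizations of the twelve Weyl chambers in `N > 0`. -/
def chamber (i : Fin 12) (x : ℕ+ × ℕ+ × ℕ+) : (ℕ+ × ℤ) × ℤ :=
  let (x, y, z) := x
  ![((z, (y : ℤ)), (x : ℤ)),
    ((z, x + y), -x),
    ((y + z, x), -(x + y)),
    ((y, x), -(x + y + z)),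
    ((y + z, -y), x + y),
    ((y, -(y + z)), x + y + z),
    ((x + y + z, -(x + y)), y),
    ((x + y, -(x + y + z)), y + z),
    ((x, -(x + y + z)), z),
    ((x + y + z, -x), -y),
    ((x + y, -x), -(y + z)),
    ((x, -(x + y)), -z)] i

/-- The signs of the five other linear forms. -/
def chamberSigns (x : (ℕ+ × ℤ) × ℤ) : Bool × Bool × Bool × Bool × Bool :=
  (decide (0 < x.2), decide (0 < x.1.2), decide (0 < x.2 + x.1.2), decide (0 < x.1.2 + x.1.1),
    decide (0 < x.2 + x.1.2 + x.1.1))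

theorem chamberSigns_chamber (i : Fin 12) (x : ℕ+ × ℕ+ × ℕ+) : chamberSigns (chamber i x) =
    ![(true, true, true, true, true), (false, true, true, true, true),
      (false, true, false, true, true), (false, true, false, true, false),
      (true, false, true, true, true), (true, false, true, false, true),
      (true, false, false, true, true), (true, false, false, false, true),
      (true, false, false, false, false), (false, false, false, true, true),
      (false, false, false, true, false), (false, false, false, false, false)] i := by
  obtain ⟨x, y, z⟩ := x
  have hx := x.pos
  have hy := y.pos
  have hz := z.pos
  fin_cases i <;>
    simp [chamber, chamberSigns] <;> omega

/-- The twelve sign vectors are distinct, so a common point forces a common chamber; within one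
chamber the parametrization is an injective linear map. -/
theorem chamber_injective : Function.Injective fun x : Fin 12 × (ℕ+ × ℕ+ × ℕ+) =>
    chamber x.1 x.2 := by
  rintro ⟨i, x⟩ ⟨j, y⟩ h
  have hij : i = j := by
    have h1 := congrArg chamberSigns h
    simp only [chamberSigns_chamber] at h1
    clear h
    revert h1
    revert i j
    decide
  subst hij
  obtain ⟨x₁, x₂, x₃⟩ := x
  obtain ⟨y₁, y₂, y₃⟩ := y
  fin_cases i <;> simp [chamber, ← PNat.coe_inj] at h ⊢ <;> omega

theorem exists_pnat_cast_eq {k : ℤ} (hk : 0 < k) : ∃ x : ℕ+, ((x : ℕ) : ℤ) = k :=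
  ⟨⟨k.toNat, by omega⟩, by simp; omega⟩

/-- Of the 32 sign patterns of the five forms, twenty are contradictory given `N > 0`. Each of the
other twelve is one chamber, with positive coordinates obtained by inverting its parametrization. -/
theorem exists_chamber_eq {N : ℕ+} {m l : ℤ} (h1 : l ≠ 0) (h2 : m ≠ 0) (h3 : l + m ≠ 0)
    (h4 : m + N ≠ 0) (h5 : l + m + N ≠ 0) :
    ∃ x : Fin 12 × (ℕ+ × ℕ+ × ℕ+), chamber x.1 x.2 = ((N, m), l) := by
  have hN := N.pos
  have key : ∀ (i : Fin 12) (X Y Z : ℤ), 0 < X → 0 < Y → 0 < Z →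
      (∀ x y z : ℕ+, (x : ℤ) = X → (y : ℤ) = Y → (z : ℤ) = Z → chamber i (x, y, z) = ((N, m), l)) →
      ∃ x : Fin 12 × (ℕ+ × ℕ+ × ℕ+), chamber x.1 x.2 = ((N, m), l) := by
    intro i X Y Z hX hY hZ h
    obtain ⟨x, hx⟩ := exists_pnat_cast_eq hX
    obtain ⟨y, hy⟩ := exists_pnat_cast_eq hY
    obtain ⟨z, hz⟩ := exists_pnat_cast_eq hZ
    exact ⟨(i, x, y, z), h x y z hx hy hz⟩
  rcases lt_or_gt_of_ne h1 with hl | hl <;> rcases lt_or_gt_of_ne h2 with hm | hm <;>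
    rcases lt_or_gt_of_ne h3 with hk | hk <;> rcases lt_or_gt_of_ne h4 with hmN | hmN <;>
    rcases lt_or_gt_of_ne h5 with hkN | hkN <;> first
    | omega
    | (refine key 0 l m N (by omega) (by omega) (by omega) fun x y z hx hy hz => ?_
       simp [chamber, ← PNat.coe_inj]; omega)
    | (refine key 1 (-l) (l + m) N (by omega) (by omega) (by omega) fun x y z hx hy hz => ?_
       simp [chamber, ← PNat.coe_inj]; omega)
    | (refine key 2 m (-(l + m)) (l + m + N) (by omega) (by omega) (by omega)
        fun x y z hx hy hz => ?_
       simp [chamber, ← PNat.coe_inj]; omega)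
    | (refine key 3 m N (-(l + m + N)) (by omega) (by omega) (by omega) fun x y z hx hy hz => ?_
       simp [chamber, ← PNat.coe_inj]; omega)
    | (refine key 4 (l + m) (-m) (m + N) (by omega) (by omega) (by omega) fun x y z hx hy hz => ?_
       simp [chamber, ← PNat.coe_inj]; omega)
    | (refine key 5 (l + m) N (-(m + N)) (by omega) (by omega) (by omega) fun x y z hx hy hz => ?_
       simp [chamber, ← PNat.coe_inj]; omega)
    | (refine key 6 (-(l + m)) l (m + N) (by omega) (by omega) (by omega) fun x y z hx hy hz => ?_
       simp [chamber, ← PNat.coe_inj]; omega)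
    | (refine key 7 (-(l + m)) (l + m + N) (-(m + N)) (by omega) (by omega) (by omega)
        fun x y z hx hy hz => ?_
       simp [chamber, ← PNat.coe_inj]; omega)
    | (refine key 8 N (-(l + m + N)) l (by omega) (by omega) (by omega) fun x y z hx hy hz => ?_
       simp [chamber, ← PNat.coe_inj]; omega)
    | (refine key 9 (-m) (-l) (l + m + N) (by omega) (by omega) (by omega)
        fun x y z hx hy hz => ?_
       simp [chamber, ← PNat.coe_inj]; omega)
    | (refine key 10 (-m) (m + N) (-(l + m + N)) (by omega) (by omega) (by omega)
        fun x y z hx hy hz => ?_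
       simp [chamber, ← PNat.coe_inj]; omega)
    | (refine key 11 N (-(m + N)) (-l) (by omega) (by omega) (by omega) fun x y z hx hy hz => ?_
       simp [chamber, ← PNat.coe_inj]; omega)


-- On each chamber the six forms `l, l+m, l+m+N, m, m+N, N` are plus or minus the six sums `X, Y, Z,
-- X+Y, Y+Z, X+Y+Z`. Which form lands on which sum fixes the arrangement of exponents, and the
-- negative forms supply the sign.
set_option linter.unusedSimpArgs false in
theorem latticeTerm_chamber (p q a b c : ℕ) (s : ℂ) (i : Fin 12) (x : ℕ+ × ℕ+ × ℕ+) :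
    latticeTerm p q a b c s (chamber i x) =
      (-1) ^ signA3 p q a b c i * zetaA3Term x (exponentsA3 p q a b c i s) := by
  obtain ⟨x, y, z⟩ := x
  have key : ∀ (i : Fin 12) (l k n m v N : ℂ), ((chamber i (x, y, z)).2 : ℂ) = l →
      ((chamber i (x, y, z)).1.2 : ℂ) = m → (((chamber i (x, y, z)).1.1 : ℕ) : ℂ) = N →
      l + m = k → k + N = n → m + N = v →
      latticeTerm p q a b c s (chamber i (x, y, z)) =
        l⁻¹ ^ p * k⁻¹ ^ a * n⁻¹ ^ c * (m⁻¹ ^ q * v⁻¹ ^ b * (N ^ s)⁻¹) := by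
    rintro i l k n m v N rfl rfl rfl rfl rfl rfl
    rw [latticeTerm, Complex.cpow_neg]
  set X : ℂ := ((x : ℕ) : ℂ) with hX
  set Y : ℂ := ((y : ℕ) : ℂ) with hY
  set Z : ℂ := ((z : ℕ) : ℂ) with hZ
  have hzeta : ∀ e : Fin 6 → ℂ, zetaA3Term (x, y, z) e = (X ^ e 0)⁻¹ * (Y ^ e 1)⁻¹ * (Z ^ e 2)⁻¹ *
      ((X + Y) ^ e 3)⁻¹ * ((Y + Z) ^ e 4)⁻¹ * ((X + Y + Z) ^ e 5)⁻¹ := fun e => by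
    simp only [zetaA3Term, one_div, mul_inv, hX, hY, hZ]
  rw [hzeta]
  fin_cases i
  · rw [key _ X (X + Y) (X + Y + Z) Y (Y + Z) Z
      (by simp [chamber, X, Y, Z]) (by simp [chamber, X, Y, Z]) (by simp [chamber, X, Y, Z])
      (by ring) (by ring) (by ring)]
    simp [exponentsA3, signA3, Complex.cpow_natCast, pow_add]
    ring
  · rw [key _ (-X) Y (Y + Z) (X + Y) (X + Y + Z) Z
      (by simp [chamber, X, Y, Z]) (by simp [chamber, X, Y, Z]) (by simp [chamber, X, Y, Z])
      (by ring) (by ring) (by ring)]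
    simp only [neg_inv_pow_eq]
    simp [exponentsA3, signA3, Complex.cpow_natCast, pow_add]
    ring
  · rw [key _ (-(X + Y)) (-Y) Z X (X + Y + Z) (Y + Z)
      (by simp [chamber, X, Y, Z]) (by simp [chamber, X, Y, Z]) (by simp [chamber, X, Y, Z])
      (by ring) (by ring) (by ring)]
    simp only [neg_inv_pow_eq]
    simp [exponentsA3, signA3, Complex.cpow_natCast, pow_add]
    ring
  · rw [key _ (-(X + Y + Z)) (-(Y + Z)) (-Z) X (X + Y) Y
      (by simp [chamber, X, Y, Z]) (by simp [chamber, X, Y, Z]) (by simp [chamber, X, Y, Z])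
      (by ring) (by ring) (by ring)]
    simp only [neg_inv_pow_eq]
    simp [exponentsA3, signA3, Complex.cpow_natCast, pow_add]
    ring
  · rw [key _ (X + Y) X (X + Y + Z) (-Y) Z (Y + Z)
      (by simp [chamber, X, Y, Z]) (by simp [chamber, X, Y, Z]) (by simp [chamber, X, Y, Z])
      (by ring) (by ring) (by ring)]
    simp only [neg_inv_pow_eq]
    simp [exponentsA3, signA3, Complex.cpow_natCast, pow_add]
    ring
  · rw [key _ (X + Y + Z) X (X + Y) (-(Y + Z)) (-Z) Y
      (by simp [chamber, X, Y, Z]) (by simp [chamber, X, Y, Z]) (by simp [chamber, X, Y, Z])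
      (by ring) (by ring) (by ring)]
    simp only [neg_inv_pow_eq]
    simp [exponentsA3, signA3, Complex.cpow_natCast, pow_add]
    ring
  · rw [key _ Y (-X) (Y + Z) (-(X + Y)) Z (X + Y + Z)
      (by simp [chamber, X, Y, Z]) (by simp [chamber, X, Y, Z]) (by simp [chamber, X, Y, Z])
      (by ring) (by ring) (by ring)]
    simp only [neg_inv_pow_eq]
    simp [exponentsA3, signA3, Complex.cpow_natCast, pow_add]
    ring
  · rw [key _ (Y + Z) (-X) Y (-(X + Y + Z)) (-Z) (X + Y)
      (by simp [chamber, X, Y, Z]) (by simp [chamber, X, Y, Z]) (by simp [chamber, X, Y, Z])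
      (by ring) (by ring) (by ring)]
    simp only [neg_inv_pow_eq]
    simp [exponentsA3, signA3, Complex.cpow_natCast, pow_add]
    ring
  · rw [key _ Z (-(X + Y)) (-Y) (-(X + Y + Z)) (-(Y + Z)) X
      (by simp [chamber, X, Y, Z]) (by simp [chamber, X, Y, Z]) (by simp [chamber, X, Y, Z])
      (by ring) (by ring) (by ring)]
    simp only [neg_inv_pow_eq]
    simp [exponentsA3, signA3, Complex.cpow_natCast, pow_add]
    ring
  · rw [key _ (-Y) (-(X + Y)) Z (-X) (Y + Z) (X + Y + Z)
      (by simp [chamber, X, Y, Z]) (by simp [chamber, X, Y, Z]) (by simp [chamber, X, Y, Z])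
      (by ring) (by ring) (by ring)]
    simp only [neg_inv_pow_eq]
    simp [exponentsA3, signA3, Complex.cpow_natCast, pow_add]
    ring
  · rw [key _ (-(Y + Z)) (-(X + Y + Z)) (-Z) (-X) Y (X + Y)
      (by simp [chamber, X, Y, Z]) (by simp [chamber, X, Y, Z]) (by simp [chamber, X, Y, Z])
      (by ring) (by ring) (by ring)]
    simp only [neg_inv_pow_eq]
    simp [exponentsA3, signA3, Complex.cpow_natCast, pow_add]
    ring
  · rw [key _ (-Z) (-(X + Y + Z)) (-(Y + Z)) (-(X + Y)) (-Y) X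
      (by simp [chamber, X, Y, Z]) (by simp [chamber, X, Y, Z]) (by simp [chamber, X, Y, Z])
      (by ring) (by ring) (by ring)]
    simp only [neg_inv_pow_eq]
    simp [exponentsA3, signA3, Complex.cpow_natCast, pow_add]
    ring

/-! ### The functional relation. -/

theorem isMeromorphicContinuation_zetaA3 {p q a b c : ℕ} (hp : 1 ≤ p) (hq : 1 ≤ q) (ha : 1 ≤ a)
    (hb : 1 ≤ b) (hc : 1 ≤ c) (i : Fin 12) : IsMeromorphicContinuation
      (fun (x : ℕ+ × ℕ+ × ℕ+) s => zetaA3Term x (exponentsA3 p q a b c i s))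
      (zetaA3 (exponentsA3 p q a b c i)) := by
  obtain ⟨F, hF⟩ := exists_continuation_exponentsA3 hp hq ha hb hc i
  rw [zetaA3, hF.meromorphicContinuation_eq]
  exact hF

/-- The left-hand side of the functional relation. -/
noncomputable def zetaSide (p q a b c : ℕ) (s : ℂ) : ℂ :=
  ∑ i : Fin 12, (-1 : ℂ) ^ signA3 p q a b c i * zetaA3 (exponentsA3 p q a b c i) s

/-- Both sides are the sum of the same absolutely convergent lattice series, once split over the
chambers and once summed along lines. -/
theorem exists_zetaSide_eq_tornheimSide {p q a b c : ℕ} (hp : 1 ≤ p) (hq : 1 ≤ q) (ha : 1 ≤ a)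
    (hb : 1 ≤ b) (hc : 1 ≤ c) : ∃ σ : ℝ, ∀ s : ℂ, σ < s.re →
      zetaSide p q a b c s = tornheimSide p q a b c s := by
  choose σ hσ using fun i => (isMeromorphicContinuation_zetaA3 hp hq ha hb hc i).2
  -- This exceeds `4`, needed for the lattice sum, and every half-plane bound `σ i` of the twelve
  -- series.
  refine ⟨4 + ∑ i, |σ i|, fun s hs => ?_⟩
  have h0 : ∀ i, 0 ≤ |σ i| := fun i => abs_nonneg _
  have hsum : 0 ≤ ∑ i, |σ i| := Finset.sum_nonneg fun i _ => h0 i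
  have hi : ∀ i, σ i < s.re := fun i => by
    have h1 := Finset.single_le_sum (f := fun i => |σ i|) (fun i _ => h0 i) (Finset.mem_univ i)
    have h2 := le_abs_self (σ i)
    linarith
  have h := hasSum_latticeTerm hp hq ha hb hc (show 4 < s.re by linarith)
  have hoff : ∀ x ∉ Set.range fun x : Fin 12 × (ℕ+ × ℕ+ × ℕ+) => chamber x.1 x.2,
      latticeTerm p q a b c s x = 0 := by
    rintro ⟨⟨N, m⟩, l⟩ hx
    by_contra hne
    have hne' : ((l : ℂ) ≠ 0 ∧ (l : ℂ) + m ≠ 0 ∧ (l : ℂ) + m + (N : ℕ) ≠ 0) ∧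
        (m : ℂ) ≠ 0 ∧ (m : ℂ) + (N : ℕ) ≠ 0 := by
      refine ⟨⟨fun h => hne ?_, fun h => hne ?_, fun h => hne ?_⟩, fun h => hne ?_, fun h => hne ?_⟩
      all_goals
        simp only [latticeTerm, h, inv_zero, zero_pow (show p ≠ 0 by omega),
          zero_pow (show q ≠ 0 by omega), zero_pow (show a ≠ 0 by omega),
          zero_pow (show b ≠ 0 by omega), zero_pow (show c ≠ 0 by omega), zero_mul, mul_zero]
    obtain ⟨⟨h1, h2, h3⟩, h4, h5⟩ := hne'
    exact hx (exists_chamber_eq (by exact_mod_cast h1) (by exact_mod_cast h4)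
      (by exact_mod_cast h2) (by exact_mod_cast h5) (by exact_mod_cast h3))
  have h1 := ((chamber_injective.hasSum_iff hoff).mpr h).prod_fiberwise
    (g := fun i => (-1 : ℂ) ^ signA3 p q a b c i * zetaA3 (exponentsA3 p q a b c i) s) fun i => by
      simp only [Function.comp_apply, latticeTerm_chamber]
      exact (hσ i s (hi i)).mul_left _
  exact (hasSum_fintype _).unique h1

theorem meromorphicOn_zetaSide {p q a b c : ℕ} (hp : 1 ≤ p) (hq : 1 ≤ q) (ha : 1 ≤ a)
    (hb : 1 ≤ b) (hc : 1 ≤ c) : MeromorphicOn (zetaSide p q a b c) Set.univ := by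
  intro s _
  exact MeromorphicAt.fun_sum fun i _ => (MeromorphicAt.const _ s).fun_mul
    ((isMeromorphicContinuation_zetaA3 hp hq ha hb hc i).1.meromorphicOn s (Set.mem_univ s))

theorem meromorphicOn_tornheimSide {p q a b c : ℕ} (hp : 1 ≤ p) (hq : 1 ≤ q)
    (hb : 1 ≤ b) (hc : 1 ≤ c) : MeromorphicOn (tornheimSide p q a b c) Set.univ := by
  intro s _
  have h0 : ∀ {P Q : ℕ}, 1 ≤ P → 1 ≤ Q → MeromorphicAt (fun z => tornheimT P z Q 1 1) s :=
    fun hP hQ => by simpa using meromorphicAt_tornheimT hP hQ 0 s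
  unfold tornheimSide
  refine ((MeromorphicAt.fun_add ?_ ?_).fun_add ?_).fun_add ?_ <;>
    refine (MeromorphicAt.const _ s).fun_mul (MeromorphicAt.fun_sum fun j hj =>
      (MeromorphicAt.const _ s).fun_mul (MeromorphicAt.fun_sum fun ω hω =>
        (MeromorphicAt.const _ s).fun_mul ?_)) <;>
    have hj := Finset.mem_range.mp hj <;> have hω := Finset.mem_range.mp hω
  · exact h0 (by omega) (by omega)
  · simpa only [add_assoc] using meromorphicAt_tornheimT hq (by omega) ((a : ℂ) + ω) s
  · exact h0 (by omega) (by omega)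
  · have := meromorphicAt_tornheimT (P := q) (Q := p + b + c - ω - 1) hq (by omega)
      ((a : ℂ) - 2 * j + ω + 1) s
    refine this.congr (Eventually.of_forall fun z => ?_)
    simp only
    congr 1
    ring

/-- The identity theorem gives equality near `s` except perhaps at `s`. Analyticity of both sides at
`s` extends it to the point itself; at a pole the conventional values need not satisfy the relation.
-/
theorem zetaSide_eq_tornheimSide {p q a b c : ℕ} (hp : 1 ≤ p) (hq : 1 ≤ q) (ha : 1 ≤ a)
    (hb : 1 ≤ b) (hc : 1 ≤ c) {s : ℂ} (hl : AnalyticAt ℂ (zetaSide p q a b c) s)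
    (hr : AnalyticAt ℂ (tornheimSide p q a b c) s) :
    zetaSide p q a b c s = tornheimSide p q a b c s := by
  obtain ⟨σ, h⟩ := exists_zetaSide_eq_tornheimSide hp hq ha hb hc
  have hy : σ < ((σ + 1 : ℝ) : ℂ).re := by simp
  have := MeromorphicOn.eventuallyEq_of_isPreconnected (meromorphicOn_zetaSide hp hq ha hb hc)
    (meromorphicOn_tornheimSide hp hq hb hc) isPreconnected_univ (Set.mem_univ _)
    (eventuallyEq_nhdsNE_of_forall_re_lt h hy) (Set.mem_univ s)
  exact ((hl.meromorphicNFAt.eventuallyEq_nhdsNE_iff_eventuallyEq_nhds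
    hr.meromorphicNFAt).mp this).eq_of_nhds

end

open Finset in
theorem mainTheorem1 (p q a b c : ℕ)
    (hp : 1 ≤ p) (hq : 1 ≤ q) (ha : 1 ≤ a) (hb : 1 ≤ b) (hc : 1 ≤ c) :
    -- all the functions of the complex variable `s` involved exist on the whole plane
    (∀ i : Fin 12, ∃ F, IsMeromorphicContinuation
      (fun (x : ℕ+ × ℕ+ × ℕ+) s => zetaA3Term x (exponentsA3 p q a b c i s)) F) ∧
    (∀ P Q : ℕ, 1 ≤ P → 1 ≤ Q → ∃ F, IsMeromorphicContinuation (tornheimTerm P Q 1 1) F) ∧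
    -- the functional relation, at every `s` where no function on either side is singular
    (∀ s : ℂ,
      (∀ i : Fin 12, AnalyticAt ℂ (zetaA3 (exponentsA3 p q a b c i)) s) →
      (∀ j ∈ range (p / 2 + 1), ∀ ω ∈ range (p - 2 * j + 1),
        AnalyticAt ℂ (fun z => tornheimT (q + a + ω) z (p + b + c - 2 * j - ω) 1 1) s) →
      (∀ j ∈ range (c / 2 + 1), ∀ ω ∈ range (c - 2 * j + 1),
        AnalyticAt ℂ (fun z => tornheimT q (z + a + ω) (p + b + c - 2 * j - ω) 1 1) s) →
      (∀ j ∈ range (a / 2 + 1), ∀ ω ∈ range p,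
        AnalyticAt ℂ (fun z => tornheimT (q + a - 2 * j + ω + 1) z (p + b + c - 1 - ω) 1 1) s) →
      (∀ j ∈ range (a / 2 + 1), ∀ ω ∈ range c,
        AnalyticAt ℂ (fun z =>
          tornheimT q (z + a - 2 * j + ω + 1) (p + b + c - ω - 1) 1 1) s) →
      ∑ i : Fin 12, (-1 : ℂ) ^ signA3 p q a b c i * zetaA3 (exponentsA3 p q a b c i) s =
        2 * (-1 : ℂ) ^ p * ∑ j ∈ range (p / 2 + 1), riemannZeta (2 * j) *
          ∑ ω ∈ range (p - 2 * j + 1),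
            ((ω + a - 1).choose ω : ℂ) * ((p + c - 2 * j - ω - 1).choose (c - 1) : ℂ) *
              tornheimT (q + a + ω) s (p + b + c - 2 * j - ω) 1 1 +
        2 * (-1 : ℂ) ^ (p + a) * ∑ j ∈ range (c / 2 + 1), riemannZeta (2 * j) *
          ∑ ω ∈ range (c - 2 * j + 1),
            ((ω + a - 1).choose ω : ℂ) * ((p + c - 2 * j - ω - 1).choose (p - 1) : ℂ) *
              tornheimT q (s + a + ω) (p + b + c - 2 * j - ω) 1 1 +
        2 * (-1 : ℂ) ^ p * ∑ j ∈ range (a / 2 + 1), riemannZeta (2 * j) *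
          ∑ ω ∈ range p,
            ((ω + a - 2 * j).choose ω : ℂ) * ((p + c - 2 - ω).choose (c - 1) : ℂ) *
              tornheimT (q + a - 2 * j + ω + 1) s (p + b + c - 1 - ω) 1 1 +
        2 * (-1 : ℂ) ^ (p + a) * ∑ j ∈ range (a / 2 + 1), riemannZeta (2 * j) *
          ∑ ω ∈ range c,
            ((ω + a - 2 * j).choose ω : ℂ) * ((p + c - 2 - ω).choose (p - 1) : ℂ) *
              tornheimT q (s + a - 2 * j + ω + 1) (p + b + c - ω - 1) 1 1) ∧
    -- the double sums on the right-hand side are expressed by the Riemann zeta-function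
    (∀ P Q : ℕ, 1 ≤ P → 1 ≤ Q → ∀ s : ℂ,
      (∀ k ∈ range (max P Q / 2 + 1), s + P + Q - 2 * k ≠ 1) →
      tornheimT P s Q 1 1 =
        2 * (-1 : ℂ) ^ P * ∑ k ∈ range (P / 2 + 1), riemannZeta (2 * k) *
          ((P + Q - 1 - 2 * k).choose (Q - 1) : ℂ) * riemannZeta (s + P + Q - 2 * k) +
        2 * (-1 : ℂ) ^ P * ∑ k ∈ range (Q / 2 + 1), riemannZeta (2 * k) *
          ((P + Q - 1 - 2 * k).choose (P - 1) : ℂ) * riemannZeta (s + P + Q - 2 * k)) := by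
  refine ⟨exists_continuation_exponentsA3 hp hq ha hb hc, fun P Q hP hQ =>
    ⟨_, isMeromorphicContinuation_tornheim hP hQ⟩, fun s hl h1 h2 h3 h4 => ?_,
    fun P Q hP hQ s hs => tornheimT_eq_tornheimValue hP hQ hs⟩
  -- If none of the individual functions is singular at `s`, both finite combinations are analytic
  -- there.
  refine zetaSide_eq_tornheimSide hp hq ha hb hc
    (Finset.analyticAt_fun_sum _ fun i _ => analyticAt_const.fun_mul (hl i)) ?_
  unfold tornheimSide
  refine ((AnalyticAt.fun_add ?_ ?_).fun_add ?_).fun_add ?_ <;>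
    refine analyticAt_const.fun_mul (Finset.analyticAt_fun_sum _ fun j hj =>
      analyticAt_const.fun_mul (Finset.analyticAt_fun_sum _ fun ω hω =>
        analyticAt_const.fun_mul ?_))
  · exact h1 j hj ω hω
  · exact h2 j hj ω hω
  · exact h3 j hj ω hω
  · exact h4 j hj ω hω
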